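/- Conventions. A Lie groupoid $X_1\rightrightarrows X_0$ has source and target submersions $s,t$, manifold $X_2=\{(p,q)\in X_1\times X_1: s(p)=t(q)\}$ of composable pairs and composition $m:X_2\to X_1$, $m(p,q)=p*q$; all manifolds are smooth, finite-dimensional and without boundary. Identifying composable pairs with commutative triangles, the symmetric group $S_3$ acts on $X_2$ by permuting vertices. For a Riemannian metric $\eta$, $\eta^*$ denotes the dual metric on covectors. A metric $\eta$ is transverse to a surjective submersion $\pi$ if for any two points $e_1,e_2$ of one fibre $d\pi(e_1)^*\circ(d\pi(e_2)^*)^{-1}$ is an isometry, for $\eta^*$, from the annihilator of $\ker d\pi(e_2)$ to that of $\ker d\pi(e_1)$. A groupoid metric on $X_1\rightrightarrows X_0$ is a Riemannian metric $\eta=\eta^{(2)}$ on $X_2$ that is $S_3$-invariant and transverse to $m$; it induces metrics $\eta^{(1)}$ on $X_1$ and $\eta^{(0)}$ on $X_0$ for which the two projections and $m:X_2\to X_1$, and $s,t:X_1\to X_0$, are Riemannian submersions. A Lie 2-group is a Lie groupoid $G_1\rightrightarrows G_0$ in which $G_0,G_1$ are Lie groups and all structural maps are group homomorphisms ($G_2\subset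 G_1\times G_1$ having the induced group structure). A 2-action $\theta=(\theta^1,\theta^0)$ of it on $X_1\rightrightarrows X_0$ consists of smooth left actions of $G_1$ on $X_1$ and of $G_0$ on $X_0$ that form a Lie groupoid morphism from $G_1\times X_1\rightrightarrows G_0\times X_0$ to $X_1\rightrightarrows X_0$; it induces an action $\theta^2$ of $G_2$ on $X_2$, $(g,h)\cdot(p,q)=(gp,hq)$. It is isometric for a groupoid metric $\eta$ if $G_2$ acts on $(X_2,\eta)$ by isometries. Theorem. Let $\theta$ be a 2-action of a Lie 2-group $G_1\rightrightarrows G_0$ with $G_1$ compact on a Lie groupoid $X_1\rightrightarrows X_0$, and let $\mu_j$ be the normalized Haar measure on $G_j$, $j=0,1,2$. (1) For every groupoid metric $\eta$ on $X_1\rightrightarrows X_0$ there is a groupoid metric $\overline\eta$ on $X_1\rightrightarrows X_0$ for which $\theta$ is isometric and which is given by dual averaging: $$\overline\eta^{\,*}_z(\alpha,\beta)=\int_{G_2}\eta^*_{az}\bigl(\alpha\circ(d\theta^2_a(z))^{-1},\ \beta\circ(d\theta^2_a(z))^{-1}\bigr)\,d\mu_2(a)\qquad(z\in X_2,\ \alpha,\beta\in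 T_z^*X_2).$$ Moreover, the metrics $\overline\eta^{(1)}$ and $\overline\eta^{(0)}$ induced by $\overline\eta$ on $X_1$ and $X_0$ are obtained by the same formula from $\eta^{(1)}$, $\theta^1$, $\mu_1$ and from $\eta^{(0)}$, $\theta^0$, $\mu_0$, respectively. (2) If $X_1\rightrightarrows X_0$ is a proper groupoid ($X_0$, $X_1$ are Hausdorff and second countable, and $(s,t):X_1\to X_0\times X_0$ is a proper map), then there exists a groupoid metric on $X_1\rightrightarrows X_0$ for which $\theta$ is isometric. -/

import Mathlib

open scoped Manifold ContDiff
open MeasureTheory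

noncomputable section

section Metric

variable {E X E' X' : Type*}
  [NormedAddCommGroup E] [NormedSpace ℝ E] [FiniteDimensional ℝ E]
  [TopologicalSpace X] [ChartedSpace E X] [IsManifold 𝓘(ℝ, E) ∞ X]
  [NormedAddCommGroup E'] [NormedSpace ℝ E'] [FiniteDimensional ℝ E']
  [TopologicalSpace X'] [ChartedSpace E' X'] [IsManifold 𝓘(ℝ, E') ∞ X']

/-- Smooth Riemannian metrics on a smooth manifold `X` modelled on `E`. -/
abbrev RiemMetric (E X : Type*)
    [NormedAddCommGroup E] [NormedSpace ℝ E]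
    [TopologicalSpace X] [ChartedSpace E X] [IsManifold 𝓘(ℝ, E) ∞ X] : Type _ :=
  Bundle.ContMDiffRiemannianMetric 𝓘(ℝ, E) ∞ E (fun x : X => TangentSpace 𝓘(ℝ, E) x)

namespace RiemMetric

theorem exists_sharp (η : RiemMetric E X) (x : X) (α : TangentSpace 𝓘(ℝ, E) x →L[ℝ] ℝ) :
    ∃ v : TangentSpace 𝓘(ℝ, E) x, ∀ w, η.inner x v w = α w := by
  have : FiniteDimensional ℝ (TangentSpace 𝓘(ℝ, E) x) := ‹FiniteDimensional ℝ E›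
  let f : TangentSpace 𝓘(ℝ, E) x →ₗ[ℝ] Module.Dual ℝ (TangentSpace 𝓘(ℝ, E) x) :=
    { toFun := fun v => (η.inner x v).toLinearMap
      map_add' := fun v w => by ext u; simp
      map_smul' := fun c v => by ext u; simp }
  have hinj : Function.Injective f := by
    rw [← LinearMap.ker_eq_bot, LinearMap.ker_eq_bot']
    intro v hv
    by_contra hne
    have h1 := η.pos x v hne
    have h2 : η.inner x v v = 0 := LinearMap.congr_fun hv v
    exact absurd h2 h1.ne'
  have hsurj : Function.Surjective f :=
    (LinearMap.injective_iff_surjective_of_finrank_eq_finrank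
      (Subspace.dual_finrank_eq (K := ℝ)).symm).1 hinj
  obtain ⟨v, hv⟩ := hsurj α.toLinearMap
  exact ⟨v, fun w => LinearMap.congr_fun hv w⟩

/-- The tangent vector `α♯` representing the covector `α`, that is, `η(α♯, ·) = α`. -/
def sharp (η : RiemMetric E X) (x : X) (α : TangentSpace 𝓘(ℝ, E) x →L[ℝ] ℝ) :
    TangentSpace 𝓘(ℝ, E) x :=
  (η.exists_sharp x α).choose

/-- The dual (cotangent) metric `η*_x(α, β) = η_x(α♯, β♯)`. -/
def dual (η : RiemMetric E X) (x : X) (α β : TangentSpace 𝓘(ℝ, E) x →L[ℝ] ℝ) : ℝ :=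
  η.inner x (η.sharp x α) (η.sharp x β)

/-- `f` preserves the metric `η`; a diffeomorphism with this property is an isometry of `η`. -/
def IsPreservedBy (η : RiemMetric E X) (f : X → X) : Prop :=
  ∀ (x : X) (v w : TangentSpace 𝓘(ℝ, E) x),
    η.inner (f x) (mfderiv 𝓘(ℝ, E) 𝓘(ℝ, E) f x v) (mfderiv 𝓘(ℝ, E) 𝓘(ℝ, E) f x w) =
      η.inner x v w

/-- Transversality of `η` to a submersion `π : X → X'`: for two points `x`, `y` of one fibre,
the map `dπ(x)* ∘ (dπ(y)*)⁻¹` is an isometry between the annihilators of the tangent spaces of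
the fibre at `y` and `x`. The elements of the two annihilators that correspond to each other are
the pullbacks of one covector at `π x = π y`, which is written here as the value of a
(set-theoretic) section `α` or `β` of the cotangent bundle of `X'`. -/
def IsTransverse (η : RiemMetric E X) (π : X → X') : Prop :=
  ∀ x y : X, π x = π y → ∀ α β : ∀ b : X', TangentSpace 𝓘(ℝ, E') b →L[ℝ] ℝ,
    η.dual x ((α (π x)).comp (mfderiv 𝓘(ℝ, E) 𝓘(ℝ, E') π x))
        ((β (π x)).comp (mfderiv 𝓘(ℝ, E) 𝓘(ℝ, E') π x)) =
      η.dual y ((α (π y)).comp (mfderiv 𝓘(ℝ, E) 𝓘(ℝ, E') π y))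
        ((β (π y)).comp (mfderiv 𝓘(ℝ, E) 𝓘(ℝ, E') π y))

/-- The smooth map `π : (X, η) → (X', η')` is a Riemannian submersion, in cotangent form: for
every `x`, the map `dπ(x)*` is an isometry from the cotangent space at `π x` onto the annihilator
of `ker dπ(x)`. (In particular `dπ(x)*` is injective, so `dπ(x)` is surjective.)
In other words, `η'` is the push-forward metric of `η`. -/
def IsRiemannianSubmersion (η : RiemMetric E X) (η' : RiemMetric E' X') (π : X → X') : Prop :=
  ∀ (x : X) (α β : TangentSpace 𝓘(ℝ, E') (π x) →L[ℝ] ℝ),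
    η.dual x (α.comp (mfderiv 𝓘(ℝ, E) 𝓘(ℝ, E') π x))
        (β.comp (mfderiv 𝓘(ℝ, E) 𝓘(ℝ, E') π x)) =
      η'.dual (π x) α β

/-- `η'` is the cotangent average of `η` along the diffeomorphisms `act g` of `X`:
`η'* = ∫ (act g)^* η* dμ(g)`, where a covector `α` at `x` is transported to the point `act g x`
as `α ∘ (d(act g)(x))⁻¹`. -/
def IsCotangentAverage {Γ : Type*} [MeasurableSpace Γ] (η' η : RiemMetric E X)
    (act : Γ → X → X) (μ : Measure Γ) : Prop :=
  ∀ (x : X) (α β : TangentSpace 𝓘(ℝ, E) x →L[ℝ] ℝ),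
    Integrable (fun g => η.dual (act g x)
      (α.comp (mfderiv 𝓘(ℝ, E) 𝓘(ℝ, E) (act g) x).inverse)
      (β.comp (mfderiv 𝓘(ℝ, E) 𝓘(ℝ, E) (act g) x).inverse)) μ ∧
    η'.dual x α β = ∫ g, η.dual (act g x)
      (α.comp (mfderiv 𝓘(ℝ, E) 𝓘(ℝ, E) (act g) x).inverse)
      (β.comp (mfderiv 𝓘(ℝ, E) 𝓘(ℝ, E) (act g) x).inverse) ∂μ

end RiemMetric

end Metric

/-- A Lie groupoid `X₁ ⇉ X₀`. The manifold `X₂` of composable pairs is the embedded submanifold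
`{(p, q) | src p = tgt q}` of `X₁ × X₁`: it is given as a manifold together with a smooth
embedding `pair` whose image is the set of composable pairs, which determines it up to a unique
diffeomorphism. (Surjectivity of `src` and `tgt` follows from the laws for `unit`.) -/
structure LieGroupoid (E₀ E₁ E₂ X₀ X₁ X₂ : Type*)
    [NormedAddCommGroup E₀] [NormedSpace ℝ E₀] [TopologicalSpace X₀] [ChartedSpace E₀ X₀]
    [NormedAddCommGroup E₁] [NormedSpace ℝ E₁] [TopologicalSpace X₁] [ChartedSpace E₁ X₁]
    [NormedAddCommGroup E₂] [NormedSpace ℝ E₂] [TopologicalSpace X₂] [ChartedSpace E₂ X₂] where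
  /-- source -/
  src : X₁ → X₀
  /-- target -/
  tgt : X₁ → X₀
  /-- unit -/
  unit : X₀ → X₁
  /-- inverse -/
  inv : X₁ → X₁
  /-- the inclusion of the composable pairs -/
  pair : X₂ → X₁ × X₁
  /-- composition `p * q` of composable arrows -/
  comp : ∀ p q : X₁, src p = tgt q → X₁
  src_submersion : Manifold.IsSubmersion 𝓘(ℝ, E₁) 𝓘(ℝ, E₀) ∞ src
  tgt_submersion : Manifold.IsSubmersion 𝓘(ℝ, E₁) 𝓘(ℝ, E₀) ∞ tgt
  pair_embedding : Manifold.IsSmoothEmbedding 𝓘(ℝ, E₂) (𝓘(ℝ, E₁).prod 𝓘(ℝ, E₁)) ∞ pair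
  src_pair : ∀ z, src (pair z).1 = tgt (pair z).2
  exists_pair : ∀ p q, src p = tgt q → ∃ z, pair z = (p, q)
  unit_smooth : ContMDiff 𝓘(ℝ, E₀) 𝓘(ℝ, E₁) ∞ unit
  inv_smooth : ContMDiff 𝓘(ℝ, E₁) 𝓘(ℝ, E₁) ∞ inv
  comp_smooth : ContMDiff 𝓘(ℝ, E₂) 𝓘(ℝ, E₁) ∞
    (fun z => comp (pair z).1 (pair z).2 (src_pair z))
  src_comp : ∀ p q h, src (comp p q h) = src q
  tgt_comp : ∀ p q h, tgt (comp p q h) = tgt p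
  comp_assoc : ∀ p q r (h : src p = tgt q) (h' : src q = tgt r),
    comp (comp p q h) r ((src_comp p q h).trans h') =
      comp p (comp q r h') (h.trans (tgt_comp q r h').symm)
  src_unit : ∀ x, src (unit x) = x
  tgt_unit : ∀ x, tgt (unit x) = x
  unit_comp : ∀ p, comp (unit (tgt p)) p (src_unit _) = p
  comp_unit : ∀ p, comp p (unit (src p)) (tgt_unit _).symm = p
  src_inv : ∀ p, src (inv p) = tgt p
  tgt_inv : ∀ p, tgt (inv p) = src p
  inv_comp : ∀ p, comp (inv p) p (src_inv p) = unit (src p)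
  comp_inv : ∀ p, comp p (inv p) (tgt_inv p).symm = unit (tgt p)

namespace LieGroupoid

section Groupoid

variable {E₀ E₁ E₂ X₀ X₁ X₂ : Type*}
  [NormedAddCommGroup E₀] [NormedSpace ℝ E₀] [TopologicalSpace X₀] [ChartedSpace E₀ X₀]
  [NormedAddCommGroup E₁] [NormedSpace ℝ E₁] [TopologicalSpace X₁] [ChartedSpace E₁ X₁]
  [NormedAddCommGroup E₂] [NormedSpace ℝ E₂] [TopologicalSpace X₂] [ChartedSpace E₂ X₂]
  (X : LieGroupoid E₀ E₁ E₂ X₀ X₁ X₂)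

/-- The first projection `(p, q) ↦ p` of the composable pairs. -/
def fst (z : X₂) : X₁ := (X.pair z).1

/-- The second projection `(p, q) ↦ q` of the composable pairs. -/
def snd (z : X₂) : X₁ := (X.pair z).2

theorem src_fst (z : X₂) : X.src (X.fst z) = X.tgt (X.snd z) := X.src_pair z

/-- The composition map `(p, q) ↦ p * q` of the composable pairs. -/
def mul (z : X₂) : X₁ := X.comp (X.fst z) (X.snd z) (X.src_fst z)

/-- The composable pair with components `p` and `q`. -/
def mkPair (p q : X₁) (h : X.src p = X.tgt q) : X₂ := (X.exists_pair p q h).choose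

/-- A composable pair `(p, q)` is the same as a commutative triangle with vertices `x₀ = src q`,
`x₁ = tgt q = src p`, `x₂ = tgt p`. This is the arrow from `x₀` to `x_i` of the triangle. -/
def leg (z : X₂) : Fin 3 → X₁ :=
  ![X.unit (X.src (X.snd z)), X.snd z, X.mul z]

theorem src_leg (z : X₂) (i : Fin 3) : X.src (X.leg z i) = X.src (X.snd z) := by
  fin_cases i
  · exact X.src_unit _
  · rfl
  · exact X.src_comp _ _ _

/-- The arrow from the vertex `x_j` to the vertex `x_i` of the triangle. -/
def edge (z : X₂) (i j : Fin 3) : X₁ :=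
  X.comp (X.leg z i) (X.inv (X.leg z j))
    ((X.src_leg z i).trans ((X.tgt_inv _).trans (X.src_leg z j)).symm)

theorem src_edge (z : X₂) (i j : Fin 3) : X.src (X.edge z i j) = X.tgt (X.leg z j) :=
  (X.src_comp _ _ _).trans (X.src_inv _)

theorem tgt_edge (z : X₂) (i j : Fin 3) : X.tgt (X.edge z i j) = X.tgt (X.leg z i) :=
  X.tgt_comp _ _ _

/-- The action of the symmetric group `S₃` on `X₂` by permutation of the vertices of the
commutative triangles (a right action: the new vertices are `x_{σ 0}`, `x_{σ 1}`, `x_{σ 2}`). -/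
def permute (σ : Equiv.Perm (Fin 3)) (z : X₂) : X₂ :=
  X.mkPair (X.edge z (σ 2) (σ 1)) (X.edge z (σ 1) (σ 0))
    ((X.src_edge z _ _).trans (X.tgt_edge z _ _).symm)

/-- A proper groupoid: the map `(src, tgt) : X₁ → X₀ × X₀` is proper. -/
def IsProper : Prop := IsProperMap (fun p : X₁ => (X.src p, X.tgt p))

variable [FiniteDimensional ℝ E₀] [IsManifold 𝓘(ℝ, E₀) ∞ X₀]
  [FiniteDimensional ℝ E₁] [IsManifold 𝓘(ℝ, E₁) ∞ X₁]
  [FiniteDimensional ℝ E₂] [IsManifold 𝓘(ℝ, E₂) ∞ X₂]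

/-- `η` is a groupoid metric (a 2-metric) on `X₁ ⇉ X₀`: a Riemannian metric on `X₂` that is
invariant under `S₃` and transverse to the composition map. -/
structure IsGroupoidMetric (η : RiemMetric E₂ X₂) : Prop where
  invariant : ∀ σ : Equiv.Perm (Fin 3), η.IsPreservedBy (X.permute σ)
  transverse : η.IsTransverse (E' := E₁) X.mul

/-- `η₁` and `η₀` are the metrics on `X₁` and `X₀` induced by the groupoid metric `η`: the three
face maps `X₂ → X₁` and the maps `src, tgt : X₁ → X₀` are Riemannian submersions. -/
structure IsInduced (η : RiemMetric E₂ X₂) (η₁ : RiemMetric E₁ X₁) (η₀ : RiemMetric E₀ X₀) :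
    Prop where
  snd : η.IsRiemannianSubmersion η₁ X.snd
  mul : η.IsRiemannianSubmersion η₁ X.mul
  fst : η.IsRiemannianSubmersion η₁ X.fst
  src : η₁.IsRiemannianSubmersion η₀ X.src
  tgt : η₁.IsRiemannianSubmersion η₀ X.tgt

end Groupoid

section TwoGroup

variable {F₀ F₁ F₂ G₀ G₁ G₂ : Type*}
  [NormedAddCommGroup F₀] [NormedSpace ℝ F₀] [TopologicalSpace G₀] [ChartedSpace F₀ G₀]
  [NormedAddCommGroup F₁] [NormedSpace ℝ F₁] [TopologicalSpace G₁] [ChartedSpace F₁ G₁]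
  [NormedAddCommGroup F₂] [NormedSpace ℝ F₂] [TopologicalSpace G₂] [ChartedSpace F₂ G₂]

/-- A Lie groupoid `G₁ ⇉ G₀` is a Lie 2-group: `G₀` and `G₁` are Lie groups, `G₂` carries the
group structure induced from the direct product `G₁ × G₁`, and the structural maps of the
groupoid are group homomorphisms. -/
structure IsLieTwoGroup (G : LieGroupoid F₀ F₁ F₂ G₀ G₁ G₂) [Group G₀] [Group G₁] [Group G₂] :
    Prop where
  lieGroup_obj : LieGroup 𝓘(ℝ, F₀) ∞ G₀
  lieGroup_arr : LieGroup 𝓘(ℝ, F₁) ∞ G₁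
  pair_mul : ∀ a b : G₂, G.pair (a * b) = G.pair a * G.pair b
  src_mul : ∀ g h : G₁, G.src (g * h) = G.src g * G.src h
  tgt_mul : ∀ g h : G₁, G.tgt (g * h) = G.tgt g * G.tgt h
  unit_mul : ∀ g h : G₀, G.unit (g * h) = G.unit g * G.unit h
  inv_mul : ∀ g h : G₁, G.inv (g * h) = G.inv g * G.inv h
  mul_mul : ∀ a b : G₂, G.mul (a * b) = G.mul a * G.mul b

variable {E₀ E₁ E₂ X₀ X₁ X₂ : Type*}
  [NormedAddCommGroup E₀] [NormedSpace ℝ E₀] [TopologicalSpace X₀] [ChartedSpace E₀ X₀]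
  [NormedAddCommGroup E₁] [NormedSpace ℝ E₁] [TopologicalSpace X₁] [ChartedSpace E₁ X₁]
  [NormedAddCommGroup E₂] [NormedSpace ℝ E₂] [TopologicalSpace X₂] [ChartedSpace E₂ X₂]

/-- The actions `θ⁰` of `G₀` on `X₀` and `θ¹` of `G₁` on `X₁` form a left 2-action: they are
smooth left Lie group actions, and together a morphism of Lie groupoids from the product groupoid
`G₁ × X₁ ⇉ G₀ × X₀` to `X₁ ⇉ X₀`. -/
structure IsTwoAction (G : LieGroupoid F₀ F₁ F₂ G₀ G₁ G₂) (X : LieGroupoid E₀ E₁ E₂ X₀ X₁ X₂)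
    [Group G₀] [Group G₁] [MulAction G₀ X₀] [MulAction G₁ X₁] : Prop where
  smooth_obj : ContMDiffSMul 𝓘(ℝ, F₀) 𝓘(ℝ, E₀) ∞ G₀ X₀
  smooth_arr : ContMDiffSMul 𝓘(ℝ, F₁) 𝓘(ℝ, E₁) ∞ G₁ X₁
  src_smul : ∀ (g : G₁) (p : X₁), X.src (g • p) = G.src g • X.src p
  tgt_smul : ∀ (g : G₁) (p : X₁), X.tgt (g • p) = G.tgt g • X.tgt p
  comp_smul : ∀ (g h : G₁) (p q : X₁) (hgh : G.src g = G.tgt h) (hpq : X.src p = X.tgt q),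
    G.comp g h hgh • X.comp p q hpq =
      X.comp (g • p) (h • q) (by rw [src_smul, tgt_smul, hgh, hpq])

namespace IsTwoAction

variable {G : LieGroupoid F₀ F₁ F₂ G₀ G₁ G₂} {X : LieGroupoid E₀ E₁ E₂ X₀ X₁ X₂}
  [Group G₀] [Group G₁] [MulAction G₀ X₀] [MulAction G₁ X₁]

/-- The induced action `θ²` of `G₂` on `X₂`: `(g, h) · (p, q) = (g p, h q)`. -/
def act₂ (hθ : IsTwoAction G X) (a : G₂) (z : X₂) : X₂ :=
  X.mkPair (G.fst a • X.fst z) (G.snd a • X.snd z) (by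
    rw [hθ.src_smul, hθ.tgt_smul, G.src_fst, X.src_fst])

/-- The 2-action is isometric for `η`: `G₂` acts on `(X₂, η)` by isometries. -/
def IsIsometric [FiniteDimensional ℝ E₂] [IsManifold 𝓘(ℝ, E₂) ∞ X₂]
    (hθ : IsTwoAction G X) (η : RiemMetric E₂ X₂) : Prop :=
  ∀ a : G₂, η.IsPreservedBy (hθ.act₂ a)

end IsTwoAction

end TwoGroup

end LieGroupoid

end

/-!
Metrics are handled through their duals. A smooth Riemannian metric is the same as a smooth family
of positive definite forms on the cotangent spaces, a cometric (`IsCometric.exists_metric`,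
`RiemMetric.isCometric_dual`), and cometrics can be averaged: sums and integrals of them are again
cometrics, and they are compatible with submersions, since covectors are pulled back.

Averaging. The cotangent average of a metric over a compact Lie group exists because integrals of
jointly smooth functions over compact sets are smooth in the parameter
(`contMDiffAt_setIntegral`, `RiemMetric.exists_isCotangentAverage`), and it is invariant because
the Haar measure of a compact group is right invariant. An equivariant Riemannian submersion, along
a measure preserving map of the groups, remains a Riemannian submersion between the averages
(`RiemMetric.IsRiemannianSubmersion.average`). This applies to the three face maps `X₂ → X₁`, to
the source and the target, and to the permutations of `X₂`: they are equivariant along the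
corresponding maps of the 2-group, which are surjective homomorphisms of compact groups and
therefore preserve the normalized Haar measures. Hence the average of a groupoid metric is an
invariant groupoid metric, and its induced metrics are the averages of the induced metrics
(`LieGroupoid.IsGroupoidMetric.exists_average`).

Proper groupoids. By the first part it suffices to find any groupoid metric on a proper groupoid
(`LieGroupoid.IsProper.exists_isGroupoidMetric`). A point of `X₂` is a commutative triangle, and a
triple `p` of arrows with a common source determines the triangle whose edges are the quotients of
the arrows; two triples determine the same triangle exactly if they differ by a right translation,
and the triples over a triangle `z` are parametrized by the arrows `g` that start at the origin of
`z`. Moving the three arrows and their source in all possible ways, in charts that trivialize the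
source map, yields a positive definite form on the covectors at the triangle
(`LieGroupoid.FibreAtlas.legForm`). The charts are averaged by a partition of unity on the arrows,
independently for each of the three arrows; therefore the construction is symmetric in the three
arrows, and the form pushed forward by the composition, which forgets the middle arrow, does not
depend on the middle arrow, because the weights of its charts add up to one
(`LieGroupoid.FibreAtlas.legForm_comp_mul_congr`). The dependence on the triple is then removed by
integration over `g`. The integral uses a right invariant smooth density on the source fibres, which
is multiplied by a cutoff function of the target to make the supports compact; it exists since the
groupoid is proper (`LieGroupoid.IsProper.exists_isCutoff`,
`LieGroupoid.FibreAtlas.integral_comp_op`). Right invariance of the integral gives the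
invariance under `S₃`, whose action on the legs of a triangle changes the origin.
-/

set_option maxSynthPendingDepth 3
set_option linter.unusedSectionVars false

section

open scoped Topology
open Set Filter

/-! ### Cometrics -/

section LinearAlgebra

variable {E V : Type*} [NormedAddCommGroup E] [NormedSpace ℝ E] [FiniteDimensional ℝ E]
  [NormedAddCommGroup V] [NormedSpace ℝ V]

theorem isVonNBounded_of_posDef (B : E →L[ℝ] E →L[ℝ] ℝ) (hB : ∀ v, v ≠ 0 → 0 < B v v) :
    Bornology.IsVonNBounded ℝ {v : E | B v v < 1} := by
  have : ProperSpace E := FiniteDimensional.proper ℝ E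
  rw [NormedSpace.isVonNBounded_iff]
  rcases subsingleton_or_nontrivial E with h | h
  · exact (Set.toFinite _).isBounded
  have hc : Continuous fun v : E => B v v := by fun_prop
  obtain ⟨v₀, hv₀, hmin⟩ := (isCompact_sphere (0 : E) 1).exists_isMinOn
    (NormedSpace.sphere_nonempty.2 zero_le_one) hc.continuousOn
  have hv₀' : v₀ ≠ 0 := by rintro rfl; simp at hv₀
  set m := B v₀ v₀
  have hm : 0 < m := hB _ hv₀'
  refine isBounded_iff_forall_norm_le.2 ⟨1 + 1 / m, fun v hv => ?_⟩
  have hv : B v v < 1 := hv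
  rcases eq_or_ne v 0 with rfl | hne
  · simp; positivity
  have hn : 0 < ‖v‖ := norm_pos_iff.2 hne
  have h1 : m ≤ B (‖v‖⁻¹ • v) (‖v‖⁻¹ • v) := hmin (by simp [norm_smul, hn.ne'])
  have h2 : B (‖v‖⁻¹ • v) (‖v‖⁻¹ • v) = ‖v‖⁻¹ ^ 2 * B v v := by
    simp; ring
  rw [h2] at h1
  have h3 : m * ‖v‖ ^ 2 ≤ B v v := by
    calc m * ‖v‖ ^ 2 ≤ (‖v‖⁻¹ ^ 2 * B v v) * ‖v‖ ^ 2 := by gcongr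
      _ = B v v := by field_simp
  have h4 : ‖v‖ ^ 2 ≤ 1 / m := by
    rw [le_div_iff₀ hm]; nlinarith
  nlinarith [sq_nonneg (‖v‖ - 1), one_div_pos.2 hm]

/-- A family of continuous linear maps out of a finite-dimensional space is smooth if it is
smooth when evaluated at each vector. -/
theorem contMDiffAt_clm_of_apply {EN HN N : Type*} [NormedAddCommGroup EN] [NormedSpace ℝ EN]
    [TopologicalSpace HN] {J : ModelWithCorners ℝ EN HN} [TopologicalSpace N] [ChartedSpace HN N]
    {n : WithTop ℕ∞} {A : N → E →L[ℝ] V} {x : N}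
    (h : ∀ v, ContMDiffAt J 𝓘(ℝ, V) n (fun y => A y v) x) :
    ContMDiffAt J 𝓘(ℝ, E →L[ℝ] V) n A x := by
  let d := Module.finrank ℝ E
  have hd : d = Module.finrank ℝ (Fin d → ℝ) := (Module.finrank_fin_fun ℝ).symm
  let e₁ := ContinuousLinearEquiv.ofFinrankEq hd
  let e₂ := (e₁.arrowCongr (1 : V ≃L[ℝ] V)).trans (ContinuousLinearEquiv.piRing (Fin d))
  have h1 : ContMDiffAt J 𝓘(ℝ, Fin d → V) n (fun y => e₂ (A y)) x := by
    rw [contMDiffAt_pi_space]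
    intro i
    exact h (e₁.symm (Pi.single i 1))
  have h2 := e₂.symm.toContinuousLinearMap.contMDiff.contMDiffAt.comp x h1 (n := n)
  refine h2.congr_of_eventuallyEq (Eventually.of_forall fun y => ?_)
  simp

theorem contMDiffAt_inverse {W EN HN N : Type*} [NormedAddCommGroup W] [NormedSpace ℝ W]
    [NormedAddCommGroup EN] [NormedSpace ℝ EN] [CompleteSpace W]
    [TopologicalSpace HN] {J : ModelWithCorners ℝ EN HN} [TopologicalSpace N] [ChartedSpace HN N]
    {n : WithTop ℕ∞} {A : N → W →L[ℝ] V} {x : N} (h : ContMDiffAt J 𝓘(ℝ, W →L[ℝ] V) n A x)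
    (hinv : (A x).IsInvertible) :
    ContMDiffAt J 𝓘(ℝ, V →L[ℝ] W) n (fun y => (A y).inverse) x := by
  obtain ⟨e, he⟩ := hinv
  have := contDiffAt_map_inverse (n := n) e
  rw [he] at this
  exact ContMDiffAt.comp x this.contMDiffAt h

end LinearAlgebra

section Metric

variable {E X : Type*}
  [NormedAddCommGroup E] [NormedSpace ℝ E]
  [TopologicalSpace X] [ChartedSpace E X]

/-- The derivative at `x` of the preferred chart around `x₀`. -/
noncomputable def chartD (x₀ x : X) : TangentSpace 𝓘(ℝ, E) x →L[ℝ] E :=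
  mfderiv 𝓘(ℝ, E) 𝓘(ℝ, E) (extChartAt 𝓘(ℝ, E) x₀) x

variable [IsManifold 𝓘(ℝ, E) ∞ X]

theorem isInvertible_chartD {x₀ x : X} (hx : x ∈ (chartAt E x₀).source) :
    (chartD (E := E) x₀ x).IsInvertible := by
  have : IsManifold 𝓘(ℝ, E) 1 X := IsManifold.of_le (n := ∞) (by simp)
  exact isInvertible_mfderiv_extChartAt (by simpa using hx)

theorem eventually_mem_chartAt_source (x₀ : X) : ∀ᶠ x in 𝓝 x₀, x ∈ (chartAt E x₀).source :=
  (chartAt E x₀).open_source.mem_nhds (mem_chart_source E x₀)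

theorem comp_chartD_comp_inverse {x₀ x : X} (hx : x ∈ (chartAt E x₀).source)
    {V : Type*} [NormedAddCommGroup V] [NormedSpace ℝ V] (ξ : TangentSpace 𝓘(ℝ, E) x →L[ℝ] V) :
    (ξ ∘L (chartD x₀ x).inverse) ∘L chartD (E := E) x₀ x = ξ := by
  ext v
  have := (isInvertible_chartD hx)
  simp [this]

/-- A family of bilinear forms on the tangent spaces is smooth if and only if its expression in the
preferred chart is. -/
theorem contMDiff_bilinear_iff (b : ∀ x : X, TangentSpace 𝓘(ℝ, E) x →L[ℝ]
      TangentSpace 𝓘(ℝ, E) x →L[ℝ] ℝ) (x₀ : X) :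
    ContMDiffAt 𝓘(ℝ, E) (𝓘(ℝ, E).prod 𝓘(ℝ, E →L[ℝ] E →L[ℝ] ℝ)) ∞
      (fun x ↦ Bundle.TotalSpace.mk' (E →L[ℝ] E →L[ℝ] ℝ)
        (E := fun x : X => TangentSpace 𝓘(ℝ, E) x →L[ℝ] TangentSpace 𝓘(ℝ, E) x →L[ℝ] ℝ)
        x (b x)) x₀ ↔
    ContMDiffAt 𝓘(ℝ, E) 𝓘(ℝ, E →L[ℝ] E →L[ℝ] ℝ) ∞
      (fun x => ((chartD x₀ x).inverse.precomp ℝ).comp ((b x).comp (chartD x₀ x).inverse)) x₀ := by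
  rw [Bundle.contMDiffAt_section]
  refine Filter.EventuallyEq.contMDiffAt_iff ?_
  filter_upwards [eventually_mem_chartAt_source (E := E) x₀] with x hx
  have : IsManifold 𝓘(ℝ, E) 1 X := IsManifold.of_le (n := ∞) (by simp)
  have h1 := TangentBundle.continuousLinearMapAt_trivializationAt (I := 𝓘(ℝ, E)) hx
  have h2 : ((trivializationAt E (TangentSpace 𝓘(ℝ, E)) x₀).symmL ℝ x) =
      (chartD (E := E) x₀ x).inverse := by
    have h3 := mfderiv_extChartAt_comp_mfderivWithin_extChartAt_symm (I := 𝓘(ℝ, E)) (x := x₀)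
      ((extChartAt 𝓘(ℝ, E) x₀).map_source (by simpa using hx))
    have h4 := mfderivWithin_extChartAt_symm_comp_mfderiv_extChartAt (I := 𝓘(ℝ, E)) (x := x₀)
      ((extChartAt 𝓘(ℝ, E) x₀).map_source (by simpa using hx))
    rw [TangentBundle.symmL_trivializationAt hx]
    rw [(extChartAt 𝓘(ℝ, E) x₀).left_inv (by simpa using hx)] at h3 h4
    exact (ContinuousLinearMap.inverse_eq h3 h4).symm
  ext v w
  simp [hom_trivializationAt_apply, ContinuousLinearMap.inCoordinates, h2, hx]

end Metric

section DoubleDual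

variable {E : Type*} [NormedAddCommGroup E] [NormedSpace ℝ E] [FiniteDimensional ℝ E]

theorem isInvertible_of_injective_strongDual (f : E →L[ℝ] E →L[ℝ] ℝ)
    (hf : Function.Injective f) : f.IsInvertible := by
  have h : Module.finrank ℝ E = Module.finrank ℝ (E →L[ℝ] ℝ) := by
    rw [← (LinearMap.toContinuousLinearMap (𝕜 := ℝ) (E := E) (F' := ℝ)).finrank_eq]
    exact (Subspace.dual_finrank_eq (K := ℝ)).symm
  have hs := (LinearMap.injective_iff_surjective_of_finrank_eq_finrank (K := ℝ)
    (f := f.toLinearMap) h).1 hf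
  exact ⟨(LinearEquiv.ofBijective f.toLinearMap ⟨hf, hs⟩).toContinuousLinearEquiv, by ext; rfl⟩

theorem isInvertible_of_surjective_strongDual (f : E →L[ℝ] E →L[ℝ] ℝ)
    (hf : Function.Surjective f) : f.IsInvertible := by
  have h : Module.finrank ℝ E = Module.finrank ℝ (E →L[ℝ] ℝ) := by
    rw [← (LinearMap.toContinuousLinearMap (𝕜 := ℝ) (E := E) (F' := ℝ)).finrank_eq]
    exact (Subspace.dual_finrank_eq (K := ℝ)).symm
  exact isInvertible_of_injective_strongDual f
    ((LinearMap.injective_iff_surjective_of_finrank_eq_finrank (K := ℝ) (f := f.toLinearMap) h).2 hf)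

end DoubleDual

section Cometric

variable {E X : Type*}
  [NormedAddCommGroup E] [NormedSpace ℝ E] [FiniteDimensional ℝ E]
  [TopologicalSpace X] [ChartedSpace E X] [IsManifold 𝓘(ℝ, E) ∞ X]

/-- A smooth family of positive definite symmetric bilinear forms on the cotangent spaces of `X`.
Smoothness is expressed by evaluating the forms, near each point `x₀`, on the covectors which
are constant in the preferred chart around `x₀`. -/
structure IsCometric (b : ∀ x : X, (TangentSpace 𝓘(ℝ, E) x →L[ℝ] ℝ) →
    (TangentSpace 𝓘(ℝ, E) x →L[ℝ] ℝ) → ℝ) : Prop where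
  symm : ∀ x α β, b x α β = b x β α
  add_left : ∀ x α α' β, b x (α + α') β = b x α β + b x α' β
  smul_left : ∀ x (c : ℝ) α β, b x (c • α) β = c * b x α β
  pos : ∀ x α, α ≠ 0 → 0 < b x α α
  smooth : ∀ (x₀ : X) (ξ ζ : E →L[ℝ] ℝ), ContMDiffAt 𝓘(ℝ, E) 𝓘(ℝ, ℝ) ∞
    (fun x => b x (ξ ∘L chartD x₀ x) (ζ ∘L chartD x₀ x)) x₀

namespace IsCometric

variable {b : ∀ x : X, (TangentSpace 𝓘(ℝ, E) x →L[ℝ] ℝ) →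
    (TangentSpace 𝓘(ℝ, E) x →L[ℝ] ℝ) → ℝ}

/-- The bilinear form on the dual of the model space which represents `b x` in the preferred chart
around `x₀`. -/
noncomputable def coord (hb : IsCometric b) (x₀ x : X) :
    (E →L[ℝ] ℝ) →L[ℝ] (E →L[ℝ] ℝ) →L[ℝ] ℝ :=
  LinearMap.toContinuousLinearMap
    { toFun := fun ξ => LinearMap.toContinuousLinearMap
        { toFun := fun ζ => b x (ξ ∘L chartD x₀ x) (ζ ∘L chartD x₀ x)
          map_add' := fun ζ ζ' => by
            rw [hb.symm, ContinuousLinearMap.add_comp, hb.add_left, hb.symm,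
              hb.symm x (ζ' ∘L chartD x₀ x)]
          map_smul' := fun c ζ => by
            rw [hb.symm, ContinuousLinearMap.smul_comp, hb.smul_left, hb.symm]; rfl }
      map_add' := fun ξ ξ' => by
        ext ζ; simp [ContinuousLinearMap.add_comp, hb.add_left]
      map_smul' := fun c ξ => by
        ext ζ; simp [ContinuousLinearMap.smul_comp, hb.smul_left] }

theorem coord_apply (hb : IsCometric b) (x₀ x : X) (ξ ζ : E →L[ℝ] ℝ) :
    hb.coord x₀ x ξ ζ = b x (ξ ∘L chartD x₀ x) (ζ ∘L chartD x₀ x) := rfl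

theorem contMDiffAt_coord (hb : IsCometric b) (x₀ : X) :
    ContMDiffAt 𝓘(ℝ, E) 𝓘(ℝ, (E →L[ℝ] ℝ) →L[ℝ] (E →L[ℝ] ℝ) →L[ℝ] ℝ) ∞ (hb.coord x₀) x₀ :=
  contMDiffAt_clm_of_apply fun ξ => contMDiffAt_clm_of_apply fun ζ => hb.smooth x₀ ξ ζ

/-- Evaluating a cometric along a smooth map on two smoothly varying covectors gives a smooth
function. -/
theorem contMDiffAt_apply (hb : IsCometric b) {EN HN N : Type*} [NormedAddCommGroup EN]
    [NormedSpace ℝ EN] [TopologicalSpace HN] {J : ModelWithCorners ℝ EN HN} [TopologicalSpace N]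
    [ChartedSpace HN N] {f : N → X} {A A' : N → E →L[ℝ] ℝ} {n : N} {x₀ : X} (hx₀ : f n = x₀)
    (hf : ContMDiffAt J 𝓘(ℝ, E) ∞ f n)
    (hA : ContMDiffAt J 𝓘(ℝ, E →L[ℝ] ℝ) ∞ A n) (hA' : ContMDiffAt J 𝓘(ℝ, E →L[ℝ] ℝ) ∞ A' n) :
    ContMDiffAt J 𝓘(ℝ, ℝ) ∞
      (fun m => b (f m) (A m ∘L chartD x₀ (f m)) (A' m ∘L chartD x₀ (f m))) n := by
  subst hx₀
  exact (((hb.contMDiffAt_coord (f n)).comp n hf).clm_apply hA).clm_apply hA'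

theorem zero_left (hb : IsCometric b) (x : X) (β : TangentSpace 𝓘(ℝ, E) x →L[ℝ] ℝ) :
    b x 0 β = 0 := by
  have := hb.smul_left x 0 0 β
  simpa using this

theorem nondegenerate (hb : IsCometric b) {x : X} {α α' : TangentSpace 𝓘(ℝ, E) x →L[ℝ] ℝ}
    (h : ∀ β, b x α β = b x α' β) : α = α' := by
  by_contra hne
  have h1 := hb.pos x (α - α') (sub_ne_zero.2 hne)
  have h2 : b x (α - α') (α - α') = 0 := by
    have h3 : ∀ β, b x (α - α') β = 0 := fun β => by
      rw [sub_eq_add_neg, hb.add_left, ← neg_one_smul ℝ α', hb.smul_left, h β]; ring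
    exact h3 _
  exact h1.ne' h2

theorem exists_flat (hb : IsCometric b) (x : X) (v : TangentSpace 𝓘(ℝ, E) x) :
    ∃ α : TangentSpace 𝓘(ℝ, E) x →L[ℝ] ℝ, ∀ β, b x α β = β v := by
  have : FiniteDimensional ℝ (TangentSpace 𝓘(ℝ, E) x) := ‹FiniteDimensional ℝ E›
  have : FiniteDimensional ℝ (TangentSpace 𝓘(ℝ, E) x →L[ℝ] ℝ) :=
    inferInstanceAs (FiniteDimensional ℝ (E →L[ℝ] ℝ))
  let f : (TangentSpace 𝓘(ℝ, E) x →L[ℝ] ℝ) →ₗ[ℝ]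
      Module.Dual ℝ (TangentSpace 𝓘(ℝ, E) x →L[ℝ] ℝ) :=
    LinearMap.mk₂ ℝ (b x) (hb.add_left x) (hb.smul_left x)
      (fun α β β' => by rw [hb.symm, hb.add_left, hb.symm, hb.symm x β'])
      (fun c α β => by rw [hb.symm, hb.smul_left, hb.symm]; rfl)
  have hinj : Function.Injective f := fun α α' h =>
    hb.nondegenerate fun β => LinearMap.congr_fun h β
  have hsurj : Function.Surjective f :=
    (LinearMap.injective_iff_surjective_of_finrank_eq_finrank
      (Subspace.dual_finrank_eq (K := ℝ)).symm).1 hinj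
  obtain ⟨α, hα⟩ := hsurj
    { toFun := fun β => β v, map_add' := fun _ _ => rfl, map_smul' := fun _ _ => rfl }
  exact ⟨α, fun β => LinearMap.congr_fun hα β⟩

/-- The covector which represents a tangent vector `v` with respect to a cometric. -/
noncomputable def flat (hb : IsCometric b) (x : X) (v : TangentSpace 𝓘(ℝ, E) x) :
    TangentSpace 𝓘(ℝ, E) x →L[ℝ] ℝ :=
  (hb.exists_flat x v).choose

theorem apply_flat (hb : IsCometric b) (x : X) (v : TangentSpace 𝓘(ℝ, E) x)
    (β : TangentSpace 𝓘(ℝ, E) x →L[ℝ] ℝ) : b x (hb.flat x v) β = β v :=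
  (hb.exists_flat x v).choose_spec β

/-- The bilinear form on the tangent spaces which is dual to a cometric. -/
noncomputable def inner (hb : IsCometric b) (x : X) :
    TangentSpace 𝓘(ℝ, E) x →L[ℝ] TangentSpace 𝓘(ℝ, E) x →L[ℝ] ℝ :=
  have : FiniteDimensional ℝ (TangentSpace 𝓘(ℝ, E) x) := ‹FiniteDimensional ℝ E›
  have : T2Space (TangentSpace 𝓘(ℝ, E) x) := inferInstanceAs (T2Space E)
  LinearMap.toContinuousLinearMap
    { toFun := hb.flat x
      map_add' := fun v w => hb.nondegenerate fun β => by
        rw [hb.add_left, hb.apply_flat, hb.apply_flat, hb.apply_flat, map_add]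
      map_smul' := fun c v => hb.nondegenerate fun β => by
        rw [RingHom.id_apply, hb.smul_left, hb.apply_flat, hb.apply_flat, map_smul]; rfl }

theorem inner_apply (hb : IsCometric b) (x : X) (v : TangentSpace 𝓘(ℝ, E) x) :
    hb.inner x v = hb.flat x v := rfl

theorem flat_apply (hb : IsCometric b) (x : X) (v w : TangentSpace 𝓘(ℝ, E) x) :
    hb.flat x v w = b x (hb.flat x w) (hb.flat x v) := (hb.apply_flat x w _).symm

theorem exists_apply_ne_zero {x : X} {v : TangentSpace 𝓘(ℝ, E) x} (hv : v ≠ 0) :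
    ∃ β : TangentSpace 𝓘(ℝ, E) x →L[ℝ] ℝ, β v ≠ 0 := by
  have h : ∀ w : E, w ≠ 0 → ∃ β : E →L[ℝ] ℝ, β w ≠ 0 :=
    fun w hw => SeparatingDual.exists_ne_zero (R := ℝ) hw
  exact h v hv

/-- Every smooth cometric is the dual of a smooth Riemannian metric. -/
theorem exists_metric (hb : IsCometric b) : ∃ η : RiemMetric E X, ∀ x α β, η.dual x α β = b x α β := by
  have hpos : ∀ (x : X) (v : TangentSpace 𝓘(ℝ, E) x), v ≠ 0 → 0 < hb.inner x v v := by
    intro x v hv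
    rw [hb.inner_apply, hb.flat_apply]
    refine hb.pos _ _ fun h => ?_
    obtain ⟨β, hβ⟩ := exists_apply_ne_zero hv
    rw [← hb.apply_flat, h, hb.zero_left] at hβ
    exact hβ rfl
  suffices h : ∃ η : RiemMetric E X, ∀ x, η.inner x = hb.inner x by
    obtain ⟨η, hη⟩ := h
    refine ⟨η, fun x α β => ?_⟩
    have h1 : ∀ α, hb.flat x (η.sharp x α) = α := fun α => by
      ext w
      rw [← hb.inner_apply, ← hη]
      exact (η.exists_sharp x α).choose_spec w
    rw [RiemMetric.dual, hη, hb.inner_apply, hb.flat_apply, h1, h1, hb.symm]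
  refine ⟨⟨hb.inner, ?_, hpos, fun x => isVonNBounded_of_posDef (E := E) (hb.inner x) (hpos x),
    fun x₀ => ?_⟩, fun _ => rfl⟩
  · intro x v w
    rw [hb.inner_apply, hb.flat_apply, hb.symm, ← hb.flat_apply]; rfl
  · rw [contMDiff_bilinear_iff]
    -- In the chart, the metric is the inverse of the cometric, up to the double dual embedding.
    let ev : E →L[ℝ] (E →L[ℝ] ℝ) →L[ℝ] ℝ := (ContinuousLinearMap.id ℝ (E →L[ℝ] ℝ)).flip
    have hinv : ∀ x ∈ (chartAt E x₀).source, (hb.coord x₀ x).IsInvertible := by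
      intro x hx
      have hi : Function.Injective (hb.coord x₀ x) := by
        rw [injective_iff_map_eq_zero]
        intro ξ hξ
        by_contra hne
        have h1 : ξ ∘L chartD x₀ x ≠ 0 := by
          intro h0
          apply hne
          have hD := isInvertible_chartD (E := E) hx
          obtain ⟨e, he⟩ := hD
          ext u
          have := DFunLike.congr_fun h0 (e.symm u)
          rw [← he] at this
          simpa using this
        have h2 := hb.pos x _ h1
        rw [← hb.coord_apply, hξ] at h2
        simp at h2
      exact isInvertible_of_injective_strongDual _ hi
    have h1 : ContMDiffAt 𝓘(ℝ, E) 𝓘(ℝ, E →L[ℝ] E →L[ℝ] ℝ) ∞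
        (fun x => (hb.coord x₀ x).inverse ∘L ev) x₀ :=
      (contMDiffAt_inverse (hb.contMDiffAt_coord x₀) (hinv x₀ (mem_chart_source E x₀))).clm_comp
        contMDiffAt_const
    refine h1.congr_of_eventuallyEq ?_
    filter_upwards [eventually_mem_chartAt_source (E := E) x₀] with x hx
    ext1 u
    obtain ⟨e, he⟩ := hinv x hx
    have h2 : hb.coord x₀ x (hb.flat x ((chartD x₀ x).inverse u) ∘L (chartD x₀ x).inverse) =
        ev u := by
      ext1 ζ
      rw [hb.coord_apply, comp_chartD_comp_inverse hx, hb.apply_flat]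
      have := isInvertible_chartD hx
      simp [ev, this]
    change (hb.flat x ((chartD x₀ x).inverse u) ∘L (chartD x₀ x).inverse) = _
    rw [← he] at h2
    simp [← he, ← h2]

end IsCometric

namespace RiemMetric

theorem inner_sharp (η : RiemMetric E X) (x : X) (α : TangentSpace 𝓘(ℝ, E) x →L[ℝ] ℝ)
    (w : TangentSpace 𝓘(ℝ, E) x) : η.inner x (η.sharp x α) w = α w :=
  (η.exists_sharp x α).choose_spec w

theorem dual_eq_apply_sharp (η : RiemMetric E X) (x : X) (α β : TangentSpace 𝓘(ℝ, E) x →L[ℝ] ℝ) :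
    η.dual x α β = α (η.sharp x β) := η.inner_sharp x α _

theorem dual_comm (η : RiemMetric E X) (x : X) (α β : TangentSpace 𝓘(ℝ, E) x →L[ℝ] ℝ) :
    η.dual x α β = η.dual x β α := η.symm x _ _

theorem inner_injective (η : RiemMetric E X) (x : X) : Function.Injective (η.inner x) := by
  rw [injective_iff_map_eq_zero]
  intro v hv
  by_contra hne
  have := η.pos x v hne
  simp [hv] at this

theorem sharp_inner (η : RiemMetric E X) (x : X) (v : TangentSpace 𝓘(ℝ, E) x) :
    η.sharp x (η.inner x v) = v := by
  apply η.inner_injective x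
  ext w
  exact η.inner_sharp x _ w

theorem dual_inner (η : RiemMetric E X) (x : X) (v w : TangentSpace 𝓘(ℝ, E) x) :
    η.dual x (η.inner x v) (η.inner x w) = η.inner x v w := by
  rw [dual, sharp_inner, sharp_inner]

/-- The dual of a Riemannian metric is a smooth cometric. -/
theorem isCometric_dual (η : RiemMetric E X) : IsCometric η.dual where
  symm := η.dual_comm
  add_left x α α' β := by simp [dual_eq_apply_sharp]
  smul_left x c α β := by simp [dual_eq_apply_sharp]
  pos x α hα := by
    refine η.pos x _ fun h => hα ?_
    ext w
    rw [← η.inner_sharp x α w, h]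
    simp
  smooth x₀ ξ ζ := by
    have h1 := (contMDiff_bilinear_iff η.inner x₀).1 (η.contMDiff x₀)
    set C : X → E →L[ℝ] E →L[ℝ] ℝ :=
      fun x => ((chartD x₀ x).inverse.precomp ℝ).comp ((η.inner x).comp (chartD x₀ x).inverse)
    have hC : ∀ x ∈ (chartAt E x₀).source, ∀ ξ : E →L[ℝ] ℝ,
        C x (chartD x₀ x (η.sharp x (ξ ∘L chartD x₀ x))) = ξ := by
      intro x hx ξ
      have hD := isInvertible_chartD (E := E) hx
      ext u
      simp [C, hD, inner_sharp]
    have hinv : ∀ x ∈ (chartAt E x₀).source, (C x).IsInvertible := by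
      intro x hx
      have hs : Function.Surjective (C x) := fun ξ => ⟨_, hC x hx ξ⟩
      exact isInvertible_of_surjective_strongDual _ hs
    have h2 : ContMDiffAt 𝓘(ℝ, E) 𝓘(ℝ, ℝ) ∞ (fun x => ξ ((C x).inverse ζ)) x₀ :=
      (contMDiffAt_const (c := ξ)).clm_apply
        ((contMDiffAt_inverse h1 (hinv x₀ (mem_chart_source E x₀))).clm_apply contMDiffAt_const)
    refine h2.congr_of_eventuallyEq ?_
    filter_upwards [eventually_mem_chartAt_source (E := E) x₀] with x hx
    rw [dual_eq_apply_sharp, ContinuousLinearMap.comp_apply]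
    obtain ⟨e, he⟩ := hinv x hx
    have h3 := hC x hx ζ
    rw [← he] at h3 ⊢
    rw [ContinuousLinearMap.inverse_equiv]
    exact congrArg ξ (e.symm_apply_eq.2 h3.symm).symm

end RiemMetric

end Cometric

/-! ### Integrals and differentials depending on parameters -/

section Parametric

variable {E V EN HN N : Type*} [NormedAddCommGroup E] [NormedSpace ℝ E]
  [NormedAddCommGroup V] [NormedSpace ℝ V] [NormedAddCommGroup EN] [NormedSpace ℝ EN]
  [TopologicalSpace HN] {J : ModelWithCorners ℝ EN HN} [TopologicalSpace N] [ChartedSpace HN N]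
  [IsManifold J ∞ N]

/-- The partial derivative of a jointly smooth function is jointly smooth. -/
theorem ContMDiffAt.partial_fderiv {F : N → E → V} {n₀ : N} {u₀ : E}
    (hF : ContMDiffAt (J.prod 𝓘(ℝ, E)) 𝓘(ℝ, V) ∞ (Function.uncurry F) (n₀, u₀)) :
    ContMDiffAt (J.prod 𝓘(ℝ, E)) 𝓘(ℝ, E →L[ℝ] V) ∞
      (fun p : N × E => fderiv ℝ (F p.1) p.2) (n₀, u₀) := by
  have : IsManifold J 1 N := IsManifold.of_le (n := ∞) (by simp)
  have h1 : ContMDiffAt ((J.prod 𝓘(ℝ, E)).prod 𝓘(ℝ, E)) 𝓘(ℝ, V) ∞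
      (Function.uncurry fun p : N × E => F p.1) ((n₀, u₀), u₀) := by
    exact ContMDiffAt.comp (g := Function.uncurry F) (f := fun q : (N × E) × E => (q.1.1, q.2)) _ hF
      ((contMDiffAt_fst.comp _ contMDiffAt_fst).prodMk contMDiffAt_snd)
  have h2 := ContMDiffAt.mfderiv (x₀ := (n₀, u₀)) (fun p : N × E => F p.1) Prod.snd h1
    (contMDiffAt_snd (n := ∞)) (by simp)
  refine h2.congr_of_eventuallyEq (Eventually.of_forall fun p => ?_)
  refine Eq.trans (mfderiv_eq_fderiv (f := F p.1) (x := p.2)).symm ?_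
  exact (congrFun (inTangentCoordinates_model_space (I := 𝓘(ℝ, E)) (I' := 𝓘(ℝ, V)) Prod.snd
    (fun p : N × E => F p.1 p.2) (fun p : N × E => mfderiv 𝓘(ℝ, E) 𝓘(ℝ, V) (F p.1) p.2)
    (n₀, u₀)) p).symm

theorem ContMDiffAt.right_section {EX HX X E' H' Y : Type*} [NormedAddCommGroup EX]
    [NormedSpace ℝ EX] [TopologicalSpace HX] {I : ModelWithCorners ℝ EX HX} [TopologicalSpace X]
    [ChartedSpace HX X] [NormedAddCommGroup E'] [NormedSpace ℝ E'] [TopologicalSpace H']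
    {I' : ModelWithCorners ℝ E' H'} [TopologicalSpace Y] [ChartedSpace H' Y] {F : N → X → Y}
    {n₀ : N} {x₀ : X} {n : WithTop ℕ∞}
    (hF : ContMDiffAt (J.prod I) I' n (Function.uncurry F) (n₀, x₀)) :
    ContMDiffAt I I' n (F n₀) x₀ :=
  ContMDiffAt.comp (g := Function.uncurry F) (f := fun x : X => (n₀, x)) x₀ hF
    (contMDiffAt_const.prodMk contMDiffAt_id)

theorem ContMDiffAt.left_section {EX HX X E' H' Y : Type*} [NormedAddCommGroup EX]
    [NormedSpace ℝ EX] [TopologicalSpace HX] {I : ModelWithCorners ℝ EX HX} [TopologicalSpace X]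
    [ChartedSpace HX X] [NormedAddCommGroup E'] [NormedSpace ℝ E'] [TopologicalSpace H']
    {I' : ModelWithCorners ℝ E' H'} [TopologicalSpace Y] [ChartedSpace H' Y] {F : N → X → Y}
    {n₀ : N} {x₀ : X} {n : WithTop ℕ∞}
    (hF : ContMDiffAt (J.prod I) I' n (Function.uncurry F) (n₀, x₀)) :
    ContMDiffAt J I' n (fun m => F m x₀) n₀ :=
  ContMDiffAt.comp (g := Function.uncurry F) (f := fun m : N => (m, x₀)) n₀ hF
    (contMDiffAt_id.prodMk contMDiffAt_const)

variable [FiniteDimensional ℝ E] [MeasurableSpace N] [OpensMeasurableSpace N] {μ : Measure N}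
  [IsFiniteMeasureOnCompacts μ] {C : Set N} {U : Set E}

/-- Differentiation under the integral sign; on a compact set the derivatives are bounded, uniformly
near the given parameter. -/
theorem hasFDerivAt_setIntegral (hU : IsOpen U) (hC : IsCompact C) (hCm : MeasurableSet C)
    {F : N → E → ℝ} (hF : ∀ a ∈ C, ∀ u ∈ U,
      ContMDiffAt (J.prod 𝓘(ℝ, E)) 𝓘(ℝ, ℝ) ∞ (Function.uncurry F) (a, u)) {u : E} (hu : u ∈ U) :
    HasFDerivAt (fun u => ∫ a in C, F a u ∂μ) (∫ a in C, fderiv ℝ (F a) u ∂μ) u := by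
  have hcont : ∀ v ∈ U, ContinuousOn (fun a => F a v) C := fun v hv a ha =>
    (hF a ha v hv).left_section.continuousAt.continuousWithinAt
  have hD : ∀ a ∈ C, ∀ v ∈ U, ContinuousAt (fun p : N × E => fderiv ℝ (F p.1) p.2) (a, v) :=
    fun a ha v hv => (hF a ha v hv).partial_fderiv.continuousAt
  have hDc : ContinuousOn (fun a => fderiv ℝ (F a) u) C := fun a ha =>
    (ContinuousAt.comp (g := fun p : N × E => fderiv ℝ (F p.1) p.2) (f := fun a => (a, u))
      (hD a ha u hu) (by fun_prop)).continuousWithinAt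
  obtain ⟨M, hM⟩ := hC.exists_bound_of_continuousOn hDc
  have hev : ∀ᶠ v in 𝓝 u, ∀ a ∈ C, ‖fderiv ℝ (F a) v‖ ≤ M + 1 := by
    refine hC.eventually_forall_of_forall_eventually fun a ha => ?_
    have h1 : ContinuousAt (fun q : E × N => fderiv ℝ (F q.2) q.1) (u, a) :=
      ContinuousAt.comp (g := fun p : N × E => fderiv ℝ (F p.1) p.2) (f := Prod.swap)
        (hD a ha u hu) continuous_swap.continuousAt
    filter_upwards [h1.norm.eventually_lt_const (lt_of_le_of_lt (hM a ha) (lt_add_one M))]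
      with q hq using hq.le
  have hs := hev.and (hU.mem_nhds hu)
  refine hasFDerivAt_integral_of_dominated_of_fderiv_le (F := fun u a => F a u)
    (F' := fun u a => fderiv ℝ (F a) u) (bound := fun _ => M + 1) hs ?_ ?_ ?_ ?_ ?_ ?_
  · filter_upwards [hU.mem_nhds hu] with v hv
    exact (hcont v hv).aestronglyMeasurable_of_isCompact hC hCm
  · exact (hcont u hu).integrableOn_compact' hC hCm
  · exact hDc.aestronglyMeasurable_of_isCompact hC hCm
  · exact (ae_restrict_iff' hCm).2 (Eventually.of_forall fun a ha v hv => hv.1 a ha)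
  · exact integrableOn_const hC.measure_ne_top
  · refine (ae_restrict_iff' hCm).2 (Eventually.of_forall fun a ha v hv => ?_)
    have := (hF a ha v hv.2).right_section
    exact (this.contDiffAt.differentiableAt (by simp)).hasFDerivAt

theorem integral_fderiv_apply (hC : IsCompact C) (hCm : MeasurableSet C)
    {F : N → E → ℝ} (hF : ∀ a ∈ C, ∀ u ∈ U,
      ContMDiffAt (J.prod 𝓘(ℝ, E)) 𝓘(ℝ, ℝ) ∞ (Function.uncurry F) (a, u)) {u : E} (hu : u ∈ U)
    (v : E) : (∫ a in C, fderiv ℝ (F a) u ∂μ) v = ∫ a in C, fderiv ℝ (F a) u v ∂μ := by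
  rw [ContinuousLinearMap.integral_apply]
  refine ContinuousOn.integrableOn_compact' hC hCm fun a ha => ?_
  exact (ContinuousAt.comp (g := fun p : N × E => fderiv ℝ (F p.1) p.2) (f := fun a => (a, u))
      (hF a ha u hu).partial_fderiv.continuousAt (by fun_prop)).continuousWithinAt

theorem contDiffOn_nat_setIntegral (hU : IsOpen U) (hC : IsCompact C) (hCm : MeasurableSet C)
    (n : ℕ) : ∀ {F : N → E → ℝ}, (∀ a ∈ C, ∀ u ∈ U,
      ContMDiffAt (J.prod 𝓘(ℝ, E)) 𝓘(ℝ, ℝ) ∞ (Function.uncurry F) (a, u)) →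
    ContDiffOn ℝ n (fun u => ∫ a in C, F a u ∂μ) U := by
  induction n with
  | zero =>
    intro F hF
    refine contDiffOn_zero.2 fun u hu => ?_
    exact (hasFDerivAt_setIntegral hU hC hCm hF hu).continuousAt.continuousWithinAt
  | succ n ih =>
    intro F hF
    push_cast
    rw [contDiffOn_succ_iff_fderiv_apply hU.uniqueDiffOn]
    refine ⟨fun u hu => (hasFDerivAt_setIntegral hU hC hCm hF
      hu).differentiableAt.differentiableWithinAt, fun h => by simp at h, fun v => ?_⟩
    have h1 : ContDiffOn ℝ n (fun u => ∫ a in C, fderiv ℝ (F a) u v ∂μ) U :=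
      ih fun a ha u hu => (hF a ha u hu).partial_fderiv.clm_apply contMDiffAt_const
    refine h1.congr fun u hu => ?_
    rw [fderivWithin_of_isOpen hU hu, (hasFDerivAt_setIntegral hU hC hCm hF hu).fderiv,
      integral_fderiv_apply hC hCm hF hu]

/-- The integral over a compact set of a jointly smooth function is a smooth function of the
parameter. -/
theorem contMDiffAt_setIntegral {X : Type*} [TopologicalSpace X] [ChartedSpace E X]
    [IsManifold 𝓘(ℝ, E) ∞ X] {W : Set X} (hC : IsCompact C)
    (hCm : MeasurableSet C) {x₀ : X} (hx₀ : W ∈ 𝓝 x₀)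
    {F : N → X → ℝ} (hF : ∀ a ∈ C, ∀ x ∈ W,
      ContMDiffAt (J.prod 𝓘(ℝ, E)) 𝓘(ℝ, ℝ) ∞ (Function.uncurry F) (a, x)) :
    ContMDiffAt 𝓘(ℝ, E) 𝓘(ℝ, ℝ) ∞ (fun x => ∫ a in C, F a x ∂μ) x₀ := by
  obtain ⟨W', hW', hWo, hxW⟩ := mem_nhds_iff.1 hx₀
  let φ := extChartAt 𝓘(ℝ, E) x₀
  let U : Set E := φ.target ∩ φ.symm ⁻¹' W'
  have hU : IsOpen U := (continuousOn_extChartAt_symm x₀).isOpen_inter_preimage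
    (isOpen_extChartAt_target x₀) hWo
  have h1 : ContDiffOn ℝ ∞ (fun u => ∫ a in C, F a (φ.symm u) ∂μ) U := by
    refine contDiffOn_infty.2 fun n => contDiffOn_nat_setIntegral (J := J) hU hC hCm n
      (F := fun a u => F a (φ.symm u)) fun a ha u hu => ?_
    have h2 : ContMDiffAt 𝓘(ℝ, E) 𝓘(ℝ, E) ∞ φ.symm u :=
      (contMDiffOn_extChartAt_symm x₀).contMDiffAt ((isOpen_extChartAt_target x₀).mem_nhds hu.1)
    exact ContMDiffAt.comp (g := Function.uncurry F) (f := fun q : N × E => (q.1, φ.symm q.2))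
      (a, u) (hF a ha _ (hW' hu.2)) (contMDiffAt_fst.prodMk (h2.comp (a, u) contMDiffAt_snd))
  have hφ : φ x₀ ∈ U := ⟨mem_extChartAt_target x₀, by
    simpa [φ, extChartAt_to_inv] using hxW⟩
  have h3 := ((h1.contDiffAt (hU.mem_nhds hφ)).contMDiffAt).comp x₀
    (contMDiffAt_extChartAt (n := ∞) (x := x₀))
  refine h3.congr_of_eventuallyEq ?_
  filter_upwards [extChartAt_source_mem_nhds (I := 𝓘(ℝ, E)) x₀] with x hx
  simp only [Function.comp, φ, (extChartAt 𝓘(ℝ, E) x₀).left_inv hx]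

end Parametric

section CoordDerivative

variable {E X E' X' EN HN N : Type*} [NormedAddCommGroup E] [NormedSpace ℝ E]
  [TopologicalSpace X] [ChartedSpace E X] [IsManifold 𝓘(ℝ, E) ∞ X]
  [NormedAddCommGroup E'] [NormedSpace ℝ E']
  [TopologicalSpace X'] [ChartedSpace E' X'] [IsManifold 𝓘(ℝ, E') ∞ X']
  [NormedAddCommGroup EN] [NormedSpace ℝ EN]
  [TopologicalSpace HN] {J : ModelWithCorners ℝ EN HN} [TopologicalSpace N] [ChartedSpace HN N]
  [IsManifold J ∞ N]

/-- In charts, the differential of a map depending smoothly on a parameter is a smooth family of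
linear maps. -/
theorem contMDiffAt_coord_mfderiv {F : N → X → X'} {n₀ : N} {x₀ : X} {y₀ : X'}
    (hF : ContMDiffAt (J.prod 𝓘(ℝ, E)) 𝓘(ℝ, E') ∞ (Function.uncurry F) (n₀, x₀))
    (hy₀ : F n₀ x₀ ∈ (chartAt E' y₀).source) :
    ContMDiffAt (J.prod 𝓘(ℝ, E)) 𝓘(ℝ, E →L[ℝ] E') ∞ (fun p : N × X =>
      (chartD y₀ (F p.1 p.2) ∘L mfderiv 𝓘(ℝ, E) 𝓘(ℝ, E') (F p.1) p.2) ∘L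
        (chartD x₀ p.2).inverse) (n₀, x₀) := by
  have : IsManifold J 1 N := IsManifold.of_le (n := ∞) (by simp)
  have : IsManifold 𝓘(ℝ, E) 1 X := IsManifold.of_le (n := ∞) (by simp)
  have : IsManifold 𝓘(ℝ, E') 1 X' := IsManifold.of_le (n := ∞) (by simp)
  have h0 : ContMDiffAt (J.prod 𝓘(ℝ, E)) 𝓘(ℝ, E') ∞
      (Function.uncurry fun n x => extChartAt 𝓘(ℝ, E') y₀ (F n x)) (n₀, x₀) :=
    ContMDiffAt.comp (g := extChartAt 𝓘(ℝ, E') y₀) (n₀, x₀) (contMDiffAt_extChartAt' hy₀) hF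
  have h1 : ContMDiffAt ((J.prod 𝓘(ℝ, E)).prod 𝓘(ℝ, E)) 𝓘(ℝ, E') ∞
      (Function.uncurry fun p : N × X => fun x => extChartAt 𝓘(ℝ, E') y₀ (F p.1 x))
      ((n₀, x₀), x₀) := by
    exact ContMDiffAt.comp (g := Function.uncurry fun n x => extChartAt 𝓘(ℝ, E') y₀ (F n x))
      (f := fun q : (N × X) × X => (q.1.1, q.2)) _ h0
      ((contMDiffAt_fst.comp _ contMDiffAt_fst).prodMk contMDiffAt_snd)
  have h2 := ContMDiffAt.mfderiv (x₀ := (n₀, x₀))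
    (fun p : N × X => fun x => extChartAt 𝓘(ℝ, E') y₀ (F p.1 x)) Prod.snd h1
    (contMDiffAt_snd (n := ∞)) (by simp)
  refine h2.congr_of_eventuallyEq ?_
  have hc : Tendsto (Function.uncurry F) (𝓝 (n₀, x₀)) (𝓝 (F n₀ x₀)) := hF.continuousAt
  have hd : ∀ᶠ p in 𝓝 (n₀, x₀), MDifferentiableAt 𝓘(ℝ, E) 𝓘(ℝ, E') (F p.1) p.2 := by
    filter_upwards [(contMDiffAt_iff_contMDiffAt_nhds (n := 1) (by simp)).1
      (hF.of_le (n := ∞) (m := 1) (by simp))] with p hp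
    exact (ContMDiffAt.right_section (F := F) (n₀ := p.1) (x₀ := p.2) hp).mdifferentiableAt
      (by simp)
  filter_upwards [(continuous_snd.tendsto (n₀, x₀)).eventually
    (eventually_mem_chartAt_source (E := E) x₀),
    hc.eventually ((chartAt E' y₀).open_source.mem_nhds hy₀), hd] with p hp hp' hpd
  rw [inTangentCoordinates_eq_mfderiv_comp hp (by rw [chartAt_self_eq]; trivial)]
  have h3 := mfderiv_extChartAt_comp_mfderivWithin_extChartAt_symm (I := 𝓘(ℝ, E)) (x := x₀)
    ((extChartAt 𝓘(ℝ, E) x₀).map_source (by simpa using hp))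
  have h4 := mfderivWithin_extChartAt_symm_comp_mfderiv_extChartAt (I := 𝓘(ℝ, E)) (x := x₀)
    ((extChartAt 𝓘(ℝ, E) x₀).map_source (by simpa using hp))
  rw [(extChartAt 𝓘(ℝ, E) x₀).left_inv (by simpa using hp)] at h3 h4
  have h5 : (chartD (E := E) x₀ p.2).inverse = _ := ContinuousLinearMap.inverse_eq h3 h4
  have h6 : mfderiv 𝓘(ℝ, E) 𝓘(ℝ, E') (fun x => extChartAt 𝓘(ℝ, E') y₀ (F p.1 x)) p.2 =
      chartD y₀ (F p.1 p.2) ∘L mfderiv 𝓘(ℝ, E) 𝓘(ℝ, E') (F p.1) p.2 :=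
    mfderiv_comp p.2 (mdifferentiableAt_extChartAt hp') hpd
  rw [h5, h6]
  -- the charts of the model space are the identity
  have h7 : ∀ c y : E', mfderiv 𝓘(ℝ, E') 𝓘(ℝ, E') (extChartAt 𝓘(ℝ, E') c) y =
      ContinuousLinearMap.id ℝ (TangentSpace 𝓘(ℝ, E') y) := by
    intro c y
    have h8 : (extChartAt 𝓘(ℝ, E') c : E' → E') = id := by
      rw [extChartAt_model_space_eq_id]; rfl
    rw [h8]
    exact mfderiv_id
  rw [h7]
  rfl

variable [FiniteDimensional ℝ E]

/-- The dual of a metric, evaluated on the pullbacks of two covectors which are constant in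
a chart along a map depending smoothly on a parameter, is a smooth function of the parameter. -/
theorem RiemMetric.contMDiffAt_dual_pullback (η : RiemMetric E X) {F : N → X → X'} {f : N → X}
    {n₀ : N} {y₀ : X'} (hf : ContMDiffAt J 𝓘(ℝ, E) ∞ f n₀)
    (hF : ContMDiffAt (J.prod 𝓘(ℝ, E)) 𝓘(ℝ, E') ∞ (Function.uncurry F) (n₀, f n₀))
    (hy₀ : F n₀ (f n₀) ∈ (chartAt E' y₀).source) (ξ ζ : E' →L[ℝ] ℝ) :
    ContMDiffAt J 𝓘(ℝ, ℝ) ∞ (fun n => η.dual (f n)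
      ((ξ ∘L chartD y₀ (F n (f n))) ∘L mfderiv 𝓘(ℝ, E) 𝓘(ℝ, E') (F n) (f n))
      ((ζ ∘L chartD y₀ (F n (f n))) ∘L mfderiv 𝓘(ℝ, E) 𝓘(ℝ, E') (F n) (f n))) n₀ := by
  have h1 := (contMDiffAt_coord_mfderiv hF hy₀).comp n₀ (contMDiffAt_id.prodMk hf)
  have h2 := η.isCometric_dual.contMDiffAt_apply rfl hf
    ((contMDiffAt_const (c := ξ)).clm_comp h1) ((contMDiffAt_const (c := ζ)).clm_comp h1)
  refine h2.congr_of_eventuallyEq ?_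
  filter_upwards [hf.continuousAt.eventually (eventually_mem_chartAt_source (E := E) (f n₀))]
    with n hn
  have h3 : ∀ ξ : E' →L[ℝ] ℝ, (ξ ∘L chartD y₀ (F n (f n))) ∘L
      mfderiv 𝓘(ℝ, E) 𝓘(ℝ, E') (F n) (f n) =
      (ξ ∘L (chartD y₀ (F n (f n)) ∘L mfderiv 𝓘(ℝ, E) 𝓘(ℝ, E') (F n) (f n)) ∘L
        (chartD (f n₀) (f n)).inverse) ∘L chartD (f n₀) (f n) := by
    intro ξ
    ext v
    simp [isInvertible_chartD hn]
  simp only [Function.comp]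
  rw [h3 ξ, h3 ζ]
  rfl

end CoordDerivative

/-! ### Riemannian submersions and push-forward of metrics -/

section Submersions

variable {E X E' X' E'' X'' : Type*}
  [NormedAddCommGroup E] [NormedSpace ℝ E]
  [TopologicalSpace X] [ChartedSpace E X] [IsManifold 𝓘(ℝ, E) ∞ X]
  [NormedAddCommGroup E'] [NormedSpace ℝ E']
  [TopologicalSpace X'] [ChartedSpace E' X'] [IsManifold 𝓘(ℝ, E') ∞ X']
  [NormedAddCommGroup E''] [NormedSpace ℝ E'']
  [TopologicalSpace X''] [ChartedSpace E'' X''] [IsManifold 𝓘(ℝ, E'') ∞ X'']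

variable (E E') in
/-- A map has a smooth local section through every point of its source. For a smooth map this
means that it is a submersion. -/
def HasLocalSections (π : X → X') : Prop :=
  ∀ z, ∃ σ : X' → X, ContMDiffAt 𝓘(ℝ, E') 𝓘(ℝ, E) ∞ σ (π z) ∧ σ (π z) = z ∧
    ∀ᶠ p in 𝓝 (π z), π (σ p) = p

theorem surjective_mfderiv_of_section {π : X → X'} {z : X} {σ : X' → X}
    (hπ : MDifferentiableAt 𝓘(ℝ, E) 𝓘(ℝ, E') π z)
    (hσ : MDifferentiableAt 𝓘(ℝ, E') 𝓘(ℝ, E) σ (π z)) (hz : σ (π z) = z)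
    (h : ∀ᶠ p in 𝓝 (π z), π (σ p) = p) :
    Function.Surjective (mfderiv 𝓘(ℝ, E) 𝓘(ℝ, E') π z) := by
  rw [← hz] at hπ
  have h1 := mfderiv_comp (π z) hπ hσ
  have h2 : π ∘ σ =ᶠ[𝓝 (π z)] id := h
  rw [h2.mfderiv_eq, mfderiv_id] at h1
  intro v
  refine ⟨(mfderiv 𝓘(ℝ, E') 𝓘(ℝ, E) σ (π z) v : E), ?_⟩
  have h3 := DFunLike.congr_fun h1 v
  rw [ContinuousLinearMap.comp_apply] at h3
  refine Eq.trans ?_ h3.symm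
  have h4 : ∀ (y : X) (w : E), y = z →
      (mfderiv 𝓘(ℝ, E) 𝓘(ℝ, E') π z w : E') = mfderiv 𝓘(ℝ, E) 𝓘(ℝ, E') π y w := by
    rintro y w rfl; rfl
  exact h4 _ _ hz

/-- The differential of a map with a smooth two-sided inverse. -/
theorem isInvertible_mfderiv {f : X → X'} {g : X' → X} {x : X}
    (hf : MDifferentiableAt 𝓘(ℝ, E) 𝓘(ℝ, E') f x)
    (hg : MDifferentiableAt 𝓘(ℝ, E') 𝓘(ℝ, E) g (f x)) (hgf : ∀ y, g (f y) = y)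
    (hfg : ∀ y, f (g y) = y) :
    (mfderiv 𝓘(ℝ, E) 𝓘(ℝ, E') f x).IsInvertible ∧
      ((mfderiv 𝓘(ℝ, E) 𝓘(ℝ, E') f x).inverse : E' →L[ℝ] E) =
        mfderiv 𝓘(ℝ, E') 𝓘(ℝ, E) g (f x) := by
  have h1 := mfderiv_comp x hg hf
  rw [show g ∘ f = id from funext hgf, mfderiv_id] at h1
  have hf' : MDifferentiableAt 𝓘(ℝ, E) 𝓘(ℝ, E') f (g (f x)) := by rwa [hgf]
  have h2 := mfderiv_comp (f x) hf' hg
  rw [show f ∘ g = id from funext hfg, mfderiv_id] at h2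
  have h4 : ∀ y : X, y = x → (mfderiv 𝓘(ℝ, E) 𝓘(ℝ, E') f y : E →L[ℝ] E') =
      mfderiv 𝓘(ℝ, E) 𝓘(ℝ, E') f x := by
    rintro y rfl; rfl
  let A : E →L[ℝ] E' := mfderiv 𝓘(ℝ, E) 𝓘(ℝ, E') f x
  let B : E' →L[ℝ] E := mfderiv 𝓘(ℝ, E') 𝓘(ℝ, E) g (f x)
  have hBA : B ∘L A = ContinuousLinearMap.id ℝ E := h1.symm
  have hAB : A ∘L B = ContinuousLinearMap.id ℝ E' := by
    have h5 : (mfderiv 𝓘(ℝ, E) 𝓘(ℝ, E') f (g (f x)) : E →L[ℝ] E') ∘L B =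
      ContinuousLinearMap.id ℝ E' := h2.symm
    rwa [h4 _ (hgf x)] at h5
  exact ⟨ContinuousLinearMap.IsInvertible.of_inverse (f := A) (g := B) hAB hBA,
    ContinuousLinearMap.inverse_eq (f := A) (g := B) hAB hBA⟩

namespace RiemMetric

variable [FiniteDimensional ℝ E] [FiniteDimensional ℝ E'] [FiniteDimensional ℝ E'']

/-- The value of a dual metric at equal points, on covectors given in the model space. -/
theorem dual_congr (η : RiemMetric E X) {x y : X} (h : x = y) (α β : E →L[ℝ] ℝ) :
    η.dual x α β = η.dual y α β := by
  subst h; rfl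

theorem IsRiemannianSubmersion.isTransverse {η : RiemMetric E X} {η' : RiemMetric E' X'}
    {π : X → X'} (h : η.IsRiemannianSubmersion η' π) : η.IsTransverse (E' := E') π := by
  intro x y hxy α β
  rw [h x, h y, hxy]

theorem IsRiemannianSubmersion.comp {η : RiemMetric E X} {η' : RiemMetric E' X'}
    {η'' : RiemMetric E'' X''} {π : X → X'} {ρ : X' → X''}
    (h : η.IsRiemannianSubmersion η' π) (h' : η'.IsRiemannianSubmersion η'' ρ)
    (hπ : MDifferentiable 𝓘(ℝ, E) 𝓘(ℝ, E') π) (hρ : MDifferentiable 𝓘(ℝ, E') 𝓘(ℝ, E'') ρ) :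
    η.IsRiemannianSubmersion η'' (ρ ∘ π) := by
  intro x α β
  rw [mfderiv_comp x (hρ _) (hπ x)]
  exact (h x (α ∘L mfderiv 𝓘(ℝ, E') 𝓘(ℝ, E'') ρ (π x))
    (β ∘L mfderiv 𝓘(ℝ, E') 𝓘(ℝ, E'') ρ (π x))).trans (h' (π x) α β)

theorem IsRiemannianSubmersion.isPreservedBy {η : RiemMetric E X} {f : X → X}
    (h : η.IsRiemannianSubmersion η f)
    (hf : ∀ x, Function.Injective (mfderiv 𝓘(ℝ, E) 𝓘(ℝ, E) f x)) : η.IsPreservedBy f := by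
  intro x v w
  set L := mfderiv 𝓘(ℝ, E) 𝓘(ℝ, E) f x
  have h1 : ∀ u, η.sharp x ((η.inner (f x) (L u)).comp L) = u := by
    intro u
    apply hf x
    by_contra hne
    obtain ⟨β, hβ⟩ := IsCometric.exists_apply_ne_zero (sub_ne_zero.2 hne)
    refine hβ ?_
    have h2 := h x β (η.inner (f x) (L u))
    rw [dual_eq_apply_sharp, dual_eq_apply_sharp, sharp_inner] at h2
    rw [map_sub, sub_eq_zero]
    exact h2
  have h3 := h x (η.inner (f x) (L v)) (η.inner (f x) (L w))
  rw [dual_inner, dual, h1, h1] at h3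
  exact h3.symm

theorem IsPreservedBy.isRiemannianSubmersion {η : RiemMetric E X} {f : X → X}
    (h : η.IsPreservedBy f)
    (hf : ∀ x, Function.Surjective (mfderiv 𝓘(ℝ, E) 𝓘(ℝ, E) f x)) :
    η.IsRiemannianSubmersion η f := by
  intro x α β
  set L := mfderiv 𝓘(ℝ, E) 𝓘(ℝ, E) f x
  have h1 : ∀ α, L (η.sharp x (α.comp L)) = η.sharp (f x) α := by
    intro α
    apply η.inner_injective
    ext w
    obtain ⟨u, rfl⟩ := hf x w
    rw [h x, inner_sharp, inner_sharp]
    rfl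
  rw [dual, dual, ← h1, ← h1, h x]

/-- A metric which is transverse to a surjective submersion `π` descends along `π`. -/
theorem exists_pushforward (η : RiemMetric E X) {π : X → X'}
    (hπ : ContMDiff 𝓘(ℝ, E) 𝓘(ℝ, E') ∞ π) (hsec : HasLocalSections E E' π)
    (hsurj : Function.Surjective π) (htr : η.IsTransverse (E' := E') π) :
    ∃ η' : RiemMetric E' X', η.IsRiemannianSubmersion η' π := by
  choose s hs using hsurj
  let P : ∀ z : X, (E' →L[ℝ] ℝ) → TangentSpace 𝓘(ℝ, E) z →L[ℝ] ℝ := fun z α =>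
    ContinuousLinearMap.comp (show TangentSpace 𝓘(ℝ, E') (π z) →L[ℝ] ℝ from α)
      (mfderiv 𝓘(ℝ, E) 𝓘(ℝ, E') π z)
  let b : ∀ p : X', (TangentSpace 𝓘(ℝ, E') p →L[ℝ] ℝ) → (TangentSpace 𝓘(ℝ, E') p →L[ℝ] ℝ) → ℝ :=
    fun p α β => η.dual (s p) (P (s p) α) (P (s p) β)
  have hb : ∀ (z : X) (α β : TangentSpace 𝓘(ℝ, E') (π z) →L[ℝ] ℝ),
      η.dual z (α ∘L mfderiv 𝓘(ℝ, E) 𝓘(ℝ, E') π z) (β ∘L mfderiv 𝓘(ℝ, E) 𝓘(ℝ, E') π z) =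
        b (π z) α β := fun z α β =>
    htr z (s (π z)) (hs _).symm (fun _ => (α : E' →L[ℝ] ℝ)) (fun _ => (β : E' →L[ℝ] ℝ))
  have hsmooth : ∀ (p₀ : X') (ξ ζ : E' →L[ℝ] ℝ), ContMDiffAt 𝓘(ℝ, E') 𝓘(ℝ, ℝ) ∞
      (fun p => b p (ξ ∘L chartD p₀ p) (ζ ∘L chartD p₀ p)) p₀ := by
    intro p₀ ξ ζ
    obtain ⟨σ, hσ, hσz, hπσ⟩ := hsec (s p₀)
    rw [hs] at hσ hσz hπσ
    have h1 := η.contMDiffAt_dual_pullback (J := 𝓘(ℝ, E')) (F := fun _ : X' => π) (y₀ := p₀) hσ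
      (ContMDiffAt.comp (g := π) (f := Prod.snd) _ hπ.contMDiffAt contMDiffAt_snd)
      (by rw [hπσ.self_of_nhds]; exact mem_chart_source E' p₀) ξ ζ
    refine h1.congr_of_eventuallyEq ?_
    filter_upwards [hπσ] with p hp
    have h2 := hb (σ p) (ξ ∘L chartD p₀ (π (σ p))) (ζ ∘L chartD p₀ (π (σ p)))
    rw [h2]
    have h3 : ∀ q : X', q = p → b p (ξ ∘L chartD p₀ p) (ζ ∘L chartD p₀ p) =
        b q (ξ ∘L chartD p₀ q) (ζ ∘L chartD p₀ q) := by
      rintro q rfl; rfl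
    exact h3 _ hp
  have hc : IsCometric b :=
    { symm := fun p α β => η.dual_comm _ _ _
      add_left := fun p α α' β => by
        refine Eq.trans ?_ (η.isCometric_dual.add_left (s p) (P (s p) α) (P (s p) α') _)
        rfl
      smul_left := fun p c α β => by
        refine Eq.trans ?_ (η.isCometric_dual.smul_left (s p) c (P (s p) α) _)
        rfl
      pos := fun p α hα => by
        refine η.isCometric_dual.pos _ _ fun h0 => hα ?_
        obtain ⟨σ, hσ, hσz, hπσ⟩ := hsec (s p)
        have hsj := surjective_mfderiv_of_section
          ((hπ.mdifferentiable (by simp)) (s p)) (hσ.mdifferentiableAt (by simp)) hσz hπσ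
        have h1 : ∀ v : E', (α : E' →L[ℝ] ℝ) v = 0 := fun v => by
          obtain ⟨u, rfl⟩ := hsj v
          exact DFunLike.congr_fun h0 u
        ext v
        exact h1 v
      smooth := hsmooth }
  obtain ⟨η', hη'⟩ := hc.exists_metric
  exact ⟨η', fun z α β => by rw [hη', hb]⟩

end RiemMetric

end Submersions

/-! ### Cotangent averages -/

section Average

namespace RiemMetric

section Existence

variable {E X : Type*}
  [NormedAddCommGroup E] [NormedSpace ℝ E] [FiniteDimensional ℝ E]
  [TopologicalSpace X] [ChartedSpace E X] [IsManifold 𝓘(ℝ, E) ∞ X]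
  {EK K : Type*} [NormedAddCommGroup EK] [NormedSpace ℝ EK] [TopologicalSpace K]
  [ChartedSpace EK K] [IsManifold 𝓘(ℝ, EK) ∞ K] [Group K] [CompactSpace K]
  [MeasurableSpace K] [BorelSpace K] {act : K → X → X}

/-- The integrand of a cotangent average, on the covectors which are constant in a chart, is
jointly smooth. -/
theorem contMDiffAt_average_integrand (η : RiemMetric E X)
    (hact : ContMDiff (𝓘(ℝ, EK).prod 𝓘(ℝ, E)) 𝓘(ℝ, E) ∞ (Function.uncurry act))
    (hinv : ContMDiff (𝓘(ℝ, EK).prod 𝓘(ℝ, E)) 𝓘(ℝ, E) ∞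
      (Function.uncurry fun a x => act a⁻¹ x))
    (h₁ : ∀ a x, act a⁻¹ (act a x) = x) {x₀ x : X} (hx : x ∈ (chartAt E x₀).source) (a : K)
    (ξ ζ : E →L[ℝ] ℝ) :
    ContMDiffAt (𝓘(ℝ, EK).prod 𝓘(ℝ, E)) 𝓘(ℝ, ℝ) ∞
      (Function.uncurry fun (a : K) (x : X) => η.dual (act a x)
        ((ξ ∘L chartD x₀ x).comp (mfderiv 𝓘(ℝ, E) 𝓘(ℝ, E) (act a) x).inverse)
        ((ζ ∘L chartD x₀ x).comp (mfderiv 𝓘(ℝ, E) 𝓘(ℝ, E) (act a) x).inverse)) (a, x) := by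
  have h2 : ∀ a x, act a (act a⁻¹ x) = x := fun a x => by simpa using h₁ a⁻¹ x
  have hF : ContMDiff ((𝓘(ℝ, EK).prod 𝓘(ℝ, E)).prod 𝓘(ℝ, E)) 𝓘(ℝ, E) ∞
      (Function.uncurry fun (n : K × X) (y : X) => act n.1⁻¹ y) :=
    hinv.comp ((contMDiff_fst.comp contMDiff_fst).prodMk contMDiff_snd)
  have h3 := η.contMDiffAt_dual_pullback (n₀ := (a, x)) (y₀ := x₀) (hact (a, x))
    (hF.contMDiffAt) (by simpa [h₁] using hx) ξ ζ
  refine h3.congr_of_eventuallyEq (Eventually.of_forall ?_)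
  rintro ⟨c, y⟩
  have hd : ∀ c, MDifferentiable 𝓘(ℝ, E) 𝓘(ℝ, E) (act c) := fun c y =>
    (ContMDiffAt.right_section (F := act) (n₀ := c) (hact (c, y))).mdifferentiableAt (by simp)
  have h4 := (isInvertible_mfderiv (hd c y) (hd c⁻¹ (act c y)) (h₁ c) (h2 c)).2
  have h5 : ∀ ξ : E →L[ℝ] ℝ,
      ((ξ ∘L chartD x₀ y).comp (mfderiv 𝓘(ℝ, E) 𝓘(ℝ, E) (act c) y).inverse : E →L[ℝ] ℝ) =
      (ξ ∘L chartD x₀ (act c⁻¹ (act c y))).comp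
        (mfderiv 𝓘(ℝ, E) 𝓘(ℝ, E) (act c⁻¹) (act c y)) := by
    intro ξ
    rw [← h4]
    have h6 : ∀ z : X, z = y → (chartD x₀ z : E →L[ℝ] E) = chartD x₀ y := by
      rintro z rfl; rfl
    have h7 := h6 _ (h₁ c y)
    exact congrArg (fun D : E →L[ℝ] E =>
      ((ξ ∘L D).comp (mfderiv 𝓘(ℝ, E) 𝓘(ℝ, E) (act c) y).inverse : E →L[ℝ] ℝ)) h7.symm
  simp only [Function.uncurry]
  exact congrArg₂ (η.dual (act c y)) (h5 ξ) (h5 ζ)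

/-- A metric on a manifold with a smooth action of a compact Lie group has a cotangent average. -/
theorem exists_isCotangentAverage (η : RiemMetric E X) (μ : Measure K) [IsProbabilityMeasure μ]
    (hact : ContMDiff (𝓘(ℝ, EK).prod 𝓘(ℝ, E)) 𝓘(ℝ, E) ∞ (Function.uncurry act))
    (hinv : ContMDiff (𝓘(ℝ, EK).prod 𝓘(ℝ, E)) 𝓘(ℝ, E) ∞
      (Function.uncurry fun a x => act a⁻¹ x))
    (h₁ : ∀ a x, act a⁻¹ (act a x) = x) :
    ∃ η' : RiemMetric E X, η'.IsCotangentAverage η act μ := by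
  have h2 : ∀ a x, act a (act a⁻¹ x) = x := fun a x => by simpa using h₁ a⁻¹ x
  let I : ∀ x : X, (TangentSpace 𝓘(ℝ, E) x →L[ℝ] ℝ) → (TangentSpace 𝓘(ℝ, E) x →L[ℝ] ℝ) →
      K → ℝ := fun x α β a => η.dual (act a x)
        (α.comp (mfderiv 𝓘(ℝ, E) 𝓘(ℝ, E) (act a) x).inverse)
        (β.comp (mfderiv 𝓘(ℝ, E) 𝓘(ℝ, E) (act a) x).inverse)
  have hcont : ∀ x α β, Continuous (I x α β) := by
    intro x α β
    rw [continuous_iff_continuousAt]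
    intro a
    have h3 := (η.contMDiffAt_average_integrand hact hinv h₁ (mem_chart_source E x) a
      (α ∘L (chartD x x).inverse) (β ∘L (chartD x x).inverse)).left_section.continuousAt
    simpa only [comp_chartD_comp_inverse (mem_chart_source E x)] using h3
  have hint : ∀ x α β, Integrable (I x α β) μ := fun x α β => by
    have := ((hcont x α β).continuousOn (s := univ)).integrableOn_compact' (μ := μ) isCompact_univ
      MeasurableSet.univ
    simpa using this
  let b : ∀ x : X, (TangentSpace 𝓘(ℝ, E) x →L[ℝ] ℝ) → (TangentSpace 𝓘(ℝ, E) x →L[ℝ] ℝ) → ℝ :=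
    fun x α β => ∫ a, I x α β a ∂μ
  have hb : IsCometric b :=
    { symm := fun x α β => integral_congr_ae (Eventually.of_forall fun a => η.dual_comm _ _ _)
      add_left := fun x α α' β => by
        simp only [b]
        rw [← integral_add (hint _ _ _) (hint _ _ _)]
        refine integral_congr_ae (Eventually.of_forall fun a => ?_)
        simp only [I, ContinuousLinearMap.add_comp]
        exact η.isCometric_dual.add_left _ _ _ _
      smul_left := fun x c α β => by
        simp only [b]
        rw [← integral_const_mul]
        refine integral_congr_ae (Eventually.of_forall fun a => ?_)
        simp only [I, ContinuousLinearMap.smul_comp]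
        exact η.isCometric_dual.smul_left _ _ _ _
      pos := fun x α hα => by
        have hpos : ∀ a, 0 < I x α α a := fun a => by
          refine η.isCometric_dual.pos _ _ fun h0 => hα ?_
          have hd : ∀ c, MDifferentiable 𝓘(ℝ, E) 𝓘(ℝ, E) (act c) := fun c y =>
            (ContMDiffAt.right_section (F := act) (n₀ := c) (hact (c, y))).mdifferentiableAt
              (by simp)
          obtain ⟨e, he⟩ := (isInvertible_mfderiv (hd a x) (hd a⁻¹ (act a x)) (h₁ a) (h2 a)).1
          ext v
          have h3 := DFunLike.congr_fun h0 (e v)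
          rw [← he] at h3
          simpa using h3
        refine (integral_pos_iff_support_of_nonneg (fun a => (hpos a).le) (hint x α α)).2 ?_
        have : Function.support (I x α α) = univ := by
          ext a; simpa using (hpos a).ne'
        rw [this, measure_univ]
        exact one_pos
      smooth := fun x₀ ξ ζ => by
        have h3 := contMDiffAt_setIntegral (μ := μ) (J := 𝓘(ℝ, EK)) (isCompact_univ (X := K))
          MeasurableSet.univ (eventually_mem_chartAt_source (E := E) x₀)
          (F := fun a x => I x (ξ ∘L chartD x₀ x) (ζ ∘L chartD x₀ x) a)
          (fun a _ x hx => η.contMDiffAt_average_integrand hact hinv h₁ hx a ξ ζ)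
        simpa only [Measure.restrict_univ] using h3 }
  obtain ⟨η', hη'⟩ := hb.exists_metric
  exact ⟨η', fun x α β => ⟨hint x α β, hη' x α β⟩⟩

/-- The cotangent average with respect to a right invariant measure is invariant. -/
theorem IsCotangentAverage.isPreservedBy {η η' : RiemMetric E X} {μ : Measure K}
    [ContinuousMul K] [μ.IsMulRightInvariant] (h : η'.IsCotangentAverage η act μ)
    (hd : ∀ a, MDifferentiable 𝓘(ℝ, E) 𝓘(ℝ, E) (act a)) (h₁ : ∀ x, act 1 x = x)
    (hmul : ∀ a b x, act (a * b) x = act a (act b x)) (b : K) : η'.IsPreservedBy (act b) := by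
  have hl : ∀ a x, act a⁻¹ (act a x) = x := fun a x => by rw [← hmul, inv_mul_cancel, h₁]
  have hr : ∀ a x, act a (act a⁻¹ x) = x := fun a x => by rw [← hmul, mul_inv_cancel, h₁]
  have hinv : ∀ a x, (mfderiv 𝓘(ℝ, E) 𝓘(ℝ, E) (act a) x).IsInvertible := fun a x =>
    (isInvertible_mfderiv (hd a x) (hd a⁻¹ (act a x)) (hl a) (hr a)).1
  refine IsRiemannianSubmersion.isPreservedBy (fun x α β => ?_) (fun x => (hinv b x).injective)
  rw [(h x _ _).2, (h (act b x) α β).2, ← integral_mul_right_eq_self _ b]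
  refine integral_congr_ae (Eventually.of_forall fun a => ?_)
  have h2 : ∀ α : TangentSpace 𝓘(ℝ, E) (act b x) →L[ℝ] ℝ,
      ((α.comp (mfderiv 𝓘(ℝ, E) 𝓘(ℝ, E) (act b) x)).comp
        (mfderiv 𝓘(ℝ, E) 𝓘(ℝ, E) (act (a * b)) x).inverse : E →L[ℝ] ℝ) =
      α.comp (mfderiv 𝓘(ℝ, E) 𝓘(ℝ, E) (act a) (act b x)).inverse := by
    intro α
    have h3 : act (a * b) = act a ∘ act b := funext fun y => hmul a b y
    rw [h3, mfderiv_comp x (hd a _) (hd b x)]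
    obtain ⟨e, he⟩ := hinv b x
    obtain ⟨e', he'⟩ := hinv a (act b x)
    rw [← he, ← he', ContinuousLinearMap.inverse_equiv]
    have h4 : ((e' : TangentSpace 𝓘(ℝ, E) (act b x) →L[ℝ] TangentSpace 𝓘(ℝ, E)
        (act a (act b x))) ∘L (e : TangentSpace 𝓘(ℝ, E) x →L[ℝ] TangentSpace 𝓘(ℝ, E)
        (act b x))).inverse = (e.trans e').symm :=
      ContinuousLinearMap.inverse_equiv (e.trans e')
    rw [show ((act a ∘ act b) x) = act a (act b x) from rfl, h4]
    ext v
    exact congrArg α (e.apply_symm_apply (e'.symm v))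
  refine Eq.trans ?_ (η.dual_congr (hmul a b x) _ _)
  exact congrArg₂ (η.dual (act (a * b) x)) (h2 α) (h2 β)

end Existence

section Functoriality

variable {E X E' X' : Type*}
  [NormedAddCommGroup E] [NormedSpace ℝ E] [FiniteDimensional ℝ E]
  [TopologicalSpace X] [ChartedSpace E X] [IsManifold 𝓘(ℝ, E) ∞ X]
  [NormedAddCommGroup E'] [NormedSpace ℝ E'] [FiniteDimensional ℝ E']
  [TopologicalSpace X'] [ChartedSpace E' X'] [IsManifold 𝓘(ℝ, E') ∞ X']
  {K K' : Type*} [MeasurableSpace K] [MeasurableSpace K']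

/-- An equivariant Riemannian submersion induces a Riemannian submersion between the cotangent
averages. -/
theorem IsRiemannianSubmersion.average {η ηbar : RiemMetric E X} {η' ηbar' : RiemMetric E' X'}
    {π : X → X'} (h : η.IsRiemannianSubmersion η' π) {act : K → X → X} {act' : K' → X' → X'}
    {μ : Measure K} {μ' : Measure K'} (hη : ηbar.IsCotangentAverage η act μ)
    (hη' : ηbar'.IsCotangentAverage η' act' μ') {φ : K → K'} (hφ : MeasurePreserving φ μ μ')
    (hπ : MDifferentiable 𝓘(ℝ, E) 𝓘(ℝ, E') π) (hd : ∀ a, MDifferentiable 𝓘(ℝ, E) 𝓘(ℝ, E) (act a))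
    (hd' : ∀ a, MDifferentiable 𝓘(ℝ, E') 𝓘(ℝ, E') (act' a))
    (hinv : ∀ a x, (mfderiv 𝓘(ℝ, E) 𝓘(ℝ, E) (act a) x).IsInvertible)
    (hinv' : ∀ a x, (mfderiv 𝓘(ℝ, E') 𝓘(ℝ, E') (act' a) x).IsInvertible)
    (heq : ∀ a x, π (act a x) = act' (φ a) (π x)) :
    ηbar.IsRiemannianSubmersion ηbar' π := by
  intro x α β
  rw [(hη x _ _).2, (hη' (π x) α β).2, ← hφ.map_eq, integral_map hφ.measurable.aemeasurable
    (by rw [hφ.map_eq]; exact (hη' (π x) α β).1.aestronglyMeasurable)]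
  refine integral_congr_ae (Eventually.of_forall fun a => ?_)
  have h2 : ∀ α : TangentSpace 𝓘(ℝ, E') (π x) →L[ℝ] ℝ,
      ((α.comp (mfderiv 𝓘(ℝ, E) 𝓘(ℝ, E') π x)).comp
        (mfderiv 𝓘(ℝ, E) 𝓘(ℝ, E) (act a) x).inverse : E →L[ℝ] ℝ) =
      ContinuousLinearMap.comp
        (show TangentSpace 𝓘(ℝ, E') (π (act a x)) →L[ℝ] ℝ from
          α.comp (mfderiv 𝓘(ℝ, E') 𝓘(ℝ, E') (act' (φ a)) (π x)).inverse)
        (mfderiv 𝓘(ℝ, E) 𝓘(ℝ, E') π (act a x)) := by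
    intro α
    have h3 : π ∘ act a = act' (φ a) ∘ π := funext fun y => heq a y
    have h4 := mfderiv_comp x (hπ (act a x)) (hd a x)
    rw [h3, mfderiv_comp x (hd' (φ a) (π x)) (hπ x)] at h4
    obtain ⟨e, he⟩ := hinv a x
    obtain ⟨e', he'⟩ := hinv' (φ a) (π x)
    rw [← he, ← he', ContinuousLinearMap.inverse_equiv, ContinuousLinearMap.inverse_equiv]
    ext v
    obtain ⟨u, rfl⟩ := e.surjective v
    have he_u : (e u : E) = mfderiv 𝓘(ℝ, E) 𝓘(ℝ, E) (act a) x u := DFunLike.congr_fun he u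
    have he'_u : ∀ u : E', (e' u : E') = mfderiv 𝓘(ℝ, E') 𝓘(ℝ, E') (act' (φ a)) (π x) u :=
      fun u => DFunLike.congr_fun he' u
    have h5 : (e' (mfderiv 𝓘(ℝ, E) 𝓘(ℝ, E') π x u) : E') =
        mfderiv 𝓘(ℝ, E) 𝓘(ℝ, E') π (act a x) (e u) := by
      refine (he'_u _).trans ((DFunLike.congr_fun h4 u).trans ?_)
      exact congrArg (mfderiv 𝓘(ℝ, E) 𝓘(ℝ, E') π (act a x)) he_u.symm
    have h6 : (e'.symm (e' (mfderiv 𝓘(ℝ, E) 𝓘(ℝ, E') π x u))) =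
      e'.symm (mfderiv 𝓘(ℝ, E) 𝓘(ℝ, E') π (act a x) (e u) : E') := congrArg e'.symm h5
    rw [e'.symm_apply_apply] at h6
    have h7 : e.symm (e u) = u := e.symm_apply_apply u
    have h8 : α (mfderiv 𝓘(ℝ, E) 𝓘(ℝ, E') π x (e.symm (e u))) =
      α (e'.symm (mfderiv 𝓘(ℝ, E) 𝓘(ℝ, E') π (act a x) (e u) : E')) := by
      rw [h7, h6]
    exact h8
  have h9 := h (act a x)
    (show E' →L[ℝ] ℝ from α.comp (mfderiv 𝓘(ℝ, E') 𝓘(ℝ, E') (act' (φ a)) (π x)).inverse)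
    (show E' →L[ℝ] ℝ from β.comp (mfderiv 𝓘(ℝ, E') 𝓘(ℝ, E') (act' (φ a)) (π x)).inverse)
  refine Eq.trans (Eq.trans ?_ h9) (η'.dual_congr (heq a x) _ _)
  exact congrArg₂ (η.dual (act a x)) (h2 α) (h2 β)

end Functoriality

end RiemMetric

end Average

/-! ### Local trivializations of submersions -/

section FibreCharts

variable {E X E' X' : Type*}
  [NormedAddCommGroup E] [NormedSpace ℝ E]
  [TopologicalSpace X] [ChartedSpace E X] [IsManifold 𝓘(ℝ, E) ∞ X]
  [NormedAddCommGroup E'] [NormedSpace ℝ E']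
  [TopologicalSpace X'] [ChartedSpace E' X'] [IsManifold 𝓘(ℝ, E') ∞ X']
  {F : Type*} [NormedAddCommGroup F] [NormedSpace ℝ F]

/-- A smooth local trivialization `X ≃ X' × F` of a map `f : X → X'`, that is, a diffeomorphism
between open sets whose first component is `f`. -/
structure IsFibreChart (E E' : Type*) {X X' F : Type*}
    [NormedAddCommGroup E] [NormedSpace ℝ E] [TopologicalSpace X] [ChartedSpace E X]
    [NormedAddCommGroup E'] [NormedSpace ℝ E'] [TopologicalSpace X'] [ChartedSpace E' X']
    [NormedAddCommGroup F] [NormedSpace ℝ F]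
    (f : X → X') (S : OpenPartialHomeomorph X (X' × F)) : Prop where
  fst_apply : ∀ x ∈ S.source, (S x).1 = f x
  smooth : ContMDiffOn 𝓘(ℝ, E) (𝓘(ℝ, E').prod 𝓘(ℝ, F)) ∞ S S.source
  smooth_symm : ContMDiffOn (𝓘(ℝ, E').prod 𝓘(ℝ, F)) 𝓘(ℝ, E) ∞ S.symm S.target

namespace IsFibreChart

variable {f : X → X'} {S : OpenPartialHomeomorph X (X' × F)}

theorem contMDiffAt_snd (h : IsFibreChart E E' f S) {x : X} (hx : x ∈ S.source) :
    ContMDiffAt 𝓘(ℝ, E) 𝓘(ℝ, F) ∞ (fun x => (S x).2) x :=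
  ContMDiffAt.snd ((h.smooth x hx).contMDiffAt (S.open_source.mem_nhds hx))

theorem contMDiffAt_symm (h : IsFibreChart E E' f S) {y : X' × F} (hy : y ∈ S.target) :
    ContMDiffAt (𝓘(ℝ, E').prod 𝓘(ℝ, F)) 𝓘(ℝ, E) ∞ S.symm y :=
  (h.smooth_symm y hy).contMDiffAt (S.open_target.mem_nhds hy)

theorem apply_eq (h : IsFibreChart E E' f S) {x : X} (hx : x ∈ S.source) :
    S x = (f x, (S x).2) := by
  rw [← h.fst_apply x hx]

theorem mk_mem_target (h : IsFibreChart E E' f S) {x : X} (hx : x ∈ S.source) :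
    (f x, (S x).2) ∈ S.target := by
  rw [← h.apply_eq hx]; exact S.map_source hx

theorem symm_mk (h : IsFibreChart E E' f S) {x : X} (hx : x ∈ S.source) :
    S.symm (f x, (S x).2) = x := by
  rw [← h.apply_eq hx]; exact S.left_inv hx

theorem map_symm (h : IsFibreChart E E' f S) {y : X' × F} (hy : y ∈ S.target) :
    f (S.symm y) = y.1 := by
  rw [← h.fst_apply _ (S.map_target hy), S.right_inv hy]

end IsFibreChart

/-- The charts in which a submersion is a linear projection `E ≃ E' × F → E'`, composed with the
inverse of the chart of `X'`. -/
theorem Manifold.IsSubmersionAtOfComplement.exists_isFibreChart {f : X → X'} {x₀ : X}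
    (h : Manifold.IsSubmersionAtOfComplement F 𝓘(ℝ, E) 𝓘(ℝ, E') ∞ f x₀) :
    ∃ S : OpenPartialHomeomorph X (X' × F), x₀ ∈ S.source ∧ IsFibreChart E E' f S := by
  have htgt : ∀ u ∈ h.domChart.target, (h.equiv u).1 ∈ h.codChart.target := fun u hu => by
    have h1 : u ∈ (h.domChart.extend 𝓘(ℝ, E)).target := by simpa using hu
    simpa using h.target_subset_preimage_target h1
  have hw : ∀ x ∈ h.domChart.source, (h.equiv (h.domChart x)).1 = h.codChart (f x) := by
    intro x hx
    have h0 : h.domChart x ∈ (h.domChart.extend 𝓘(ℝ, E)).target := by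
      simpa using h.domChart.map_source hx
    have h1 := h.writtenInCharts h0
    simp only [Function.comp_apply, OpenPartialHomeomorph.extend_coe,
      OpenPartialHomeomorph.extend_coe_symm, modelWithCornersSelf_coe,
      modelWithCornersSelf_coe_symm, id_eq, h.domChart.left_inv hx] at h1
    exact h1.symm
  let S := h.domChart ≫ₕ h.equiv.toHomeomorph.toOpenPartialHomeomorph ≫ₕ
    (h.codChart.prod (OpenPartialHomeomorph.refl F)).symm
  have hS : S.source = h.domChart.source := by
    ext x
    simp only [S, OpenPartialHomeomorph.trans_source, OpenPartialHomeomorph.prod_symm,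
      mem_inter_iff, mem_preimage]
    constructor
    · exact fun h => h.1
    · intro hx
      have := htgt _ (h.domChart.map_source hx)
      simp [hx, this]
  have hSx : ∀ x, S x = (h.codChart.symm (h.equiv (h.domChart x)).1, (h.equiv (h.domChart x)).2) :=
    fun x => rfl
  have hSy : ∀ y, S.symm y = h.domChart.symm (h.equiv.symm (h.codChart y.1, y.2)) := fun y => rfl
  have hc1 := contMDiffOn_of_mem_maximalAtlas h.domChart_mem_maximalAtlas
  have hc2 := contMDiffOn_symm_of_mem_maximalAtlas h.domChart_mem_maximalAtlas
  have hc3 := contMDiffOn_of_mem_maximalAtlas h.codChart_mem_maximalAtlas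
  have hc4 := contMDiffOn_symm_of_mem_maximalAtlas h.codChart_mem_maximalAtlas
  have he : ContMDiff 𝓘(ℝ, E) 𝓘(ℝ, E' × F) ∞ h.equiv := h.equiv.contDiff.contMDiff
  have he' : ContMDiff 𝓘(ℝ, E' × F) 𝓘(ℝ, E) ∞ h.equiv.symm := h.equiv.symm.contDiff.contMDiff
  refine ⟨S, hS ▸ h.mem_domChart_source, ⟨fun x hx => ?_, ?_, ?_⟩⟩
  · rw [hS] at hx
    rw [hSx, hw x hx]
    exact h.codChart.left_inv (h.source_subset_preimage_source hx)
  · rw [hS]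
    have h1 : ContMDiffOn 𝓘(ℝ, E) 𝓘(ℝ, E' × F) ∞ (fun x => h.equiv (h.domChart x))
      h.domChart.source := he.comp_contMDiffOn hc1
    have hl1 : ContMDiff 𝓘(ℝ, E' × F) 𝓘(ℝ, E') ∞ (Prod.fst : E' × F → E') :=
      contDiff_fst.contMDiff
    have hl2 : ContMDiff 𝓘(ℝ, E' × F) 𝓘(ℝ, F) ∞ (Prod.snd : E' × F → F) :=
      contDiff_snd.contMDiff
    exact (hc4.comp (hl1.comp_contMDiffOn h1) fun x hx => htgt _ (h.domChart.map_source hx)).prodMk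
      (hl2.comp_contMDiffOn h1)
  · have hy1 : ∀ y ∈ S.target, y.1 ∈ h.codChart.source ∧
        h.equiv.symm (h.codChart y.1, y.2) ∈ h.domChart.target := by
      intro y hy
      simp only [S, OpenPartialHomeomorph.trans_target, OpenPartialHomeomorph.prod_symm,
        mem_inter_iff, mem_preimage] at hy
      have h2 : y.1 ∈ h.codChart.source := by simpa using hy.1.1
      exact ⟨h2, hy.2⟩
    have h1 : ContMDiffOn (𝓘(ℝ, E').prod 𝓘(ℝ, F)) 𝓘(ℝ, E' × F) ∞
        (fun y : X' × F => (h.codChart y.1, y.2)) S.target :=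
      (hc3.comp contMDiffOn_fst fun y hy => (hy1 y hy).1).prodMk_space contMDiffOn_snd
    exact hc2.comp (he'.comp_contMDiffOn h1) fun y hy => (hy1 y hy).2

/-- A submersion has fibre charts with a fixed model `ℝᵏ` for the fibres. -/
theorem Manifold.IsSubmersion.exists_isFibreChart [FiniteDimensional ℝ E] {f : X → X'}
    (h : Manifold.IsSubmersion 𝓘(ℝ, E) 𝓘(ℝ, E') ∞ f) :
    ∃ k : ℕ, ∀ x₀, ∃ S : OpenPartialHomeomorph X (X' × (Fin k → ℝ)),
      x₀ ∈ S.source ∧ IsFibreChart E E' f S := by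
  obtain ⟨F, _, _, hF⟩ := h
  rcases isEmpty_or_nonempty X with hX | ⟨⟨x⟩⟩
  · exact ⟨0, fun x₀ => hX.elim x₀⟩
  have : FiniteDimensional ℝ (E' × F) := (hF x).equiv.toLinearEquiv.finiteDimensional
  have : FiniteDimensional ℝ F :=
    FiniteDimensional.of_surjective (LinearMap.snd ℝ E' F) LinearMap.snd_surjective
  let e : F ≃L[ℝ] (Fin (Module.finrank ℝ F) → ℝ) :=
    ContinuousLinearEquiv.ofFinrankEq (by simp)
  exact ⟨_, fun x₀ => ((hF x₀).trans_F e).exists_isFibreChart⟩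

theorem Manifold.IsSubmersion.hasLocalSections {f : X → X'}
    (h : Manifold.IsSubmersion 𝓘(ℝ, E) 𝓘(ℝ, E') ∞ f) : HasLocalSections E E' f := by
  obtain ⟨F, _, _, hF⟩ := h
  intro z
  obtain ⟨S, hz, hS⟩ := (hF z).exists_isFibreChart
  have h1 : ContMDiff 𝓘(ℝ, E') (𝓘(ℝ, E').prod 𝓘(ℝ, F)) ∞ fun p : X' => (p, (S z).2) :=
    contMDiff_id.prodMk contMDiff_const
  refine ⟨fun p => S.symm (p, (S z).2), ?_, hS.symm_mk hz, ?_⟩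
  · exact ContMDiffAt.comp (g := S.symm) (f z) (hS.contMDiffAt_symm (hS.mk_mem_target hz))
      h1.contMDiffAt
  · filter_upwards [h1.continuous.continuousAt.preimage_mem_nhds
      (S.open_target.mem_nhds (hS.mk_mem_target hz))] with p hp
    exact hS.map_symm hp

theorem Manifold.IsSubmersion.contMDiff' {f : X → X'}
    (h : Manifold.IsSubmersion 𝓘(ℝ, E) 𝓘(ℝ, E') ∞ f) : ContMDiff 𝓘(ℝ, E) 𝓘(ℝ, E') ∞ f := by
  obtain ⟨F, _, _, hF⟩ := h
  exact fun x => (hF x).contMDiffAt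

theorem HasLocalSections.comp_invertible {π : X → X'} (h : HasLocalSections E E' π) {Y : Type*}
    {EY : Type*} [NormedAddCommGroup EY] [NormedSpace ℝ EY] [TopologicalSpace Y]
    [ChartedSpace EY Y] {f : Y → X} {g : X → Y} (hg : ContMDiff 𝓘(ℝ, E) 𝓘(ℝ, EY) ∞ g)
    (hgf : ∀ y, g (f y) = y) (hfg : ∀ x, f (g x) = x) :
    HasLocalSections EY E' (fun y => π (f y)) := by
  intro z
  obtain ⟨σ, hσ, hσz, hπ⟩ := h (f z)
  exact ⟨fun p => g (σ p), ContMDiffAt.comp _ hg.contMDiffAt hσ, by simp only [hσz, hgf],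
    hπ.mono fun p hp => by simp only [hfg, hp]⟩

end FibreCharts

/-! ### Lie groupoids as total operations and triangles -/

namespace LieGroupoid

section Algebra

variable {E₀ E₁ E₂ X₀ X₁ X₂ : Type*}
  [NormedAddCommGroup E₀] [NormedSpace ℝ E₀] [TopologicalSpace X₀] [ChartedSpace E₀ X₀]
  [NormedAddCommGroup E₁] [NormedSpace ℝ E₁] [TopologicalSpace X₁] [ChartedSpace E₁ X₁]
  [NormedAddCommGroup E₂] [NormedSpace ℝ E₂] [TopologicalSpace X₂] [ChartedSpace E₂ X₂]
  (X : LieGroupoid E₀ E₁ E₂ X₀ X₁ X₂)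

open Classical in
/-- The composition of a Lie groupoid as a total operation, with the value `p` on a pair `(p, q)`
which is not composable. -/
noncomputable def op (p q : X₁) : X₁ := if h : X.src p = X.tgt q then X.comp p q h else p

theorem op_eq {p q : X₁} (h : X.src p = X.tgt q) : X.op p q = X.comp p q h := dif_pos h

theorem src_op {p q : X₁} (h : X.src p = X.tgt q) : X.src (X.op p q) = X.src q := by
  rw [X.op_eq h, X.src_comp]

theorem tgt_op {p q : X₁} (h : X.src p = X.tgt q) : X.tgt (X.op p q) = X.tgt p := by
  rw [X.op_eq h, X.tgt_comp]

theorem op_assoc {p q r : X₁} (h : X.src p = X.tgt q) (h' : X.src q = X.tgt r) :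
    X.op (X.op p q) r = X.op p (X.op q r) := by
  rw [X.op_eq (p := X.op p q) (by rw [X.src_op h, h']),
    X.op_eq (q := X.op q r) (by rw [X.tgt_op h', h])]
  simp only [X.op_eq h, X.op_eq h']
  exact X.comp_assoc p q r h h'

theorem unit_op {x : X₀} {p : X₁} (h : x = X.tgt p) : X.op (X.unit x) p = p := by
  subst h
  rw [X.op_eq (X.src_unit _), X.unit_comp]

theorem op_unit {x : X₀} {p : X₁} (h : X.src p = x) : X.op p (X.unit x) = p := by
  subst h
  rw [X.op_eq (X.tgt_unit _).symm, X.comp_unit]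

theorem inv_op_self (p : X₁) : X.op (X.inv p) p = X.unit (X.src p) := by
  rw [X.op_eq (X.src_inv p), X.inv_comp]

theorem op_inv_self (p : X₁) : X.op p (X.inv p) = X.unit (X.tgt p) := by
  rw [X.op_eq (X.tgt_inv p).symm, X.comp_inv]

theorem inv_op_cancel_left {p q : X₁} (h : X.src p = X.tgt q) :
    X.op (X.inv p) (X.op p q) = q := by
  rw [← X.op_assoc (X.src_inv p) h, X.inv_op_self, X.unit_op h]

theorem op_inv_cancel_left {p q : X₁} (h : X.tgt p = X.tgt q) :
    X.op p (X.op (X.inv p) q) = q := by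
  rw [← X.op_assoc (X.tgt_inv p).symm ((X.src_inv p).trans h), X.op_inv_self, X.unit_op h]

theorem op_inv_cancel_right {p q : X₁} (h : X.src p = X.tgt q) :
    X.op (X.op p q) (X.inv q) = p := by
  rw [X.op_assoc h (X.tgt_inv q).symm, X.op_inv_self, X.op_unit h]

theorem inv_op_cancel_right {p q : X₁} (h : X.src p = X.src q) :
    X.op (X.op p (X.inv q)) q = p := by
  rw [X.op_assoc (h.trans (X.tgt_inv q).symm) (X.src_inv q), X.inv_op_self, X.op_unit h]

theorem eq_inv_of_op_eq_unit {p q : X₁} (h : X.src p = X.tgt q)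
    (h1 : X.op p q = X.unit (X.src q)) : p = X.inv q := by
  rw [← X.op_inv_cancel_right h, h1, X.unit_op (X.tgt_inv q).symm]

theorem inv_inv (p : X₁) : X.inv (X.inv p) = p := by
  refine (X.eq_inv_of_op_eq_unit (X.tgt_inv p).symm ?_).symm
  rw [X.op_inv_self, X.src_inv]

theorem inv_unit (x : X₀) : X.inv (X.unit x) = X.unit x := by
  refine (X.eq_inv_of_op_eq_unit ((X.src_unit x).trans (X.tgt_unit x).symm) ?_).symm
  rw [X.unit_op (X.tgt_unit x).symm, X.src_unit]

theorem inv_op {p q : X₁} (h : X.src p = X.tgt q) :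
    X.inv (X.op p q) = X.op (X.inv q) (X.inv p) := by
  have h1 : X.src (X.inv q) = X.tgt (X.inv p) := by rw [X.src_inv, X.tgt_inv, h]
  refine (X.eq_inv_of_op_eq_unit ?_ ?_).symm
  · rw [X.src_op h1, X.tgt_op h, X.src_inv]
  · rw [X.op_assoc h1 (by rw [X.src_inv, X.tgt_op h]), X.inv_op_cancel_left h, X.inv_op_self,
      X.src_op h]

/-- Right translations cancel in quotients. -/
theorem op_op_inv_op {p q g : X₁} (hp : X.src p = X.tgt g) (hq : X.src q = X.tgt g) :
    X.op (X.op p g) (X.inv (X.op q g)) = X.op p (X.inv q) := by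
  rw [X.inv_op hq, ← X.op_assoc (by rw [X.src_op hp, X.tgt_inv])
    (by rw [X.src_inv, X.tgt_inv, hq]), X.op_inv_cancel_right hp]

theorem pair_injective : Function.Injective X.pair := X.pair_embedding.isEmbedding.injective

theorem pair_mkPair (p q : X₁) (h : X.src p = X.tgt q) : X.pair (X.mkPair p q h) = (p, q) :=
  (X.exists_pair p q h).choose_spec

theorem fst_mkPair (p q : X₁) (h : X.src p = X.tgt q) : X.fst (X.mkPair p q h) = p := by
  rw [fst, pair_mkPair]

theorem snd_mkPair (p q : X₁) (h : X.src p = X.tgt q) : X.snd (X.mkPair p q h) = q := by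
  rw [snd, pair_mkPair]

theorem pair_ext {z w : X₂} (h1 : X.fst z = X.fst w) (h2 : X.snd z = X.snd w) : z = w :=
  X.pair_injective (Prod.ext h1 h2)

theorem mul_eq_op (z : X₂) : X.mul z = X.op (X.fst z) (X.snd z) := (X.op_eq (X.src_fst z)).symm

/-- The commutative triangle with the legs `p 0`, `p 1`, `p 2`, which have to start at one point
(otherwise the value is a degenerate triangle). -/
noncomputable def tri (p : Fin 3 → X₁) : X₂ := by
  classical exact
    if h : X.src (p 2) = X.src (p 1) ∧ X.src (p 1) = X.src (p 0) then
      X.mkPair (X.op (p 2) (X.inv (p 1))) (X.op (p 1) (X.inv (p 0))) (by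
        rw [X.src_op (h.1.trans (X.tgt_inv _).symm), X.tgt_op (h.2.trans (X.tgt_inv _).symm),
          X.src_inv])
    else X.mkPair (X.unit (X.tgt (p 0))) (p 0) (X.src_unit _)

section Tri

variable {p : Fin 3 → X₁}

theorem fst_tri {x : X₀} (hp : ∀ i, X.src (p i) = x) :
    X.fst (X.tri p) = X.op (p 2) (X.inv (p 1)) := by
  rw [tri, dif_pos ⟨(hp 2).trans (hp 1).symm, (hp 1).trans (hp 0).symm⟩, fst_mkPair]

theorem snd_tri {x : X₀} (hp : ∀ i, X.src (p i) = x) :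
    X.snd (X.tri p) = X.op (p 1) (X.inv (p 0)) := by
  rw [tri, dif_pos ⟨(hp 2).trans (hp 1).symm, (hp 1).trans (hp 0).symm⟩, snd_mkPair]

theorem div_op_div {p q r : X₁} (h : X.src p = X.src q) (h' : X.src q = X.src r) :
    X.op (X.op p (X.inv q)) (X.op q (X.inv r)) = X.op p (X.inv r) := by
  rw [X.op_assoc (h.trans (X.tgt_inv q).symm)
    ((X.src_inv q).trans (X.tgt_op (h'.trans (X.tgt_inv r).symm)).symm),
    X.inv_op_cancel_left (h'.trans (X.tgt_inv r).symm)]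

theorem mul_tri {x : X₀} (hp : ∀ i, X.src (p i) = x) :
    X.mul (X.tri p) = X.op (p 2) (X.inv (p 0)) := by
  rw [mul_eq_op, X.fst_tri hp, X.snd_tri hp, X.div_op_div ((hp 2).trans (hp 1).symm)
    ((hp 1).trans (hp 0).symm)]

theorem leg_tri {x : X₀} (hp : ∀ i, X.src (p i) = x) (i : Fin 3) :
    X.leg (X.tri p) i = X.op (p i) (X.inv (p 0)) := by
  fin_cases i
  · simp only [leg, Fin.zero_eta, Matrix.cons_val_zero]
    rw [X.snd_tri hp, X.src_op (by rw [hp, X.tgt_inv, hp]), X.src_inv, X.op_inv_self]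
  · simp only [leg, Fin.mk_one, Matrix.cons_val_one, Matrix.cons_val_zero]
    rw [X.snd_tri hp]
  · exact X.mul_tri hp

theorem tri_leg (z : X₂) : X.tri (X.leg z) = z := by
  apply X.pair_ext
  · rw [X.fst_tri (X.src_leg z)]
    simp only [leg, Matrix.cons_val_one, Matrix.cons_val]
    rw [mul_eq_op, X.op_inv_cancel_right (X.src_fst z)]
  · rw [X.snd_tri (X.src_leg z)]
    simp only [leg, Matrix.cons_val_one, Matrix.cons_val_zero]
    rw [inv_unit, X.op_unit rfl]

theorem tri_op {x : X₀} (hp : ∀ i, X.src (p i) = x) {g : X₁} (hg : X.tgt g = x) :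
    X.tri (fun i => X.op (p i) g) = X.tri p := by
  have h : ∀ i, X.src (p i) = X.tgt g := fun i => (hp i).trans hg.symm
  have h' : ∀ i, X.src (X.op (p i) g) = X.src g := fun i => X.src_op (h i)
  apply X.pair_ext
  · rw [X.fst_tri h', X.fst_tri hp, X.op_op_inv_op (h _) (h _)]
  · rw [X.snd_tri h', X.snd_tri hp, X.op_op_inv_op (h _) (h _)]

theorem edge_eq (z : X₂) (i j : Fin 3) :
    X.edge z i j = X.op (X.leg z i) (X.inv (X.leg z j)) := (X.op_eq _).symm

theorem permute_eq (σ : Equiv.Perm (Fin 3)) (z : X₂) :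
    X.permute σ z = X.tri (fun i => X.leg z (σ i)) := by
  apply X.pair_ext
  · rw [permute, fst_mkPair, X.fst_tri fun i => X.src_leg z (σ i), edge_eq]
  · rw [permute, snd_mkPair, X.snd_tri fun i => X.src_leg z (σ i), edge_eq]

theorem permute_tri {x : X₀} (hp : ∀ i, X.src (p i) = x) (σ : Equiv.Perm (Fin 3)) :
    X.permute σ (X.tri p) = X.tri (fun i => p (σ i)) := by
  rw [permute_eq]
  simp only [X.leg_tri hp]
  exact X.tri_op (fun i => hp (σ i)) ((X.tgt_inv _).trans (hp 0))

theorem permute_permute (σ τ : Equiv.Perm (Fin 3)) (z : X₂) :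
    X.permute σ (X.permute τ z) = X.permute (τ * σ) z := by
  rw [X.permute_eq τ, X.permute_tri (fun i => X.src_leg z (τ i)), X.permute_eq]
  rfl

theorem permute_one (z : X₂) : X.permute 1 z = z := by
  rw [permute_eq]
  exact X.tri_leg z

theorem permute_inv_permute (σ : Equiv.Perm (Fin 3)) (z : X₂) :
    X.permute σ⁻¹ (X.permute σ z) = z := by
  rw [permute_permute, mul_inv_cancel, permute_one]

theorem permute_permute_inv (σ : Equiv.Perm (Fin 3)) (z : X₂) :
    X.permute σ (X.permute σ⁻¹ z) = z := by
  rw [permute_permute, inv_mul_cancel, permute_one]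

theorem leg_permute (σ : Equiv.Perm (Fin 3)) (z : X₂) (i : Fin 3) :
    X.leg (X.permute σ z) i = X.op (X.leg z (σ i)) (X.inv (X.leg z (σ 0))) := by
  rw [permute_eq, X.leg_tri fun i => X.src_leg z (σ i)]

theorem mul_permute (σ : Equiv.Perm (Fin 3)) (z : X₂) :
    X.mul (X.permute σ z) = X.op (X.leg z (σ 2)) (X.inv (X.leg z (σ 0))) := by
  rw [permute_eq, X.mul_tri fun i => X.src_leg z (σ i)]

theorem mul_permute_swap_one_two (z : X₂) :
    X.mul (X.permute (Equiv.swap 1 2) z) = X.snd z := by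
  rw [mul_permute, Equiv.swap_apply_right, Equiv.swap_apply_of_ne_of_ne (by decide) (by decide)]
  simp only [leg, Matrix.cons_val_one, Matrix.cons_val_zero]
  rw [inv_unit, X.op_unit rfl]

theorem mul_permute_swap_zero_one (z : X₂) :
    X.mul (X.permute (Equiv.swap 0 1) z) = X.fst z := by
  rw [mul_permute, Equiv.swap_apply_left, Equiv.swap_apply_of_ne_of_ne (by decide) (by decide)]
  simp only [leg, Matrix.cons_val_one, Matrix.cons_val_zero, Matrix.cons_val]
  rw [mul_eq_op, X.op_inv_cancel_right (X.src_fst z)]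

end Tri

end Algebra

section Smoothness

variable {E₀ E₁ E₂ X₀ X₁ X₂ : Type*}
  [NormedAddCommGroup E₀] [NormedSpace ℝ E₀] [TopologicalSpace X₀] [ChartedSpace E₀ X₀]
  [NormedAddCommGroup E₁] [NormedSpace ℝ E₁] [TopologicalSpace X₁] [ChartedSpace E₁ X₁]
  [NormedAddCommGroup E₂] [NormedSpace ℝ E₂] [TopologicalSpace X₂] [ChartedSpace E₂ X₂]
  [IsManifold 𝓘(ℝ, E₀) ∞ X₀] [IsManifold 𝓘(ℝ, E₁) ∞ X₁] [IsManifold 𝓘(ℝ, E₂) ∞ X₂]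
  (X : LieGroupoid E₀ E₁ E₂ X₀ X₁ X₂)

theorem contMDiff_src : ContMDiff 𝓘(ℝ, E₁) 𝓘(ℝ, E₀) ∞ X.src := X.src_submersion.contMDiff'

theorem contMDiff_tgt : ContMDiff 𝓘(ℝ, E₁) 𝓘(ℝ, E₀) ∞ X.tgt := X.tgt_submersion.contMDiff'

theorem contMDiff_pair : ContMDiff 𝓘(ℝ, E₂) (𝓘(ℝ, E₁).prod 𝓘(ℝ, E₁)) ∞ X.pair :=
  X.pair_embedding.isImmersion.contMDiff

theorem contMDiff_fst : ContMDiff 𝓘(ℝ, E₂) 𝓘(ℝ, E₁) ∞ X.fst := X.contMDiff_pair.fst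

theorem contMDiff_snd : ContMDiff 𝓘(ℝ, E₂) 𝓘(ℝ, E₁) ∞ X.snd := X.contMDiff_pair.snd

theorem contMDiff_mul : ContMDiff 𝓘(ℝ, E₂) 𝓘(ℝ, E₁) ∞ X.mul := X.comp_smooth

theorem contMDiff_leg (i : Fin 3) : ContMDiff 𝓘(ℝ, E₂) 𝓘(ℝ, E₁) ∞ (fun z => X.leg z i) := by
  fin_cases i
  · exact X.unit_smooth.comp (X.contMDiff_src.comp X.contMDiff_snd)
  · exact X.contMDiff_snd
  · exact X.contMDiff_mul

theorem surjective_src : Function.Surjective X.src := fun x => ⟨_, X.src_unit x⟩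

theorem surjective_tgt : Function.Surjective X.tgt := fun x => ⟨_, X.tgt_unit x⟩

theorem surjective_mul : Function.Surjective X.mul := fun p =>
  ⟨X.mkPair (X.unit (X.tgt p)) p (X.src_unit _), by
    rw [mul_eq_op, fst_mkPair, snd_mkPair, X.unit_op rfl]⟩

variable {EN HN N : Type*} [NormedAddCommGroup EN] [NormedSpace ℝ EN] [TopologicalSpace HN]
  {J : ModelWithCorners ℝ EN HN} [TopologicalSpace N] [ChartedSpace HN N]

/-- Since `pair` is a smooth embedding, smoothness of maps to the composable pairs can be tested on
the two components. -/
theorem contMDiffAt_iff_pair {f : N → X₂} {n : N} : ContMDiffAt J 𝓘(ℝ, E₂) ∞ f n ↔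
    ContMDiffAt J 𝓘(ℝ, E₁) ∞ (fun n => X.fst (f n)) n ∧
      ContMDiffAt J 𝓘(ℝ, E₁) ∞ (fun n => X.snd (f n)) n := by
  refine ⟨fun h => ⟨X.contMDiff_fst.contMDiffAt.comp n h, X.contMDiff_snd.contMDiffAt.comp n h⟩,
    fun h => ?_⟩
  have h1 : ContMDiffAt J (𝓘(ℝ, E₁).prod 𝓘(ℝ, E₁)) ∞ (X.pair ∘ f) n := h.1.prodMk h.2
  rw [ContMDiffAt.iff_comp_isImmersionAt (X.pair_embedding.isImmersion.isImmersionAt (f n))]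
  exact ⟨X.pair_embedding.isEmbedding.isInducing.continuousAt_iff.2 h1.continuousAt, h1⟩

theorem contMDiffAt_op {f g : N → X₁} {n : N} (hf : ContMDiffAt J 𝓘(ℝ, E₁) ∞ f n)
    (hg : ContMDiffAt J 𝓘(ℝ, E₁) ∞ g n) (h : ∀ᶠ m in 𝓝 n, X.src (f m) = X.tgt (g m)) :
    ContMDiffAt J 𝓘(ℝ, E₁) ∞ (fun m => X.op (f m) (g m)) n := by
  classical
  let w : N → X₂ := fun m => if h' : X.src (f m) = X.tgt (g m) then X.mkPair (f m) (g m) h' else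
    X.mkPair (f n) (g n) h.self_of_nhds
  have hw : ContMDiffAt J 𝓘(ℝ, E₂) ∞ w n := by
    rw [X.contMDiffAt_iff_pair]
    constructor
    · refine hf.congr_of_eventuallyEq (h.mono fun m hm => ?_)
      simp only [w, dif_pos hm, fst_mkPair]
    · refine hg.congr_of_eventuallyEq (h.mono fun m hm => ?_)
      simp only [w, dif_pos hm, snd_mkPair]
  refine (X.contMDiff_mul.contMDiffAt.comp n hw).congr_of_eventuallyEq (h.mono fun m hm => ?_)
  simp only [Function.comp_apply, w, dif_pos hm, mul_eq_op, fst_mkPair, snd_mkPair]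

theorem contMDiffAt_inv {f : N → X₁} {n : N} (hf : ContMDiffAt J 𝓘(ℝ, E₁) ∞ f n) :
    ContMDiffAt J 𝓘(ℝ, E₁) ∞ (fun m => X.inv (f m)) n :=
  X.inv_smooth.contMDiffAt.comp n hf

theorem contMDiffAt_tri {p : N → Fin 3 → X₁} {x : N → X₀} {n : N}
    (hp : ∀ i, ContMDiffAt J 𝓘(ℝ, E₁) ∞ (fun m => p m i) n)
    (h : ∀ᶠ m in 𝓝 n, ∀ i, X.src (p m i) = x m) :
    ContMDiffAt J 𝓘(ℝ, E₂) ∞ (fun m => X.tri (p m)) n := by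
  have hc : ∀ i j, ∀ᶠ m in 𝓝 n, X.src (p m i) = X.tgt (X.inv (p m j)) := fun i j =>
    h.mono fun m hm => by rw [hm i, X.tgt_inv, hm j]
  rw [X.contMDiffAt_iff_pair]
  constructor
  · exact (X.contMDiffAt_op (hp 2) (X.contMDiffAt_inv (hp 1)) (hc 2 1)).congr_of_eventuallyEq
      (h.mono fun m hm => X.fst_tri hm)
  · exact (X.contMDiffAt_op (hp 1) (X.contMDiffAt_inv (hp 0)) (hc 1 0)).congr_of_eventuallyEq
      (h.mono fun m hm => X.snd_tri hm)

theorem contMDiff_permute (σ : Equiv.Perm (Fin 3)) :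
    ContMDiff 𝓘(ℝ, E₂) 𝓘(ℝ, E₂) ∞ (X.permute σ) := by
  intro z
  refine (X.contMDiffAt_tri (p := fun z i => X.leg z (σ i)) (x := fun z => X.src (X.snd z))
    (fun i => (X.contMDiff_leg (σ i)).contMDiffAt)
    (Eventually.of_forall fun z i => X.src_leg z _)).congr_of_eventuallyEq
    (Eventually.of_forall fun z => X.permute_eq σ z)

theorem hasLocalSections_src : HasLocalSections E₁ E₀ X.src := X.src_submersion.hasLocalSections

theorem hasLocalSections_tgt : HasLocalSections E₁ E₀ X.tgt := X.tgt_submersion.hasLocalSections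

theorem hasLocalSections_snd : HasLocalSections E₂ E₁ X.snd := by
  classical
  intro z
  obtain ⟨τ, hτ, hτz, h⟩ := X.hasLocalSections_src (X.fst z)
  rw [X.src_fst] at hτ hτz h
  have h' : ∀ᶠ q in 𝓝 (X.snd z), X.src (τ (X.tgt q)) = X.tgt q :=
    X.contMDiff_tgt.continuous.continuousAt.eventually h
  refine ⟨fun q => if hq : X.src (τ (X.tgt q)) = X.tgt q then X.mkPair _ _ hq else z, ?_, ?_, ?_⟩
  · rw [X.contMDiffAt_iff_pair]
    constructor
    · refine (ContMDiffAt.comp _ hτ X.contMDiff_tgt.contMDiffAt).congr_of_eventuallyEq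
        (h'.mono fun q hq => ?_)
      simp only [dif_pos hq, fst_mkPair, Function.comp_apply]
    · refine contMDiffAt_id.congr_of_eventuallyEq (h'.mono fun q hq => ?_)
      simp only [dif_pos hq, snd_mkPair, id]
  · simp only [dif_pos h'.self_of_nhds]
    refine X.pair_ext ?_ (X.snd_mkPair _ _ _)
    rw [fst_mkPair, hτz]
  · refine h'.mono fun q hq => ?_
    simp only [dif_pos hq, snd_mkPair]

/-- The composition arises from the second projection by a permutation of the vertices. -/
theorem hasLocalSections_mul : HasLocalSections E₂ E₁ X.mul := by
  have h := X.hasLocalSections_snd.comp_invertible (f := X.permute (Equiv.swap 1 2))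
    (X.contMDiff_permute (Equiv.swap 1 2)⁻¹) (X.permute_inv_permute _) (X.permute_permute_inv _)
  have h1 : ∀ z, X.snd (X.permute (Equiv.swap 1 2) z) = X.mul z := fun z => by
    rw [← mul_permute_swap_one_two, permute_permute, Equiv.swap_mul_self, permute_one]
  simpa only [h1] using h

theorem isInvertible_mfderiv_permute (σ : Equiv.Perm (Fin 3)) (z : X₂) :
    (mfderiv 𝓘(ℝ, E₂) 𝓘(ℝ, E₂) (X.permute σ) z).IsInvertible :=
  (isInvertible_mfderiv ((X.contMDiff_permute σ).mdifferentiable (by simp) z)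
    ((X.contMDiff_permute σ⁻¹).mdifferentiable (by simp) _) (X.permute_inv_permute σ)
    (X.permute_permute_inv σ)).1

end Smoothness

end LieGroupoid

/-! ### The metrics induced by a groupoid metric -/

section InducedMetrics

namespace RiemMetric

variable {E X E' X' E'' X'' : Type*}
  [NormedAddCommGroup E] [NormedSpace ℝ E] [FiniteDimensional ℝ E]
  [TopologicalSpace X] [ChartedSpace E X] [IsManifold 𝓘(ℝ, E) ∞ X]
  [NormedAddCommGroup E'] [NormedSpace ℝ E'] [FiniteDimensional ℝ E']
  [TopologicalSpace X'] [ChartedSpace E' X'] [IsManifold 𝓘(ℝ, E') ∞ X']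
  [NormedAddCommGroup E''] [NormedSpace ℝ E''] [FiniteDimensional ℝ E'']
  [TopologicalSpace X''] [ChartedSpace E'' X''] [IsManifold 𝓘(ℝ, E'') ∞ X'']

theorem IsRiemannianSubmersion.dual_comp {η : RiemMetric E X} {η' : RiemMetric E' X'}
    {π : X → X'} {ρ : X' → X''} (h : η.IsRiemannianSubmersion η' π)
    (hπ : MDifferentiable 𝓘(ℝ, E) 𝓘(ℝ, E') π) (hρ : MDifferentiable 𝓘(ℝ, E') 𝓘(ℝ, E'') ρ)
    (x : X) (α β : TangentSpace 𝓘(ℝ, E'') (ρ (π x)) →L[ℝ] ℝ) :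
    η.dual x
      (ContinuousLinearMap.comp (show TangentSpace 𝓘(ℝ, E'') ((ρ ∘ π) x) →L[ℝ] ℝ from α)
        (mfderiv 𝓘(ℝ, E) 𝓘(ℝ, E'') (ρ ∘ π) x))
      (ContinuousLinearMap.comp (show TangentSpace 𝓘(ℝ, E'') ((ρ ∘ π) x) →L[ℝ] ℝ from β)
        (mfderiv 𝓘(ℝ, E) 𝓘(ℝ, E'') (ρ ∘ π) x)) =
    η'.dual (π x) (α ∘L mfderiv 𝓘(ℝ, E') 𝓘(ℝ, E'') ρ (π x))
      (β ∘L mfderiv 𝓘(ℝ, E') 𝓘(ℝ, E'') ρ (π x)) := by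
  rw [mfderiv_comp x (hρ _) (hπ x)]
  exact h x (α ∘L mfderiv 𝓘(ℝ, E') 𝓘(ℝ, E'') ρ (π x)) (β ∘L mfderiv 𝓘(ℝ, E') 𝓘(ℝ, E'') ρ (π x))

theorem IsRiemannianSubmersion.of_comp {η : RiemMetric E X} {η' : RiemMetric E' X'}
    {η'' : RiemMetric E'' X''} {π : X → X'} {ρ : X' → X''}
    (h : η.IsRiemannianSubmersion η' π) (h' : η.IsRiemannianSubmersion η'' (ρ ∘ π))
    (hπ : MDifferentiable 𝓘(ℝ, E) 𝓘(ℝ, E') π) (hρ : MDifferentiable 𝓘(ℝ, E') 𝓘(ℝ, E'') ρ)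
    (hsurj : Function.Surjective π) : η'.IsRiemannianSubmersion η'' ρ := by
  intro y α β
  obtain ⟨x, rfl⟩ := hsurj y
  exact (h.dual_comp hπ hρ x α β).symm.trans (h' x α β)

end RiemMetric

namespace LieGroupoid

variable {E₀ E₁ E₂ X₀ X₁ X₂ : Type*}
  [NormedAddCommGroup E₀] [NormedSpace ℝ E₀] [TopologicalSpace X₀] [ChartedSpace E₀ X₀]
  [NormedAddCommGroup E₁] [NormedSpace ℝ E₁] [TopologicalSpace X₁] [ChartedSpace E₁ X₁]
  [NormedAddCommGroup E₂] [NormedSpace ℝ E₂] [TopologicalSpace X₂] [ChartedSpace E₂ X₂]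
  [FiniteDimensional ℝ E₀] [IsManifold 𝓘(ℝ, E₀) ∞ X₀]
  [FiniteDimensional ℝ E₁] [IsManifold 𝓘(ℝ, E₁) ∞ X₁]
  [FiniteDimensional ℝ E₂] [IsManifold 𝓘(ℝ, E₂) ∞ X₂]
  {X : LieGroupoid E₀ E₁ E₂ X₀ X₁ X₂}

theorem surjective_snd : Function.Surjective X.snd := fun p =>
  ⟨X.mkPair (X.unit (X.tgt p)) p (X.src_unit _), X.snd_mkPair _ _ _⟩

theorem src_mul (z : X₂) : X.src (X.mul z) = X.src (X.snd z) := X.src_comp _ _ _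

/-- Invariance under `S₃` in cotangent form. -/
theorem IsGroupoidMetric.permute {η : RiemMetric E₂ X₂} (h : X.IsGroupoidMetric η)
    (σ : Equiv.Perm (Fin 3)) : η.IsRiemannianSubmersion η (X.permute σ) :=
  (h.invariant σ).isRiemannianSubmersion fun z => (X.isInvertible_mfderiv_permute σ z).surjective

/-- A groupoid metric descends to the arrows and to the objects. -/
theorem IsGroupoidMetric.exists_isInduced {η : RiemMetric E₂ X₂} (h : X.IsGroupoidMetric η) :
    ∃ (η₁ : RiemMetric E₁ X₁) (η₀ : RiemMetric E₀ X₀), X.IsInduced η η₁ η₀ := by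
  have dmul := X.contMDiff_mul.mdifferentiable (by simp)
  have dsnd := X.contMDiff_snd.mdifferentiable (by simp)
  have dfst := X.contMDiff_fst.mdifferentiable (by simp)
  have dsrc := X.contMDiff_src.mdifferentiable (by simp)
  have dtgt := X.contMDiff_tgt.mdifferentiable (by simp)
  have dper := fun σ => (X.contMDiff_permute σ).mdifferentiable (by simp)
  obtain ⟨η₁, hmul⟩ := η.exists_pushforward X.contMDiff_mul X.hasLocalSections_mul
    X.surjective_mul h.transverse
  have hsnd : η.IsRiemannianSubmersion η₁ X.snd := by
    have h1 := (h.permute (Equiv.swap 1 2)).comp hmul (dper _) dmul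
    rwa [show X.mul ∘ X.permute (Equiv.swap 1 2) = X.snd from
      funext X.mul_permute_swap_one_two] at h1
  have hfst : η.IsRiemannianSubmersion η₁ X.fst := by
    have h1 := (h.permute (Equiv.swap 0 1)).comp hmul (dper _) dmul
    rwa [show X.mul ∘ X.permute (Equiv.swap 0 1) = X.fst from
      funext X.mul_permute_swap_zero_one] at h1
  -- two arrows with the same source are two sides of a triangle
  have htr : η₁.IsTransverse (E' := E₀) X.src := by
    intro p q hpq α β
    have hc : X.src (X.op p (X.inv q)) = X.tgt q := by
      rw [X.src_op (hpq.trans (X.tgt_inv q).symm), X.src_inv]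
    obtain ⟨z, hz⟩ := X.exists_pair _ q hc
    have hz2 : X.snd z = q := congrArg Prod.snd hz
    have hz1 : X.fst z = X.op p (X.inv q) := congrArg Prod.fst hz
    have hzm : X.mul z = p := by
      rw [X.mul_eq_op, hz2, hz1, X.inv_op_cancel_right hpq]
    subst hz2
    subst hzm
    rw [← hmul.dual_comp dmul dsrc z (α _) (β _), ← hsnd.dual_comp dsnd dsrc z (α _) (β _)]
    have h2 : ∀ f : X₂ → X₀, f = X.src ∘ X.snd →
        η.dual z (ContinuousLinearMap.comp (α (f z)) (mfderiv 𝓘(ℝ, E₂) 𝓘(ℝ, E₀) f z))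
          (ContinuousLinearMap.comp (β (f z)) (mfderiv 𝓘(ℝ, E₂) 𝓘(ℝ, E₀) f z)) =
        η.dual z (ContinuousLinearMap.comp (α ((X.src ∘ X.snd) z))
            (mfderiv 𝓘(ℝ, E₂) 𝓘(ℝ, E₀) (X.src ∘ X.snd) z))
          (ContinuousLinearMap.comp (β ((X.src ∘ X.snd) z))
            (mfderiv 𝓘(ℝ, E₂) 𝓘(ℝ, E₀) (X.src ∘ X.snd) z)) := by
      rintro f rfl; rfl
    exact h2 (X.src ∘ X.mul) (funext X.src_mul)
  obtain ⟨η₀, hsrc⟩ := η₁.exists_pushforward X.contMDiff_src X.hasLocalSections_src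
    X.surjective_src htr
  refine ⟨η₁, η₀, hsnd, hmul, hfst, hsrc, ?_⟩
  have h3 := hfst.comp hsrc dfst dsrc
  rw [show X.src ∘ X.fst = X.tgt ∘ X.snd from funext X.src_fst] at h3
  exact hsnd.of_comp h3 dsnd dtgt surjective_snd

end LieGroupoid

end InducedMetrics

/-! ### Lie 2-groups and 2-actions -/

namespace LieGroupoid

section TwoGroups

variable {F₀ F₁ F₂ G₀ G₁ G₂ : Type*}
  [NormedAddCommGroup F₀] [NormedSpace ℝ F₀] [TopologicalSpace G₀] [ChartedSpace F₀ G₀]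
  [NormedAddCommGroup F₁] [NormedSpace ℝ F₁] [TopologicalSpace G₁] [ChartedSpace F₁ G₁]
  [NormedAddCommGroup F₂] [NormedSpace ℝ F₂] [TopologicalSpace G₂] [ChartedSpace F₂ G₂]
  {G : LieGroupoid F₀ F₁ F₂ G₀ G₁ G₂} [Group G₀] [Group G₁] [Group G₂]

namespace IsLieTwoGroup

variable (hG : G.IsLieTwoGroup)

include hG

theorem fst_mul (a b : G₂) : G.fst (a * b) = G.fst a * G.fst b :=
  congrArg Prod.fst (hG.pair_mul a b)

theorem snd_mul (a b : G₂) : G.snd (a * b) = G.snd a * G.snd b :=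
  congrArg Prod.snd (hG.pair_mul a b)

theorem fst_one : G.fst 1 = 1 := (MonoidHom.mk' G.fst hG.fst_mul).map_one

theorem snd_one : G.snd 1 = 1 := (MonoidHom.mk' G.snd hG.snd_mul).map_one

theorem fst_inv (a : G₂) : G.fst a⁻¹ = (G.fst a)⁻¹ := (MonoidHom.mk' G.fst hG.fst_mul).map_inv a

theorem snd_inv (a : G₂) : G.snd a⁻¹ = (G.snd a)⁻¹ := (MonoidHom.mk' G.snd hG.snd_mul).map_inv a

theorem op_mul {p q p' q' : G₁} (h : G.src p = G.tgt q) (h' : G.src p' = G.tgt q') :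
    G.op (p * p') (q * q') = G.op p q * G.op p' q' := by
  have h1 := hG.mul_mul (G.mkPair p q h) (G.mkPair p' q' h')
  rw [mul_eq_op, mul_eq_op, mul_eq_op, hG.fst_mul, hG.snd_mul] at h1
  simpa only [fst_mkPair, snd_mkPair] using h1

theorem leg_mul (a b : G₂) (i : Fin 3) : G.leg (a * b) i = G.leg a i * G.leg b i := by
  fin_cases i
  · simp only [leg, Fin.zero_eta, Matrix.cons_val_zero]
    rw [hG.snd_mul, hG.src_mul, hG.unit_mul]
  · simp only [leg, Fin.mk_one, Matrix.cons_val_one, Matrix.cons_val_zero]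
    rw [hG.snd_mul]
  · exact hG.mul_mul a b

theorem permute_mul (σ : Equiv.Perm (Fin 3)) (a b : G₂) :
    G.permute σ (a * b) = G.permute σ a * G.permute σ b := by
  have h : ∀ (a : G₂) (i j : Fin 3), G.src (G.leg a i) = G.tgt (G.inv (G.leg a j)) :=
    fun a i j => by rw [G.tgt_inv, G.src_leg, G.src_leg]
  apply G.pair_ext
  · rw [hG.fst_mul]
    simp only [permute, fst_mkPair, edge_eq]
    rw [hG.leg_mul, hG.leg_mul, hG.inv_mul, hG.op_mul (h _ _ _) (h _ _ _)]
  · rw [hG.snd_mul]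
    simp only [permute, snd_mkPair, edge_eq]
    rw [hG.leg_mul, hG.leg_mul, hG.inv_mul, hG.op_mul (h _ _ _) (h _ _ _)]

theorem lieGroup_pair [IsManifold 𝓘(ℝ, F₂) ∞ G₂] : LieGroup 𝓘(ℝ, F₂) ∞ G₂ := by
  have := hG.lieGroup_obj
  have := hG.lieGroup_arr
  exact
    { contMDiff_mul := fun a => by
        rw [G.contMDiffAt_iff_pair]
        simp only [hG.fst_mul, hG.snd_mul]
        exact ⟨((G.contMDiff_fst.comp _root_.contMDiff_fst).mul
            (G.contMDiff_fst.comp _root_.contMDiff_snd)).contMDiffAt,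
          ((G.contMDiff_snd.comp _root_.contMDiff_fst).mul
            (G.contMDiff_snd.comp _root_.contMDiff_snd)).contMDiffAt⟩
      contMDiff_inv := fun a => by
        rw [G.contMDiffAt_iff_pair]
        simp only [hG.fst_inv, hG.snd_inv]
        exact ⟨G.contMDiff_fst.inv.contMDiffAt, G.contMDiff_snd.inv.contMDiffAt⟩ }

theorem compactSpace_pair [IsManifold 𝓘(ℝ, F₂) ∞ G₂] [T2Space G₀] [CompactSpace G₁] :
    CompactSpace G₂ := by
  have := hG.lieGroup_obj
  have := hG.lieGroup_arr
  have h : range G.pair = {p | G.src p.1 = G.tgt p.2} := by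
    ext p
    exact ⟨by rintro ⟨z, rfl⟩; exact G.src_pair z, fun hp => G.exists_pair _ _ hp⟩
  have hc : IsClosed (range G.pair) := by
    rw [h]
    exact isClosed_eq (G.contMDiff_src.continuous.comp continuous_fst)
      (G.contMDiff_tgt.continuous.comp continuous_snd)
  exact (Topology.IsClosedEmbedding.mk G.pair_embedding.isEmbedding hc).compactSpace

theorem compactSpace_obj [IsManifold 𝓘(ℝ, F₂) ∞ G₂] [CompactSpace G₁] : CompactSpace G₀ := by
  have := hG.lieGroup_obj
  have := hG.lieGroup_arr
  exact (surjective_src G).compactSpace G.contMDiff_src.continuous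

end IsLieTwoGroup

end TwoGroups

section TwoActions

variable {F₀ F₁ F₂ G₀ G₁ G₂ : Type*}
  [NormedAddCommGroup F₀] [NormedSpace ℝ F₀] [TopologicalSpace G₀] [ChartedSpace F₀ G₀]
  [NormedAddCommGroup F₁] [NormedSpace ℝ F₁] [TopologicalSpace G₁] [ChartedSpace F₁ G₁]
  [NormedAddCommGroup F₂] [NormedSpace ℝ F₂] [TopologicalSpace G₂] [ChartedSpace F₂ G₂]
  {G : LieGroupoid F₀ F₁ F₂ G₀ G₁ G₂} [Group G₀] [Group G₁] [Group G₂]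
  {E₀ E₁ E₂ X₀ X₁ X₂ : Type*}
  [NormedAddCommGroup E₀] [NormedSpace ℝ E₀] [TopologicalSpace X₀] [ChartedSpace E₀ X₀]
  [NormedAddCommGroup E₁] [NormedSpace ℝ E₁] [TopologicalSpace X₁] [ChartedSpace E₁ X₁]
  [NormedAddCommGroup E₂] [NormedSpace ℝ E₂] [TopologicalSpace X₂] [ChartedSpace E₂ X₂]
  {X : LieGroupoid E₀ E₁ E₂ X₀ X₁ X₂} [MulAction G₀ X₀] [MulAction G₁ X₁]

namespace IsTwoAction

variable (hθ : IsTwoAction G X)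

theorem fst_act₂ (a : G₂) (z : X₂) : X.fst (hθ.act₂ a z) = G.fst a • X.fst z := X.fst_mkPair _ _ _

theorem snd_act₂ (a : G₂) (z : X₂) : X.snd (hθ.act₂ a z) = G.snd a • X.snd z := X.snd_mkPair _ _ _

include hθ in
theorem op_smul {g h : G₁} {p q : X₁} (hgh : G.src g = G.tgt h) (hpq : X.src p = X.tgt q) :
    X.op (g • p) (h • q) = G.op g h • X.op p q := by
  rw [G.op_eq hgh, X.op_eq hpq, hθ.comp_smul,
    X.op_eq (by rw [hθ.src_smul, hθ.tgt_smul, hgh, hpq])]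

theorem mul_act₂ (a : G₂) (z : X₂) : X.mul (hθ.act₂ a z) = G.mul a • X.mul z := by
  rw [mul_eq_op, mul_eq_op, mul_eq_op, hθ.fst_act₂, hθ.snd_act₂,
    hθ.op_smul (G.src_fst a) (X.src_fst z)]

include hθ in
theorem unit_smul (g : G₀) (x : X₀) : X.unit (g • x) = G.unit g • X.unit x := by
  have hs : X.src (G.unit g • X.unit x) = g • x := by rw [hθ.src_smul, G.src_unit, X.src_unit]
  have ht : X.tgt (G.unit g • X.unit x) = g • x := by rw [hθ.tgt_smul, G.tgt_unit, X.tgt_unit]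
  have h := hθ.op_smul (g := G.unit g) (h := G.unit g) (p := X.unit x) (q := X.unit x)
    (by rw [G.src_unit, G.tgt_unit]) (by rw [X.src_unit, X.tgt_unit])
  rw [G.unit_op (G.tgt_unit g).symm, X.unit_op (X.tgt_unit x).symm] at h
  -- an idempotent arrow is a unit
  have h1 := X.inv_op_cancel_left (hs.trans ht.symm)
  rw [h, X.inv_op_self, hs] at h1
  exact h1

include hθ in
theorem inv_smul (g : G₁) (p : X₁) : X.inv (g • p) = G.inv g • X.inv p := by
  refine (X.eq_inv_of_op_eq_unit ?_ ?_).symm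
  · rw [hθ.src_smul, hθ.tgt_smul, G.src_inv, X.src_inv]
  · rw [hθ.op_smul (G.src_inv g) (X.src_inv p), G.inv_op_self, X.inv_op_self, ← hθ.unit_smul,
      hθ.src_smul]

theorem leg_act₂ (a : G₂) (z : X₂) (i : Fin 3) :
    X.leg (hθ.act₂ a z) i = G.leg a i • X.leg z i := by
  fin_cases i
  · simp only [leg, Fin.zero_eta, Matrix.cons_val_zero]
    rw [hθ.snd_act₂, hθ.src_smul, hθ.unit_smul]
  · exact hθ.snd_act₂ a z
  · exact hθ.mul_act₂ a z

theorem permute_act₂ (σ : Equiv.Perm (Fin 3)) (a : G₂) (z : X₂) :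
    X.permute σ (hθ.act₂ a z) = hθ.act₂ (G.permute σ a) (X.permute σ z) := by
  have h : ∀ i j : Fin 3, G.src (G.leg a i) = G.tgt (G.inv (G.leg a j)) :=
    fun i j => by rw [G.tgt_inv, G.src_leg, G.src_leg]
  have h' : ∀ i j : Fin 3, X.src (X.leg z i) = X.tgt (X.inv (X.leg z j)) :=
    fun i j => by rw [X.tgt_inv, X.src_leg, X.src_leg]
  apply X.pair_ext
  · rw [hθ.fst_act₂]
    simp only [permute, fst_mkPair, edge_eq]
    rw [hθ.leg_act₂, hθ.leg_act₂, hθ.inv_smul, hθ.op_smul (h _ _) (h' _ _)]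
  · rw [hθ.snd_act₂]
    simp only [permute, snd_mkPair, edge_eq]
    rw [hθ.leg_act₂, hθ.leg_act₂, hθ.inv_smul, hθ.op_smul (h _ _) (h' _ _)]

theorem act₂_mul (hG : G.IsLieTwoGroup) (a b : G₂) (z : X₂) :
    hθ.act₂ (a * b) z = hθ.act₂ a (hθ.act₂ b z) := by
  apply X.pair_ext
  · rw [hθ.fst_act₂, hθ.fst_act₂, hθ.fst_act₂, hG.fst_mul, mul_smul]
  · rw [hθ.snd_act₂, hθ.snd_act₂, hθ.snd_act₂, hG.snd_mul, mul_smul]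

theorem act₂_one (hG : G.IsLieTwoGroup) (z : X₂) : hθ.act₂ (1 : G₂) z = z := by
  apply X.pair_ext
  · rw [hθ.fst_act₂, hG.fst_one, one_smul]
  · rw [hθ.snd_act₂, hG.snd_one, one_smul]

theorem contMDiff_act₂ [IsManifold 𝓘(ℝ, F₀) ∞ G₀] [IsManifold 𝓘(ℝ, F₁) ∞ G₁]
    [IsManifold 𝓘(ℝ, F₂) ∞ G₂] [IsManifold 𝓘(ℝ, E₀) ∞ X₀] [IsManifold 𝓘(ℝ, E₁) ∞ X₁]
    [IsManifold 𝓘(ℝ, E₂) ∞ X₂] :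
    ContMDiff (𝓘(ℝ, F₂).prod 𝓘(ℝ, E₂)) 𝓘(ℝ, E₂) ∞
      (Function.uncurry (hθ.act₂ : G₂ → X₂ → X₂)) := by
  intro n
  have := hθ.smooth_arr
  rw [X.contMDiffAt_iff_pair]
  simp only [Function.uncurry, hθ.fst_act₂, hθ.snd_act₂]
  exact ⟨(this.contMDiff_smul.comp ((G.contMDiff_fst.comp _root_.contMDiff_fst).prodMk
      (X.contMDiff_fst.comp _root_.contMDiff_snd))).contMDiffAt,
    (this.contMDiff_smul.comp ((G.contMDiff_snd.comp _root_.contMDiff_fst).prodMk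
      (X.contMDiff_snd.comp _root_.contMDiff_snd))).contMDiffAt⟩

end IsTwoAction

end TwoActions

end LieGroupoid

/-- A right translate of the normalized Haar measure is again a normalized Haar measure, and these are
unique. -/
theorem MeasureTheory.Measure.isMulRightInvariant_of_compactSpace {K : Type*} [Group K]
    [TopologicalSpace K] [IsTopologicalGroup K] [CompactSpace K] [MeasurableSpace K]
    [BorelSpace K] (μ : Measure K) [μ.IsHaarMeasure] [IsProbabilityMeasure μ] :
    μ.IsMulRightInvariant where
  map_mul_right_eq_self b := by
    have := Measure.isProbabilityMeasure_map (μ := μ) (f := (· * b))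
      (measurable_mul_const b).aemeasurable
    have := isHaarMeasure_map_mul_right μ b
    exact Measure.isHaarMeasure_eq_of_isProbabilityMeasure _ _

/-! ### Averages of groupoid metrics -/

theorem exists_isHaarMeasure_isProbabilityMeasure (K : Type*) [Group K] [TopologicalSpace K]
    [IsTopologicalGroup K] [CompactSpace K] [MeasurableSpace K] [BorelSpace K] :
    ∃ μ : Measure K, μ.IsHaarMeasure ∧ IsProbabilityMeasure μ :=
  ⟨Measure.haarMeasure ⊤, inferInstance, ⟨Measure.haarMeasure_self⟩⟩

namespace LieGroupoid

section AverageMetric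

variable {F₀ F₁ F₂ G₀ G₁ G₂ : Type*}
    [NormedAddCommGroup F₀] [NormedSpace ℝ F₀] [FiniteDimensional ℝ F₀]
    [NormedAddCommGroup F₁] [NormedSpace ℝ F₁] [FiniteDimensional ℝ F₁]
    [NormedAddCommGroup F₂] [NormedSpace ℝ F₂] [FiniteDimensional ℝ F₂]
    [TopologicalSpace G₀] [T2Space G₀] [ChartedSpace F₀ G₀] [Group G₀]
    [TopologicalSpace G₁] [T2Space G₁] [ChartedSpace F₁ G₁] [Group G₁]
    [TopologicalSpace G₂] [ChartedSpace F₂ G₂] [IsManifold 𝓘(ℝ, F₂) ∞ G₂] [Group G₂]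
    [MeasurableSpace G₀] [BorelSpace G₀] [MeasurableSpace G₁] [BorelSpace G₁]
    [MeasurableSpace G₂] [BorelSpace G₂]
    {G : LieGroupoid F₀ F₁ F₂ G₀ G₁ G₂} [CompactSpace G₁]
    {E₀ E₁ E₂ X₀ X₁ X₂ : Type*}
    [NormedAddCommGroup E₀] [NormedSpace ℝ E₀] [FiniteDimensional ℝ E₀]
    [NormedAddCommGroup E₁] [NormedSpace ℝ E₁] [FiniteDimensional ℝ E₁]
    [NormedAddCommGroup E₂] [NormedSpace ℝ E₂] [FiniteDimensional ℝ E₂]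
    [TopologicalSpace X₀] [ChartedSpace E₀ X₀] [IsManifold 𝓘(ℝ, E₀) ∞ X₀]
    [TopologicalSpace X₁] [ChartedSpace E₁ X₁] [IsManifold 𝓘(ℝ, E₁) ∞ X₁]
    [TopologicalSpace X₂] [ChartedSpace E₂ X₂] [IsManifold 𝓘(ℝ, E₂) ∞ X₂]
    {X : LieGroupoid E₀ E₁ E₂ X₀ X₁ X₂}
    [MulAction G₀ X₀] [MulAction G₁ X₁]

/-- The cotangent average of a groupoid metric is an invariant groupoid metric, and averaging
commutes with passing to the induced metrics: the five structural submersions are equivariant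
along surjective homomorphisms of compact groups, which preserve the Haar measures. -/
theorem IsGroupoidMetric.exists_average (hG : G.IsLieTwoGroup) (hθ : IsTwoAction G X)
    {η : RiemMetric E₂ X₂} (hη : X.IsGroupoidMetric η) (μ₂ : Measure G₂) (μ₁ : Measure G₁)
    (μ₀ : Measure G₀) [μ₂.IsHaarMeasure] [IsProbabilityMeasure μ₂]
    [μ₁.IsHaarMeasure] [IsProbabilityMeasure μ₁] [μ₀.IsHaarMeasure] [IsProbabilityMeasure μ₀] :
    ∃ ηbar : RiemMetric E₂ X₂, ηbar.IsCotangentAverage η hθ.act₂ μ₂ ∧ X.IsGroupoidMetric ηbar ∧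
      hθ.IsIsometric ηbar ∧
      ∃ (η₁ ηbar₁ : RiemMetric E₁ X₁) (η₀ ηbar₀ : RiemMetric E₀ X₀),
        X.IsInduced η η₁ η₀ ∧ X.IsInduced ηbar ηbar₁ ηbar₀ ∧
        ηbar₁.IsCotangentAverage η₁ (fun (g : G₁) (p : X₁) => g • p) μ₁ ∧
        ηbar₀.IsCotangentAverage η₀ (fun (g : G₀) (x : X₀) => g • x) μ₀ := by
  have := hG.lieGroup_obj
  have := hG.lieGroup_arr
  have := hG.lieGroup_pair
  have := hG.compactSpace_pair
  have := hG.compactSpace_obj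
  have tg₀ : IsTopologicalGroup G₀ := topologicalGroup_of_lieGroup 𝓘(ℝ, F₀) ∞
  have tg₁ : IsTopologicalGroup G₁ := topologicalGroup_of_lieGroup 𝓘(ℝ, F₁) ∞
  have tg₂ : IsTopologicalGroup G₂ := topologicalGroup_of_lieGroup 𝓘(ℝ, F₂) ∞
  obtain ⟨η₁, η₀, hind⟩ := hη.exists_isInduced
  -- the three actions
  have s₂ := hθ.contMDiff_act₂
  have s₁ : ContMDiff (𝓘(ℝ, F₁).prod 𝓘(ℝ, E₁)) 𝓘(ℝ, E₁) ∞
    (Function.uncurry fun (g : G₁) (p : X₁) => g • p) := hθ.smooth_arr.contMDiff_smul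
  have s₀ : ContMDiff (𝓘(ℝ, F₀).prod 𝓘(ℝ, E₀)) 𝓘(ℝ, E₀) ∞
    (Function.uncurry fun (g : G₀) (p : X₀) => g • p) := hθ.smooth_obj.contMDiff_smul
  have hl₂ : ∀ (a : G₂) z, hθ.act₂ a⁻¹ (hθ.act₂ a z) = z := fun a z => by
    rw [← hθ.act₂_mul hG, inv_mul_cancel, hθ.act₂_one hG]
  have hr₂ : ∀ (a : G₂) z, hθ.act₂ a (hθ.act₂ a⁻¹ z) = z := fun a z => by
    rw [← hθ.act₂_mul hG, mul_inv_cancel, hθ.act₂_one hG]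
  obtain ⟨ηbar, h₂⟩ := η.exists_isCotangentAverage μ₂ s₂
    (s₂.comp ((contMDiff_inv 𝓘(ℝ, F₂) ∞).comp _root_.contMDiff_fst |>.prodMk
      _root_.contMDiff_snd)) hl₂
  obtain ⟨ηbar₁, h₁⟩ := η₁.exists_isCotangentAverage μ₁ s₁
    (s₁.comp ((contMDiff_inv 𝓘(ℝ, F₁) ∞).comp _root_.contMDiff_fst |>.prodMk
      _root_.contMDiff_snd)) (fun g p => inv_smul_smul g p)
  obtain ⟨ηbar₀, h₀⟩ := η₀.exists_isCotangentAverage μ₀ s₀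
    (s₀.comp ((contMDiff_inv 𝓘(ℝ, F₀) ∞).comp _root_.contMDiff_fst |>.prodMk
      _root_.contMDiff_snd)) (fun g p => inv_smul_smul g p)
  have d₂ : ∀ a : G₂, MDifferentiable 𝓘(ℝ, E₂) 𝓘(ℝ, E₂) (hθ.act₂ a) := fun a z =>
    (ContMDiffAt.right_section (F := hθ.act₂) (n₀ := a) (s₂ (a, z))).mdifferentiableAt (by simp)
  have d₁ : ∀ a : G₁, MDifferentiable 𝓘(ℝ, E₁) 𝓘(ℝ, E₁) (fun p : X₁ => a • p) := fun a z =>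
    (ContMDiffAt.right_section (F := fun (g : G₁) (p : X₁) => g • p) (n₀ := a)
      (s₁ (a, z))).mdifferentiableAt (by simp)
  have d₀ : ∀ a : G₀, MDifferentiable 𝓘(ℝ, E₀) 𝓘(ℝ, E₀) (fun p : X₀ => a • p) := fun a z =>
    (ContMDiffAt.right_section (F := fun (g : G₀) (p : X₀) => g • p) (n₀ := a)
      (s₀ (a, z))).mdifferentiableAt (by simp)
  have i₂ : ∀ (a : G₂) z, (mfderiv 𝓘(ℝ, E₂) 𝓘(ℝ, E₂) (hθ.act₂ a) z).IsInvertible := fun a z =>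
    (isInvertible_mfderiv (d₂ a z) (d₂ a⁻¹ _) (hl₂ a) (hr₂ a)).1
  have i₁ : ∀ (a : G₁) z, (mfderiv 𝓘(ℝ, E₁) 𝓘(ℝ, E₁) (fun p : X₁ => a • p) z).IsInvertible :=
    fun a z => (isInvertible_mfderiv (d₁ a z) (d₁ a⁻¹ _) (inv_smul_smul a) (smul_inv_smul a)).1
  have i₀ : ∀ (a : G₀) z, (mfderiv 𝓘(ℝ, E₀) 𝓘(ℝ, E₀) (fun p : X₀ => a • p) z).IsInvertible :=
    fun a z => (isInvertible_mfderiv (d₀ a z) (d₀ a⁻¹ _) (inv_smul_smul a) (smul_inv_smul a)).1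
  -- the structural maps of the 2-group preserve the Haar measures
  have m_fst : MeasurePreserving G.fst μ₂ μ₁ :=
    (MonoidHom.mk' G.fst hG.fst_mul).measurePreserving G.contMDiff_fst.continuous
      (fun p => ⟨G.mkPair p _ (G.tgt_unit _).symm, G.fst_mkPair _ _ _⟩) (by simp)
  have m_snd : MeasurePreserving G.snd μ₂ μ₁ :=
    (MonoidHom.mk' G.snd hG.snd_mul).measurePreserving G.contMDiff_snd.continuous
      surjective_snd (by simp)
  have m_mul : MeasurePreserving G.mul μ₂ μ₁ :=
    (MonoidHom.mk' G.mul hG.mul_mul).measurePreserving G.contMDiff_mul.continuous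
      G.surjective_mul (by simp)
  have m_src : MeasurePreserving G.src μ₁ μ₀ :=
    (MonoidHom.mk' G.src hG.src_mul).measurePreserving G.contMDiff_src.continuous
      (surjective_src G) (by simp)
  have m_tgt : MeasurePreserving G.tgt μ₁ μ₀ :=
    (MonoidHom.mk' G.tgt hG.tgt_mul).measurePreserving G.contMDiff_tgt.continuous
      (surjective_tgt G) (by simp)
  have m_perm : ∀ σ, MeasurePreserving (G.permute σ) μ₂ μ₂ := fun σ =>
    (MonoidHom.mk' (G.permute σ) (hG.permute_mul σ)).measurePreserving
      (G.contMDiff_permute σ).continuous (fun z => ⟨_, G.permute_permute_inv σ z⟩) (by simp)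
  have hind' : X.IsInduced ηbar ηbar₁ ηbar₀ :=
    { snd := hind.snd.average h₂ h₁ m_snd (X.contMDiff_snd.mdifferentiable (by simp)) d₂ d₁ i₂ i₁
        hθ.snd_act₂
      mul := hind.mul.average h₂ h₁ m_mul (X.contMDiff_mul.mdifferentiable (by simp)) d₂ d₁ i₂ i₁
        hθ.mul_act₂
      fst := hind.fst.average h₂ h₁ m_fst (X.contMDiff_fst.mdifferentiable (by simp)) d₂ d₁ i₂ i₁
        hθ.fst_act₂
      src := hind.src.average h₁ h₀ m_src (X.contMDiff_src.mdifferentiable (by simp)) d₁ d₀ i₁ i₀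
        hθ.src_smul
      tgt := hind.tgt.average h₁ h₀ m_tgt (X.contMDiff_tgt.mdifferentiable (by simp)) d₁ d₀ i₁ i₀
        hθ.tgt_smul }
  have := μ₂.isMulRightInvariant_of_compactSpace
  refine ⟨ηbar, h₂, ⟨fun σ => ?_, hind'.mul.isTransverse⟩,
    h₂.isPreservedBy d₂ (hθ.act₂_one hG) (hθ.act₂_mul hG), η₁, ηbar₁, η₀, ηbar₀, hind, hind', h₁, h₀⟩
  exact ((hη.permute σ).average h₂ h₂ (m_perm σ) ((X.contMDiff_permute σ).mdifferentiable (by simp))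
    d₂ d₂ i₂ i₂ (hθ.permute_act₂ σ)).isPreservedBy
    fun z => (X.isInvertible_mfderiv_permute σ z).injective

/-- If there is a groupoid metric, then there is an invariant one. -/
theorem IsGroupoidMetric.exists_isIsometric (hG : G.IsLieTwoGroup) (hθ : IsTwoAction G X)
    {η : RiemMetric E₂ X₂} (hη : X.IsGroupoidMetric η) :
    ∃ ηbar : RiemMetric E₂ X₂, X.IsGroupoidMetric ηbar ∧ hθ.IsIsometric ηbar := by
  have := hG.lieGroup_obj
  have := hG.lieGroup_arr
  have := hG.lieGroup_pair
  have := hG.compactSpace_pair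
  have := hG.compactSpace_obj
  have tg₀ : IsTopologicalGroup G₀ := topologicalGroup_of_lieGroup 𝓘(ℝ, F₀) ∞
  have tg₁ : IsTopologicalGroup G₁ := topologicalGroup_of_lieGroup 𝓘(ℝ, F₁) ∞
  have tg₂ : IsTopologicalGroup G₂ := topologicalGroup_of_lieGroup 𝓘(ℝ, F₂) ∞
  obtain ⟨μ₂, _, _⟩ := exists_isHaarMeasure_isProbabilityMeasure G₂
  obtain ⟨μ₁, _, _⟩ := exists_isHaarMeasure_isProbabilityMeasure G₁
  obtain ⟨μ₀, _, _⟩ := exists_isHaarMeasure_isProbabilityMeasure G₀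
  obtain ⟨ηbar, -, h1, h2, -⟩ := hη.exists_average hG hθ μ₂ μ₁ μ₀
  exact ⟨ηbar, h1, h2⟩

end AverageMetric

end LieGroupoid

/-! ### Cutoff functions of proper groupoids -/

theorem HasLocalSections.isOpenMap {E X E' X' : Type*} [NormedAddCommGroup E] [NormedSpace ℝ E]
    [TopologicalSpace X] [ChartedSpace E X] [NormedAddCommGroup E'] [NormedSpace ℝ E']
    [TopologicalSpace X'] [ChartedSpace E' X'] {π : X → X'} (h : HasLocalSections E E' π) :
    IsOpenMap π := by
  intro U hU
  rw [isOpen_iff_mem_nhds]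
  rintro _ ⟨z, hz, rfl⟩
  obtain ⟨σ, hσ, hσz, hπ⟩ := h z
  have h1 : ∀ᶠ p in 𝓝 (π z), σ p ∈ U :=
    hσ.continuousAt.preimage_mem_nhds (hU.mem_nhds (by rwa [hσz]))
  filter_upwards [h1, hπ] with p hp hp'
  exact ⟨σ p, hp, hp'⟩

namespace LieGroupoid

section Cutoff

variable {E₀ E₁ E₂ X₀ X₁ X₂ : Type*}
  [NormedAddCommGroup E₀] [NormedSpace ℝ E₀] [TopologicalSpace X₀] [ChartedSpace E₀ X₀]
  [NormedAddCommGroup E₁] [NormedSpace ℝ E₁] [TopologicalSpace X₁] [ChartedSpace E₁ X₁]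
  [NormedAddCommGroup E₂] [NormedSpace ℝ E₂] [TopologicalSpace X₂] [ChartedSpace E₂ X₂]
  (X : LieGroupoid E₀ E₁ E₂ X₀ X₁ X₂)

/-- A cutoff function of a proper groupoid: a nonnegative smooth function on the objects which is
positive somewhere on each orbit and whose restrictions to the target maps of the source fibres
have compact support, locally uniformly. -/
structure IsCutoff (c : X₀ → ℝ) : Prop where
  smooth : ContMDiff 𝓘(ℝ, E₀) 𝓘(ℝ, ℝ) ∞ c
  nonneg : ∀ x, 0 ≤ c x
  exists_pos : ∀ x, ∃ g, X.src g = x ∧ 0 < c (X.tgt g)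
  isProper : ∀ x, ∃ N ∈ 𝓝 x, ∃ K : Set X₁, IsCompact K ∧
    ∀ g, X.src g ∈ N → c (X.tgt g) ≠ 0 → g ∈ K

/-- The saturation of a set of objects: the union of the orbits that meet it. -/
def saturation (A : Set X₀) : Set X₀ := {x | ∃ g, X.src g = x ∧ X.tgt g ∈ A}

variable {X}

theorem subset_saturation (A : Set X₀) : A ⊆ X.saturation A := fun x hx =>
  ⟨X.unit x, X.src_unit x, by rwa [X.tgt_unit]⟩

theorem saturation_mono {A B : Set X₀} (h : A ⊆ B) : X.saturation A ⊆ X.saturation B :=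
  fun _ ⟨g, hg, hA⟩ => ⟨g, hg, h hA⟩

theorem mem_saturation_of_arrow {A : Set X₀} {g : X₁} (h : X.tgt g ∈ X.saturation A) :
    X.src g ∈ X.saturation A := by
  obtain ⟨k, hk, hA⟩ := h
  exact ⟨X.op k g, X.src_op hk, by rwa [X.tgt_op hk]⟩

variable [IsManifold 𝓘(ℝ, E₀) ∞ X₀] [IsManifold 𝓘(ℝ, E₁) ∞ X₁] [IsManifold 𝓘(ℝ, E₂) ∞ X₂]

theorem isOpen_saturation {A : Set X₀} (hA : IsOpen A) : IsOpen (X.saturation A) := by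
  have : X.saturation A = X.src '' (X.tgt ⁻¹' A) := by
    ext x; exact ⟨fun ⟨g, h1, h2⟩ => ⟨g, h2, h1⟩, fun ⟨g, h2, h1⟩ => ⟨g, h1, h2⟩⟩
  rw [this]
  exact X.hasLocalSections_src.isOpenMap _ (hA.preimage X.contMDiff_tgt.continuous)

theorem IsProper.isClosed_saturation (hX : X.IsProper) [T2Space X₀] [LocallyCompactSpace X₀]
    {A : Set X₀} (hA : IsCompact A) : IsClosed (X.saturation A) := by
  rw [← isOpen_compl_iff, isOpen_iff_mem_nhds]
  intro x hx
  obtain ⟨K, hK, hxK⟩ := exists_compact_mem_nhds x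
  have h1 : X.saturation A ∩ K = X.src '' ((fun p => (X.src p, X.tgt p)) ⁻¹' (K ×ˢ A)) := by
    ext y
    exact ⟨fun ⟨⟨g, h1, h2⟩, h3⟩ => ⟨g, ⟨by rwa [← h1] at h3, h2⟩, h1⟩,
      fun ⟨g, ⟨h2, h3⟩, h1⟩ => ⟨⟨g, h1, h3⟩, h1 ▸ h2⟩⟩
  have h2 : IsClosed (X.saturation A ∩ K) := by
    rw [h1]
    exact ((IsProperMap.isCompact_preimage hX (hK.prod hA)).image
      X.contMDiff_src.continuous).isClosed
  filter_upwards [hxK, h2.isOpen_compl.mem_nhds fun h => hx h.1] with y hy hy' hy''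
  exact hy' ⟨hy'', hy⟩

/-- A proper groupoid has a cutoff function. For an exhaustion `L n` of the objects by compact
sets, it is positive on the sets `L (n + 1)` minus the saturation of the interior of `L n`, which
meet every orbit, and vanishes outside of the union of the sets `L (n + 2)` minus the saturation
of `L (n - 1)`; only finitely many of these meet the saturation of a given `L m`. -/
theorem IsProper.exists_isCutoff (hX : X.IsProper) [FiniteDimensional ℝ E₀] [T2Space X₀]
    [SecondCountableTopology X₀] : ∃ c, X.IsCutoff c := by
  have : LocallyCompactSpace X₀ := ChartedSpace.locallyCompactSpace E₀ X₀
  let L : CompactExhaustion X₀ := (default : CompactExhaustion X₀).shiftr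
  have hL0 : L 0 = ∅ := rfl
  let U : ℕ → Set X₀ := fun m => X.saturation (interior (L m))
  have hU : ∀ m, IsOpen (U m) := fun m => isOpen_saturation isOpen_interior
  have hUmono : ∀ {m n}, m ≤ n → U m ⊆ U n := fun h =>
    saturation_mono (interior_mono (L.subset h))
  have hLx : ∀ x, ∃ m, x ∈ interior (L m) := fun x => by
    obtain ⟨n, hn⟩ := L.exists_mem x
    exact ⟨n + 1, L.subset_interior_succ n hn⟩
  let C : Set X₀ := ⋃ n, L (n + 1) \ U n
  let O : Set X₀ := ⋃ n, interior (L (n + 2)) \ X.saturation (L (n - 1))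
  have hO : IsOpen O := isOpen_iUnion fun n =>
    isOpen_interior.sdiff (hX.isClosed_saturation (L.isCompact _))
  have hCO : C ⊆ O := by
    refine iUnion_mono fun n x hx => ⟨L.subset_interior_succ (n + 1) hx.1, fun h => hx.2 ?_⟩
    refine saturation_mono (A := L (n - 1)) ?_ h
    rcases n with _ | n
    · simp [hL0]
    · exact L.subset_interior_succ n
  have hC : IsClosed C := by
    rw [← isOpen_compl_iff, isOpen_iff_mem_nhds]
    intro x hx
    obtain ⟨m, hm⟩ := hLx x
    have h1 : IsClosed (⋃ n ∈ Finset.range m, L (n + 1) \ U n) :=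
      isClosed_biUnion_finset fun n _ => ((L.isCompact (n + 1)).isClosed.sdiff (hU n))
    have h2 : x ∉ ⋃ n ∈ Finset.range m, L (n + 1) \ U n := fun h => hx (by
      simp only [mem_iUnion] at h ⊢
      obtain ⟨n, -, hn⟩ := h
      exact mem_iUnion.2 ⟨n, hn⟩)
    filter_upwards [(hU m).mem_nhds (subset_saturation _ hm), h1.isOpen_compl.mem_nhds h2]
      with y hy hy' hyC
    obtain ⟨n, hn⟩ := mem_iUnion.1 hyC
    refine hy' ?_
    simp only [mem_iUnion]
    refine ⟨n, Finset.mem_range.2 ?_, hn⟩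
    by_contra hmn
    exact hn.2 (hUmono (not_lt.1 hmn) hy)
  have hOU : ∀ m, O ∩ U m ⊆ L (m + 2) := by
    rintro m x ⟨hxO, hxU⟩
    obtain ⟨n, hn⟩ := mem_iUnion.1 hxO
    have h1 : n ≤ m := by
      by_contra h
      exact hn.2 (saturation_mono (interior_subset.trans (L.subset (by omega))) hxU)
    exact L.subset (by omega) (interior_subset hn.1)
  obtain ⟨f, hf0, hf1, hf⟩ := exists_contMDiffMap_zero_one_of_isClosed (n := (⊤ : ℕ∞)) 𝓘(ℝ, E₀)
    hO.isClosed_compl hC (disjoint_compl_left_iff_subset.2 hCO)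
  refine ⟨f, f.contMDiff, fun x => (hf x).1, fun x => ?_, fun x => ?_⟩
  · have hex : ∃ m, x ∈ U m := (hLx x).imp fun m hm => subset_saturation _ hm
    classical
    obtain ⟨m, hm⟩ : ∃ m, Nat.find hex = m + 1 := by
      refine Nat.exists_eq_succ_of_ne_zero fun h0 => ?_
      obtain ⟨g, -, hg⟩ := h0 ▸ Nat.find_spec hex
      rw [hL0, interior_empty] at hg
      exact hg
    obtain ⟨g, rfl, hg⟩ := hm ▸ Nat.find_spec hex
    have h1 : X.tgt g ∈ C := mem_iUnion.2 ⟨m, interior_subset hg, fun h =>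
      Nat.find_min hex (m := m) (by omega) (mem_saturation_of_arrow h)⟩
    refine ⟨g, rfl, ?_⟩
    rw [hf1 h1]
    exact one_pos
  · obtain ⟨m, hm⟩ := hLx x
    refine ⟨_, isOpen_interior.mem_nhds hm, _, IsProperMap.isCompact_preimage hX
      ((L.isCompact m).prod (L.isCompact (m + 2))), fun g hg hc => ⟨interior_subset hg, ?_⟩⟩
    refine hOU m ⟨by_contra fun h => hc (hf0 h), X.inv g, X.src_inv g, ?_⟩
    rwa [X.tgt_inv]

end Cutoff

end LieGroupoid

/-! ### Locally finite sums and push-forward of dual metrics -/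

section LocalFiniteness

variable {EN HN N : Type*} [NormedAddCommGroup EN] [NormedSpace ℝ EN] [TopologicalSpace HN]
  {J : ModelWithCorners ℝ EN HN} [TopologicalSpace N] [ChartedSpace HN N]

theorem contMDiffAt_finsum_of_eventually {ι : Type*} {u : ι → N → ℝ} {n₀ : N} (s : Finset ι)
    (hs : ∀ᶠ n in 𝓝 n₀, ∀ i ∉ s, u i n = 0) (h : ∀ i, ContMDiffAt J 𝓘(ℝ, ℝ) ∞ (u i) n₀) :
    ContMDiffAt J 𝓘(ℝ, ℝ) ∞ (fun n => ∑ᶠ i, u i n) n₀ := by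
  have h1 : ContMDiffAt J 𝓘(ℝ, ℝ) ∞ (fun n => ∑ i ∈ s, u i n) n₀ :=
    contMDiffAt_finsetSum fun i _ => h i
  refine h1.congr_of_eventuallyEq (hs.mono fun n hn => ?_)
  exact finsum_eq_sum_of_support_subset _ fun i hi => by
    by_contra hi'
    exact hi (hn i hi')

/-- The functions of a partition of unity which do not vanish identically near a point. -/
theorem LocallyFinite.exists_finset {ι X : Type*} [TopologicalSpace X] {f : ι → X → ℝ}
    (hf : LocallyFinite fun i => Function.support (f i)) (x : X) :
    ∃ s : Finset ι, ∀ᶠ y in 𝓝 x, ∀ i ∉ s, f i y = 0 := by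
  obtain ⟨t, ht, hfin⟩ := hf x
  refine ⟨hfin.toFinset, ?_⟩
  filter_upwards [ht] with y hy i hi
  by_contra hne
  exact hi (hfin.mem_toFinset.2 ⟨y, hne, hy⟩)

theorem contMDiffAt_det {k : ℕ} {A : N → (Fin k → ℝ) →L[ℝ] (Fin k → ℝ)} {n₀ : N}
    (hA : ContMDiffAt J 𝓘(ℝ, (Fin k → ℝ) →L[ℝ] (Fin k → ℝ)) ∞ A n₀) :
    ContMDiffAt J 𝓘(ℝ, ℝ) ∞ (fun n => (A n).det) n₀ := by
  have h1 : ∀ B : (Fin k → ℝ) →L[ℝ] (Fin k → ℝ), B.det =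
      ∑ σ : Equiv.Perm (Fin k), (Equiv.Perm.sign σ : ℝ) * ∏ i, B (Pi.single i 1) (σ i) := by
    intro B
    have h2 : B.det = LinearMap.det (B : (Fin k → ℝ) →ₗ[ℝ] (Fin k → ℝ)) := rfl
    rw [h2, ← LinearMap.det_toMatrix', Matrix.det_apply']
    refine Finset.sum_congr rfl fun σ _ => ?_
    congr 1
  have h3 : ContDiff ℝ ∞ fun B : (Fin k → ℝ) →L[ℝ] (Fin k → ℝ) => B.det := by
    simp only [h1]
    refine ContDiff.sum fun σ _ => contDiff_const.mul (contDiff_prod fun i _ => ?_)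
    exact (contDiff_apply ℝ ℝ (σ i)).comp (contDiff_id.clm_apply contDiff_const)
  exact h3.contMDiff.contMDiffAt.comp n₀ hA

end LocalFiniteness

section PushForwardOfDuals

variable {E X E' X' E'' X'' : Type*}
  [NormedAddCommGroup E] [NormedSpace ℝ E] [FiniteDimensional ℝ E]
  [TopologicalSpace X] [ChartedSpace E X] [IsManifold 𝓘(ℝ, E) ∞ X]
  [NormedAddCommGroup E'] [NormedSpace ℝ E'] [FiniteDimensional ℝ E']
  [TopologicalSpace X'] [ChartedSpace E' X'] [IsManifold 𝓘(ℝ, E') ∞ X']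
  [NormedAddCommGroup E''] [NormedSpace ℝ E''] [FiniteDimensional ℝ E'']
  [TopologicalSpace X''] [ChartedSpace E'' X''] [IsManifold 𝓘(ℝ, E'') ∞ X'']

/-- The differential of a map as a map of the model spaces. -/
noncomputable def modelD (F : X → X') (x : X) : E →L[ℝ] E' := mfderiv 𝓘(ℝ, E) 𝓘(ℝ, E') F x

/-- The differential of the preferred chart around `x₀` as a map of the model space. -/
noncomputable def modelChartD (x₀ x : X) : E →L[ℝ] E := chartD x₀ x

theorem modelD_comp {F : X → X'} {x : X} {G : X' → X''}
    (hG : MDifferentiableAt 𝓘(ℝ, E') 𝓘(ℝ, E'') G (F x))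
    (hF : MDifferentiableAt 𝓘(ℝ, E) 𝓘(ℝ, E') F x) :
    (modelD (fun x => G (F x)) x : E →L[ℝ] E'') =
      (modelD G (F x) : E' →L[ℝ] E'') ∘L (modelD F x : E →L[ℝ] E') :=
  mfderiv_comp x hG hF

theorem modelD_congr {F F' : X → X'} {x : X} (h : F =ᶠ[𝓝 x] F') :
    (modelD F x : E →L[ℝ] E') = modelD F' x := h.mfderiv_eq

theorem modelD_const (x : X) (y : X') :
    (modelD (E := E) (E' := E') (fun _ : X => y) x : E →L[ℝ] E') = 0 :=
  mfderiv_const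

namespace RiemMetric

/-- The dual metric on functionals on the model space. -/
noncomputable def modelDual (η : RiemMetric E X) (x : X) (α β : E →L[ℝ] ℝ) : ℝ := η.dual x α β

section

variable (η : RiemMetric E X) (x : X) (α α' β : E →L[ℝ] ℝ)

theorem modelDual_symm : η.modelDual x α β = η.modelDual x β α := η.dual_comm x α β

theorem modelDual_add_left :
    η.modelDual x (α + α') β = η.modelDual x α β + η.modelDual x α' β :=
  η.isCometric_dual.add_left x α α' β

theorem modelDual_smul_left (c : ℝ) : η.modelDual x (c • α) β = c * η.modelDual x α β :=
  η.isCometric_dual.smul_left x c α β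

theorem modelDual_zero_left : η.modelDual x 0 β = 0 := η.isCometric_dual.zero_left x β

variable {α} in
theorem modelDual_pos (h : α ≠ 0) : 0 < η.modelDual x α α := η.isCometric_dual.pos x α h

end

/-- The positive semidefinite form `(α, β) ↦ η*_x(α ∘ dF(x), β ∘ dF(x))` on the covectors at
`F x`, which are given as functionals on the model space of the target. -/
noncomputable def pushDual (η : RiemMetric E X) (F : X → X') (x : X) (α β : E' →L[ℝ] ℝ) : ℝ :=
  η.modelDual x (α ∘L modelD F x) (β ∘L modelD F x)

variable (η : RiemMetric E X) {F F' : X → X'} {x : X} (α α' β : E' →L[ℝ] ℝ)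

theorem pushDual_symm : η.pushDual F x α β = η.pushDual F x β α := η.modelDual_symm _ _ _

theorem pushDual_add_left :
    η.pushDual F x (α + α') β = η.pushDual F x α β + η.pushDual F x α' β := by
  simp only [pushDual, ContinuousLinearMap.add_comp, modelDual_add_left]

theorem pushDual_smul_left (c : ℝ) : η.pushDual F x (c • α) β = c * η.pushDual F x α β := by
  simp only [pushDual, ContinuousLinearMap.smul_comp, modelDual_smul_left]

theorem pushDual_nonneg : 0 ≤ η.pushDual F x α α := by
  by_cases h : α ∘L (modelD F x : E →L[ℝ] E') = 0
  · rw [pushDual, h, modelDual_zero_left]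
  · exact (η.modelDual_pos x h).le

variable {α} in
theorem apply_modelD_eq_zero_of_pushDual (h : η.pushDual F x α α = 0) (v : E) :
    α (modelD F x v) = 0 := by
  by_contra hv
  refine (η.modelDual_pos x fun h0 => hv ?_).ne' h
  exact DFunLike.congr_fun h0 v

theorem pushDual_congr (h : F =ᶠ[𝓝 x] F') : η.pushDual F x α β = η.pushDual F' x α β := by
  rw [pushDual, pushDual, modelD_congr h]

theorem pushDual_const (y : X') : η.pushDual (E' := E') (fun _ => y) x α β = 0 := by
  rw [pushDual, modelD_const (E' := E'), ContinuousLinearMap.comp_zero, modelDual_zero_left]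

/-- A form pushed forward along a composition. -/
theorem pushDual_comp {G : X' → X''} (hG : MDifferentiableAt 𝓘(ℝ, E') 𝓘(ℝ, E'') G (F x))
    (hF : MDifferentiableAt 𝓘(ℝ, E) 𝓘(ℝ, E') F x) (α β : E'' →L[ℝ] ℝ) :
    η.pushDual (fun x => G (F x)) x α β =
      η.pushDual F x (α ∘L (modelD G (F x) : E' →L[ℝ] E''))
        (β ∘L (modelD G (F x) : E' →L[ℝ] E'')) := by
  rw [pushDual, pushDual, modelD_comp hG hF]
  rfl

theorem contMDiffAt_pushDual {EN HN N : Type*} [NormedAddCommGroup EN] [NormedSpace ℝ EN]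
    [TopologicalSpace HN] {J : ModelWithCorners ℝ EN HN} [TopologicalSpace N] [ChartedSpace HN N]
    [IsManifold J ∞ N] {F : N → X → X'} {f : N → X} {h : N → X'} {n₀ : N} {y₀ : X'}
    (hf : ContMDiffAt J 𝓘(ℝ, E) ∞ f n₀)
    (hF : ContMDiffAt (J.prod 𝓘(ℝ, E)) 𝓘(ℝ, E') ∞ (Function.uncurry F) (n₀, f n₀))
    (hh : ∀ᶠ n in 𝓝 n₀, F n (f n) = h n) (hy₀ : h n₀ ∈ (chartAt E' y₀).source)
    (ξ ζ : E' →L[ℝ] ℝ) :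
    ContMDiffAt J 𝓘(ℝ, ℝ) ∞ (fun n => η.pushDual (F n) (f n)
      (ξ ∘L modelChartD y₀ (h n)) (ζ ∘L modelChartD y₀ (h n))) n₀ := by
  refine (η.contMDiffAt_dual_pullback hf hF (hh.self_of_nhds ▸ hy₀) ξ ζ).congr_of_eventuallyEq
    (hh.mono fun n hn => ?_)
  simp only [← hn]
  rfl

end RiemMetric

/-- Vector spaces carry Riemannian metrics. -/
theorem exists_riemMetric_self (E : Type*) [NormedAddCommGroup E] [NormedSpace ℝ E]
    [FiniteDimensional ℝ E] : Nonempty (RiemMetric E E) := by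
  let e := Module.finBasis ℝ E
  let b : ∀ x : E, (TangentSpace 𝓘(ℝ, E) x →L[ℝ] ℝ) → (TangentSpace 𝓘(ℝ, E) x →L[ℝ] ℝ) → ℝ :=
    fun x α β => ∑ a, (show E →L[ℝ] ℝ from α) (e a) * (show E →L[ℝ] ℝ from β) (e a)
  have hD : ∀ x₀ x : E, (chartD x₀ x : E →L[ℝ] E) = ContinuousLinearMap.id ℝ E := by
    intro x₀ x
    rw [chartD]
    have h1 : (extChartAt 𝓘(ℝ, E) x₀ : E → E) = id := by
      rw [extChartAt_model_space_eq_id]; rfl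
    rw [h1]
    exact mfderiv_id
  have hb : IsCometric b :=
    { symm := fun x α β => Finset.sum_congr rfl fun a _ => mul_comm _ _
      add_left := fun x α α' β => by
        simp only [b, ← Finset.sum_add_distrib]
        exact Finset.sum_congr rfl fun a _ => add_mul _ _ _
      smul_left := fun x c α β => by
        simp only [b, Finset.mul_sum]
        exact Finset.sum_congr rfl fun a _ => mul_assoc _ _ _
      pos := fun x α hα => by
        obtain ⟨a, ha⟩ : ∃ a, (show E →L[ℝ] ℝ from α) (e a) ≠ 0 := by
          by_contra! h
          refine hα ?_
          have h1 : (show E →L[ℝ] ℝ from α).toLinearMap = 0 := e.ext h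
          ext v
          exact LinearMap.congr_fun h1 v
        exact Finset.sum_pos' (fun a _ => mul_self_nonneg _)
          ⟨a, Finset.mem_univ a, mul_self_pos.2 ha⟩
      smooth := fun x₀ ξ ζ => by
        have h1 : (fun x : E => b x (ξ ∘L chartD x₀ x) (ζ ∘L chartD x₀ x)) =
            fun x => ∑ a, ξ (e a) * ζ (e a) := by
          funext x
          exact congrArg (fun D : E →L[ℝ] E => ∑ a, (ξ ∘L D) (e a) * (ζ ∘L D) (e a)) (hD x₀ x)
        rw [h1]
        exact contMDiffAt_const }
  exact ⟨hb.exists_metric.choose⟩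

/-- Second countable Hausdorff manifolds carry Riemannian metrics. -/
theorem exists_riemMetric (E X : Type*) [NormedAddCommGroup E] [NormedSpace ℝ E]
    [FiniteDimensional ℝ E] [TopologicalSpace X] [ChartedSpace E X] [IsManifold 𝓘(ℝ, E) ∞ X]
    [T2Space X] [SecondCountableTopology X] : Nonempty (RiemMetric E X) := by
  have : LocallyCompactSpace X := ChartedSpace.locallyCompactSpace E X
  obtain ⟨ρ⟩ := exists_riemMetric_self E
  obtain ⟨χ, hχ⟩ := SmoothPartitionOfUnity.exists_isSubordinate_chartAt_source 𝓘(ℝ, E) X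
  let q : X → X → (E →L[ℝ] ℝ) → (E →L[ℝ] ℝ) → ℝ := fun i x α β =>
    χ i x * ρ.pushDual (extChartAt 𝓘(ℝ, E) i).symm (extChartAt 𝓘(ℝ, E) i x) α β
  have hfin : ∀ x (α β : E →L[ℝ] ℝ), (Function.support fun i => q i x α β).Finite := fun x α β =>
    (χ.locallyFinite.point_finite x).subset fun i hi h0 => hi (by
      simp only [q, show χ i x = 0 by simpa using h0, zero_mul])
  let b : ∀ x : X, (TangentSpace 𝓘(ℝ, E) x →L[ℝ] ℝ) → (TangentSpace 𝓘(ℝ, E) x →L[ℝ] ℝ) → ℝ :=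
    fun x α β => ∑ᶠ i, q i x α β
  have hb : IsCometric b :=
    { symm := fun x α β => finsum_congr fun i =>
        congrArg (χ i x * ·)
        (ρ.pushDual_symm (show E →L[ℝ] ℝ from α) (show E →L[ℝ] ℝ from β))
      add_left := fun x α α' β => by
        simp only [b]
        rw [← finsum_add_distrib (hfin x α β) (hfin x α' β)]
        refine finsum_congr fun i => ?_
        simp only [q, ← mul_add]
        exact congrArg (χ i x * ·) (ρ.pushDual_add_left (show E →L[ℝ] ℝ from α) α' β)
      smul_left := fun x c α β => by
        simp only [b]
        rw [mul_finsum]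
        refine finsum_congr fun i => ?_
        simp only [q]
        rw [mul_left_comm]
        exact congrArg (χ i x * ·) (ρ.pushDual_smul_left (show E →L[ℝ] ℝ from α) β c)
      pos := fun x α hα => by
        obtain ⟨i, hi⟩ := χ.exists_pos_of_mem (mem_univ x)
        have hxi : x ∈ (chartAt E i).source := hχ i (subset_tsupport _ hi.ne')
        have h1 : ∀ j, 0 ≤ q j x α α := fun j => mul_nonneg (χ.nonneg j x) (ρ.pushDual_nonneg _)
        refine (h1 i).lt_of_ne' ?_ |>.trans_le (single_le_finsum i (hfin x α α) h1)
        intro h0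
        have h2 := ρ.apply_modelD_eq_zero_of_pushDual ((mul_eq_zero.1 h0).resolve_left hi.ne')
        refine hα ?_
        have hs : (mfderiv 𝓘(ℝ, E) 𝓘(ℝ, E) (extChartAt 𝓘(ℝ, E) i).symm
            (extChartAt 𝓘(ℝ, E) i x)).IsInvertible := by
          have : IsManifold 𝓘(ℝ, E) 1 X := IsManifold.of_le (n := ∞) (by simp)
          have h3 := isInvertible_mfderivWithin_extChartAt_symm (I := 𝓘(ℝ, E)) (x := i)
            ((extChartAt 𝓘(ℝ, E) i).map_source (x := x) (by simpa using hxi))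
          simpa [mfderivWithin_univ] using h3
        have h4 : ∀ v : E, (show E →L[ℝ] ℝ from α) v = 0 := fun v => by
          obtain ⟨u, hu⟩ := hs.surjective v
          rw [← h2 u]
          exact congrArg (show E →L[ℝ] ℝ from α) hu.symm
        ext v
        exact h4 v
      smooth := fun x₀ ξ ζ => by
        obtain ⟨s, hs⟩ := χ.locallyFinite.exists_finset x₀
        refine contMDiffAt_finsum_of_eventually s (hs.mono fun x hx i hi => ?_) fun i => ?_
        · simp only [q]
          rw [hx i hi, zero_mul]
        · by_cases hi : x₀ ∈ tsupport (χ i)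
          · have hxi : x₀ ∈ (chartAt E i).source := hχ i hi
            refine (χ i).contMDiff.contMDiffAt.mul ?_
            refine ρ.contMDiffAt_pushDual (J := 𝓘(ℝ, E))
              (F := fun _ : X => (extChartAt 𝓘(ℝ, E) i).symm) (h := id)
              (contMDiffAt_extChartAt' hxi) ?_ ?_ (mem_chart_source E x₀) ξ ζ
            · have h3 : ContMDiffAt 𝓘(ℝ, E) 𝓘(ℝ, E) ∞ (extChartAt 𝓘(ℝ, E) i).symm
                  (extChartAt 𝓘(ℝ, E) i x₀) :=
                (contMDiffOn_extChartAt_symm i).contMDiffAt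
                  ((isOpen_extChartAt_target i).mem_nhds
                    ((extChartAt 𝓘(ℝ, E) i).map_source (by simpa using hxi)))
              exact ContMDiffAt.comp (g := (extChartAt 𝓘(ℝ, E) i).symm) (f := Prod.snd) _ h3
                contMDiffAt_snd
            · filter_upwards [(chartAt E i).open_source.mem_nhds hxi] with x hx
              exact (extChartAt 𝓘(ℝ, E) i).left_inv (by simpa using hx)
          · refine contMDiffAt_const (c := (0 : ℝ)) |>.congr_of_eventuallyEq ?_
            filter_upwards [(isClosed_tsupport _).isOpen_compl.mem_nhds hi] with x hx
            simp only [q]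
            rw [image_eq_zero_of_notMem_tsupport hx, zero_mul] }
  exact ⟨hb.exists_metric.choose⟩

end PushForwardOfDuals

/-! ### Right translations in fibre coordinates -/

namespace LieGroupoid

section FibreAtlas

variable {E₀ E₁ E₂ X₀ X₁ X₂ : Type*}
  [NormedAddCommGroup E₀] [NormedSpace ℝ E₀] [TopologicalSpace X₀] [ChartedSpace E₀ X₀]
  [NormedAddCommGroup E₁] [NormedSpace ℝ E₁] [TopologicalSpace X₁] [ChartedSpace E₁ X₁]
  [NormedAddCommGroup E₂] [NormedSpace ℝ E₂] [TopologicalSpace X₂] [ChartedSpace E₂ X₂]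

/-- A family of local trivializations of the source map, with fibre `ℝᵏ`, and a smooth partition
of unity on the arrows which is subordinate to their domains. -/
structure FibreAtlas [FiniteDimensional ℝ E₁] (X : LieGroupoid E₀ E₁ E₂ X₀ X₁ X₂) (k : ℕ)
    (ι : Type*) where
  /-- the local trivializations -/
  chart : ι → OpenPartialHomeomorph X₁ (X₀ × (Fin k → ℝ))
  isFibreChart : ∀ i, IsFibreChart E₁ E₀ X.src (chart i)
  /-- the partition of unity -/
  part : SmoothPartitionOfUnity ι 𝓘(ℝ, E₁) X₁ univ
  subordinate : part.IsSubordinate fun i => (chart i).source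

theorem exists_fibreAtlas [FiniteDimensional ℝ E₁] (X : LieGroupoid E₀ E₁ E₂ X₀ X₁ X₂)
    [IsManifold 𝓘(ℝ, E₀) ∞ X₀] [IsManifold 𝓘(ℝ, E₁) ∞ X₁] [T2Space X₁]
    [SecondCountableTopology X₁] : ∃ k, Nonempty (FibreAtlas X k X₁) := by
  have : LocallyCompactSpace X₁ := ChartedSpace.locallyCompactSpace E₁ X₁
  obtain ⟨k, hk⟩ := X.src_submersion.exists_isFibreChart
  choose S hS hS' using hk
  obtain ⟨χ, hχ⟩ := SmoothPartitionOfUnity.exists_isSubordinate 𝓘(ℝ, E₁) isClosed_univ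
    (fun g => (S g).source) (fun g => (S g).open_source)
    (fun g _ => mem_iUnion_of_mem g (hS g))
  exact ⟨k, ⟨⟨S, hS', χ, hχ⟩⟩⟩

namespace FibreAtlas

variable [FiniteDimensional ℝ E₁] [IsManifold 𝓘(ℝ, E₀) ∞ X₀] [IsManifold 𝓘(ℝ, E₁) ∞ X₁]
  [IsManifold 𝓘(ℝ, E₂) ∞ X₂]
  {X : LieGroupoid E₀ E₁ E₂ X₀ X₁ X₂} {k : ℕ} {ι : Type*}
  (A : FibreAtlas X k ι)

/-- The fibre coordinates of an arrow. -/
noncomputable def coord (i : ι) (g : X₁) : Fin k → ℝ := (A.chart i g).2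

/-- The arrow with source `x` and given fibre coordinates. -/
noncomputable def point (i : ι) (x : X₀) (v : Fin k → ℝ) : X₁ := (A.chart i).symm (x, v)

/-- The range of the fibre coordinates of the arrows with source `x`. -/
def dom (i : ι) (x : X₀) : Set (Fin k → ℝ) := {v | (x, v) ∈ (A.chart i).target}

theorem isOpen_dom (i : ι) (x : X₀) : IsOpen (A.dom i x) :=
  (A.chart i).open_target.preimage (by fun_prop : Continuous fun v : Fin k → ℝ => (x, v))

variable {i j : ι} {x : X₀} {v : Fin k → ℝ} {g : X₁}

theorem point_mem (hv : v ∈ A.dom i x) : A.point i x v ∈ (A.chart i).source :=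
  (A.chart i).map_target hv

theorem src_point (hv : v ∈ A.dom i x) : X.src (A.point i x v) = x :=
  (A.isFibreChart i).map_symm hv

theorem coord_point (hv : v ∈ A.dom i x) : A.coord i (A.point i x v) = v := by
  rw [coord, point, (A.chart i).right_inv hv]

theorem coord_mem (hg : g ∈ (A.chart i).source) : A.coord i g ∈ A.dom i (X.src g) :=
  (A.isFibreChart i).mk_mem_target hg

theorem point_coord (hg : g ∈ (A.chart i).source) : A.point i (X.src g) (A.coord i g) = g :=
  (A.isFibreChart i).symm_mk hg

theorem mem_source_of_part_ne_zero (h : A.part i g ≠ 0) : g ∈ (A.chart i).source :=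
  A.subordinate i (subset_tsupport _ h)

section Smooth

variable {EN HN N : Type*} [NormedAddCommGroup EN] [NormedSpace ℝ EN] [TopologicalSpace HN]
  {J : ModelWithCorners ℝ EN HN} [TopologicalSpace N] [ChartedSpace HN N]

theorem contMDiffAt_coord {f : N → X₁} {n : N} (hf : ContMDiffAt J 𝓘(ℝ, E₁) ∞ f n)
    (h : f n ∈ (A.chart i).source) :
    ContMDiffAt J 𝓘(ℝ, Fin k → ℝ) ∞ (fun m => A.coord i (f m)) n :=
  ContMDiffAt.comp (g := A.coord i) n ((A.isFibreChart i).contMDiffAt_snd h) hf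

theorem contMDiffAt_point {x : N → X₀} {v : N → Fin k → ℝ} {n : N}
    (hx : ContMDiffAt J 𝓘(ℝ, E₀) ∞ x n) (hv : ContMDiffAt J 𝓘(ℝ, Fin k → ℝ) ∞ v n)
    (h : v n ∈ A.dom i (x n)) :
    ContMDiffAt J 𝓘(ℝ, E₁) ∞ (fun m => A.point i (x m) (v m)) n :=
  ContMDiffAt.comp (g := (A.chart i).symm) (f := fun m => (x m, v m)) n
    ((A.isFibreChart i).contMDiffAt_symm h) (hx.prodMk hv)

theorem eventually_mem_dom {x : N → X₀} {v : N → Fin k → ℝ} {n : N}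
    (hx : ContinuousAt x n) (hv : ContinuousAt v n)
    (h : v n ∈ A.dom i (x n)) : ∀ᶠ m in 𝓝 n, v m ∈ A.dom i (x m) :=
  (hx.prodMk hv).preimage_mem_nhds ((A.chart i).open_target.mem_nhds h)

end Smooth

/-- The right translation by the arrow `h` in fibre coordinates. -/
noncomputable def trans (i j : ι) (h : X₁) (w : Fin k → ℝ) : Fin k → ℝ :=
  A.coord j (X.op (A.point i (X.tgt h) w) h)

/-- The set on which the right translation `trans i j h` is defined. -/
def transDom (i j : ι) (h : X₁) : Set (Fin k → ℝ) :=
  {w | w ∈ A.dom i (X.tgt h) ∧ X.op (A.point i (X.tgt h) w) h ∈ (A.chart j).source}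

variable {h h' : X₁} {w : Fin k → ℝ} {l : ι}

theorem transDom_subset : A.transDom i j h ⊆ A.dom i (X.tgt h) := fun _ hw => hw.1

theorem point_trans (hw : w ∈ A.transDom i j h) :
    A.point j (X.src h) (A.trans i j h w) = X.op (A.point i (X.tgt h) w) h := by
  have := A.point_coord hw.2
  rwa [X.src_op (A.src_point hw.1)] at this

theorem trans_mem (hw : w ∈ A.transDom i j h) :
    A.trans i j h w ∈ A.transDom j i (X.inv h) := by
  have h1 := A.coord_mem hw.2
  rw [X.src_op (A.src_point hw.1)] at h1
  refine ⟨by rwa [X.tgt_inv], ?_⟩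
  rw [X.tgt_inv, A.point_trans hw, X.op_inv_cancel_right (A.src_point hw.1)]
  exact A.point_mem hw.1

theorem trans_trans (hh : X.src h = X.tgt h') (hw : w ∈ A.transDom i j h) :
    A.trans j l h' (A.trans i j h w) = A.trans i l (X.op h h') w := by
  rw [trans, ← hh, A.point_trans hw, X.op_assoc (A.src_point hw.1) hh, ← X.tgt_op hh, trans]

theorem trans_inv_trans (hw : w ∈ A.transDom i j h) :
    A.trans j i (X.inv h) (A.trans i j h w) = w := by
  rw [A.trans_trans (X.tgt_inv h).symm hw, X.op_inv_self, trans, X.tgt_unit,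
    X.op_unit (A.src_point hw.1), A.coord_point hw.1]

theorem image_transDom : A.trans i j h '' A.transDom i j h = A.transDom j i (X.inv h) := by
  refine Subset.antisymm (image_subset_iff.2 fun w hw => A.trans_mem hw) fun w hw => ?_
  have h1 := A.trans_mem hw
  have h2 := A.trans_inv_trans hw
  rw [X.inv_inv] at h1 h2
  exact ⟨_, h1, h2⟩

theorem injOn_trans : InjOn (A.trans i j h) (A.transDom i j h) :=
  fun w hw w' hw' e => by rw [← A.trans_inv_trans hw, e, A.trans_inv_trans hw']

section Smooth

variable {EN HN N : Type*} [NormedAddCommGroup EN] [NormedSpace ℝ EN] [TopologicalSpace HN]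
  {J : ModelWithCorners ℝ EN HN} [TopologicalSpace N] [ChartedSpace HN N]

theorem contMDiffAt_op_point {h : N → X₁} {w : N → Fin k → ℝ} {n : N}
    (hh : ContMDiffAt J 𝓘(ℝ, E₁) ∞ h n) (hw : ContMDiffAt J 𝓘(ℝ, Fin k → ℝ) ∞ w n)
    (hm : w n ∈ A.dom i (X.tgt (h n))) :
    ContMDiffAt J 𝓘(ℝ, E₁) ∞ (fun m => X.op (A.point i (X.tgt (h m)) (w m)) (h m)) n := by
  have h1 : ContMDiffAt J 𝓘(ℝ, E₀) ∞ (fun m => X.tgt (h m)) n :=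
    X.contMDiff_tgt.contMDiffAt.comp n hh
  exact X.contMDiffAt_op (A.contMDiffAt_point h1 hw hm) hh
    ((A.eventually_mem_dom h1.continuousAt hw.continuousAt hm).mono fun m hm => A.src_point hm)

theorem contMDiffAt_trans {h : N → X₁} {w : N → Fin k → ℝ} {n : N}
    (hh : ContMDiffAt J 𝓘(ℝ, E₁) ∞ h n) (hw : ContMDiffAt J 𝓘(ℝ, Fin k → ℝ) ∞ w n)
    (hm : w n ∈ A.transDom i j (h n)) :
    ContMDiffAt J 𝓘(ℝ, Fin k → ℝ) ∞ (fun m => A.trans i j (h m) (w m)) n :=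
  A.contMDiffAt_coord (A.contMDiffAt_op_point hh hw hm.1) hm.2

theorem isOpen_transDom (i j : ι) (h : X₁) : IsOpen (A.transDom i j h) := by
  rw [isOpen_iff_mem_nhds]
  intro w hw
  have h1 := A.contMDiffAt_op_point (J := 𝓘(ℝ, Fin k → ℝ)) (h := fun _ => h) (w := id) (n := w)
    contMDiffAt_const contMDiffAt_id hw.1
  filter_upwards [(A.isOpen_dom i (X.tgt h)).mem_nhds hw.1,
    h1.continuousAt.preimage_mem_nhds ((A.chart j).open_source.mem_nhds hw.2)] with w' h2 h3
  exact ⟨h2, h3⟩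

theorem differentiableAt_trans (hw : w ∈ A.transDom i j h) :
    DifferentiableAt ℝ (A.trans i j h) w :=
  ((A.contMDiffAt_trans (J := 𝓘(ℝ, Fin k → ℝ)) (h := fun _ => h) (w := id) (n := w)
    contMDiffAt_const contMDiffAt_id hw).contDiffAt).differentiableAt (by simp)

/-- The Jacobian of a right translation in fibre coordinates. -/
noncomputable def jac (i j : ι) (h : X₁) (w : Fin k → ℝ) : ℝ :=
  |(fderiv ℝ (A.trans i j h) w).det|

theorem jac_op (hh : X.src h = X.tgt h') (hw : w ∈ A.transDom i j h)
    (hw' : A.trans i j h w ∈ A.transDom j l h') :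
    A.jac i l (X.op h h') w = A.jac j l h' (A.trans i j h w) * A.jac i j h w := by
  have h1 : A.trans i l (X.op h h') =ᶠ[𝓝 w] fun u => A.trans j l h' (A.trans i j h u) := by
    filter_upwards [(A.isOpen_transDom i j h).mem_nhds hw] with u hu
    exact (A.trans_trans hh hu).symm
  rw [jac, h1.fderiv_eq, fderiv_fun_comp w (A.differentiableAt_trans hw')
    (A.differentiableAt_trans hw), jac, jac, ← abs_mul]
  congr 1
  exact LinearMap.det_comp _ _

theorem jac_unit (hw : w ∈ A.dom i x) : A.jac i i (X.unit x) w = 1 := by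
  have h1 : A.trans i i (X.unit x) =ᶠ[𝓝 w] id := by
    filter_upwards [(A.isOpen_dom i x).mem_nhds hw] with u hu
    rw [trans, X.tgt_unit, X.op_unit (A.src_point hu), A.coord_point hu, id]
  rw [jac, h1.fderiv_eq, fderiv_id]
  simp [ContinuousLinearMap.det]

theorem jac_pos (hw : w ∈ A.transDom i j h) : 0 < A.jac i j h w := by
  refine (abs_nonneg _).lt_of_ne' fun h0 => ?_
  have h1 := A.jac_op (l := i) (X.tgt_inv h).symm hw (A.trans_mem hw)
  rw [X.op_inv_self, A.jac_unit hw.1, show A.jac i j h w = 0 from h0, mul_zero] at h1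
  exact one_ne_zero h1

theorem contMDiffAt_jac [IsManifold J ∞ N] {h : N → X₁} {w : N → Fin k → ℝ} {n : N}
    (hh : ContMDiffAt J 𝓘(ℝ, E₁) ∞ h n) (hw : ContMDiffAt J 𝓘(ℝ, Fin k → ℝ) ∞ w n)
    (hm : w n ∈ A.transDom i j (h n)) :
    ContMDiffAt J 𝓘(ℝ, ℝ) ∞ (fun m => A.jac i j (h m) (w m)) n := by
  have h1 : ContMDiffAt (J.prod 𝓘(ℝ, Fin k → ℝ)) 𝓘(ℝ, Fin k → ℝ) ∞
      (Function.uncurry fun m u => A.trans i j (h m) u) (n, w n) :=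
    A.contMDiffAt_trans (h := fun p : N × (Fin k → ℝ) => h p.1) (w := Prod.snd)
      (hh.comp _ contMDiffAt_fst) contMDiffAt_snd hm
  have h2 := h1.partial_fderiv.comp n (contMDiffAt_id.prodMk hw)
  have h3 := contMDiffAt_det h2
  have h4 : (fderiv ℝ (A.trans i j (h n)) (w n)).det ≠ 0 := abs_pos.1 (A.jac_pos hm)
  exact (contDiffAt_abs h4).contMDiffAt.comp n h3

end Smooth

end FibreAtlas

end FibreAtlas

end LieGroupoid

/-! ### Invariant integration over the source fibres -/


namespace LieGroupoid

namespace FibreAtlas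

variable {E₀ E₁ E₂ X₀ X₁ X₂ : Type*}
  [NormedAddCommGroup E₀] [NormedSpace ℝ E₀] [TopologicalSpace X₀] [ChartedSpace E₀ X₀]
  [NormedAddCommGroup E₁] [NormedSpace ℝ E₁] [TopologicalSpace X₁] [ChartedSpace E₁ X₁]
  [NormedAddCommGroup E₂] [NormedSpace ℝ E₂] [TopologicalSpace X₂] [ChartedSpace E₂ X₂]
  [FiniteDimensional ℝ E₁] [IsManifold 𝓘(ℝ, E₀) ∞ X₀] [IsManifold 𝓘(ℝ, E₁) ∞ X₁]
  [IsManifold 𝓘(ℝ, E₂) ∞ X₂]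
  {X : LieGroupoid E₀ E₁ E₂ X₀ X₁ X₂} {k : ℕ} {ι : Type*}
  (A : FibreAtlas X k ι) {i j l : ι} {x : X₀} {v w : Fin k → ℝ} {g h : X₁} {c : X₀ → ℝ}

theorem coord_mem_transDom (hg : g ∈ (A.chart i).source) (hgh : X.src g = X.tgt h)
    (hj : X.op g h ∈ (A.chart j).source) : A.coord i g ∈ A.transDom i j h := by
  refine ⟨hgh ▸ A.coord_mem hg, ?_⟩
  rwa [← hgh, A.point_coord hg]

theorem trans_coord (hg : g ∈ (A.chart i).source) (hgh : X.src g = X.tgt h) :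
    A.trans i j h (A.coord i g) = A.coord j (X.op g h) := by
  rw [trans, ← hgh, A.point_coord hg]

theorem sum_part_eq_one (g : X₁) : ∑ᶠ i, A.part i g = 1 := A.part.sum_eq_one (mem_univ g)

theorem exists_part_pos (g : X₁) : ∃ i, 0 < A.part i g := A.part.exists_pos_of_mem (mem_univ g)

/-- The density, in the fibre coordinates of the chart `i`, of a measure on the source fibres which
is invariant under right translations. At the arrow `g` it is obtained from the average of the
Lebesgue measures of the charts around the unit at `tgt g` by the right translation by `g`; the
factor `c (tgt g)` is invariant under right translations, too. -/
noncomputable def density (c : X₀ → ℝ) (i : ι) (g : X₁) : ℝ :=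
  c (X.tgt g) * ∑ᶠ j, A.part j (X.unit (X.tgt g)) * A.jac i j (X.inv g) (A.coord i g)

theorem density_eq_zero (hc : c (X.tgt g) = 0) : A.density c i g = 0 := by
  rw [density, hc, zero_mul]

theorem jac_nonneg (h : X₁) (w : Fin k → ℝ) : 0 ≤ A.jac i j h w := abs_nonneg _

theorem density_nonneg (hc : ∀ x, 0 ≤ c x) : 0 ≤ A.density c i g :=
  mul_nonneg (hc _) (finsum_nonneg fun j => mul_nonneg (A.part.nonneg j _) (A.jac_nonneg _ _))

theorem coord_mem_transDom_inv (hg : g ∈ (A.chart i).source)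
    (hj : X.unit (X.tgt g) ∈ (A.chart j).source) : A.coord i g ∈ A.transDom i j (X.inv g) :=
  A.coord_mem_transDom hg (X.tgt_inv g).symm (by rwa [X.op_inv_self])

theorem density_pos (hc : 0 < c (X.tgt g)) (hg : g ∈ (A.chart i).source) :
    0 < A.density c i g := by
  refine mul_pos hc ?_
  obtain ⟨j, hj⟩ := A.exists_part_pos (X.unit (X.tgt g))
  refine (mul_pos hj (A.jac_pos (A.coord_mem_transDom_inv hg
    (A.mem_source_of_part_ne_zero hj.ne')))).trans_le (single_le_finsum j
      (f := fun j => A.part j (X.unit (X.tgt g)) * A.jac i j (X.inv g) (A.coord i g)) ?_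
      fun j => mul_nonneg (A.part.nonneg j _) (A.jac_nonneg _ _))
  exact (A.part.locallyFinite.point_finite (X.unit (X.tgt g))).subset fun j hj h0 => hj (by
    simp only [show A.part j (X.unit (X.tgt g)) = 0 by simpa using h0, zero_mul])

/-- The invariance of the density under right translations. -/
theorem density_eq_mul_jac (hg : g ∈ (A.chart i).source) (hgh : X.src g = X.tgt h)
    (hj : X.op g h ∈ (A.chart j).source) :
    A.density c i g = A.density c j (X.op g h) * A.jac i j h (A.coord i g) := by
  have hmem := A.coord_mem_transDom hg hgh hj
  rw [density, density, X.tgt_op hgh, mul_assoc, finsum_mul]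
  congr 1
  refine finsum_congr fun l => ?_
  rcases eq_or_ne (A.part l (X.unit (X.tgt g))) 0 with h0 | h0
  · rw [h0, zero_mul, zero_mul, zero_mul]
  · have h1 : X.src h = X.tgt (X.inv (X.op g h)) := by rw [X.tgt_inv, X.src_op hgh]
    have h2 : X.op h (X.inv (X.op g h)) = X.inv g := by
      rw [X.inv_op hgh, X.op_inv_cancel_left]
      rw [X.tgt_inv, hgh]
    have h3 : X.unit (X.tgt (X.op g h)) ∈ (A.chart l).source := by
      rw [X.tgt_op hgh]
      exact A.mem_source_of_part_ne_zero h0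
    have h4 := A.jac_op (l := l) h1 hmem (by
      rw [A.trans_coord hg hgh]
      exact A.coord_mem_transDom_inv hj h3)
    rw [← h2, h4, A.trans_coord hg hgh, mul_assoc]

theorem contMDiffAt_part {EN HN N : Type*} [NormedAddCommGroup EN] [NormedSpace ℝ EN]
    [TopologicalSpace HN] {J : ModelWithCorners ℝ EN HN} [TopologicalSpace N] [ChartedSpace HN N]
    {f : N → X₁} {n : N} (hf : ContMDiffAt J 𝓘(ℝ, E₁) ∞ f n) :
    ContMDiffAt J 𝓘(ℝ, ℝ) ∞ (fun m => A.part i (f m)) n :=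
  (A.part i).contMDiff.contMDiffAt.comp n hf

theorem contMDiffAt_density {EN HN N : Type*} [NormedAddCommGroup EN] [NormedSpace ℝ EN]
    [TopologicalSpace HN] {J : ModelWithCorners ℝ EN HN} [TopologicalSpace N] [ChartedSpace HN N]
    [IsManifold J ∞ N] {f : N → X₁} {n : N} (hc : ContMDiff 𝓘(ℝ, E₀) 𝓘(ℝ, ℝ) ∞ c)
    (hf : ContMDiffAt J 𝓘(ℝ, E₁) ∞ f n) (hm : f n ∈ (A.chart i).source) :
    ContMDiffAt J 𝓘(ℝ, ℝ) ∞ (fun m => A.density c i (f m)) n := by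
  have ht : ContMDiffAt J 𝓘(ℝ, E₀) ∞ (fun m => X.tgt (f m)) n :=
    X.contMDiff_tgt.contMDiffAt.comp n hf
  have hu : ContMDiffAt J 𝓘(ℝ, E₁) ∞ (fun m => X.unit (X.tgt (f m))) n :=
    X.unit_smooth.contMDiffAt.comp n ht
  refine (hc.contMDiffAt.comp n ht).mul ?_
  obtain ⟨s, hs⟩ := A.part.locallyFinite.exists_finset (X.unit (X.tgt (f n)))
  refine contMDiffAt_finsum_of_eventually s
    ((hu.continuousAt.eventually hs).mono fun m hm j hj => ?_) fun j => ?_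
  · simp only [hm j hj, zero_mul]
  · by_cases hj : X.unit (X.tgt (f n)) ∈ tsupport (A.part j)
    · exact (A.contMDiffAt_part hu).mul (A.contMDiffAt_jac (X.contMDiffAt_inv hf)
        (A.contMDiffAt_coord hf hm) (A.coord_mem_transDom_inv hm (A.subordinate j hj)))
    · refine contMDiffAt_const (c := (0 : ℝ)) |>.congr_of_eventuallyEq ?_
      filter_upwards [hu.continuousAt.eventually
        ((isClosed_tsupport _).isOpen_compl.mem_nhds hj)] with m hm
      rw [image_eq_zero_of_notMem_tsupport hm, zero_mul]

/-- The integral of a function on the source fibre over `x` with respect to the invariant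
density. -/
noncomputable def integral (c : X₀ → ℝ) (x : X₀) (F : X₁ → ℝ) : ℝ :=
  ∑ᶠ i, ∫ v in A.dom i x, A.part i (A.point i x v) * A.density c i (A.point i x v) *
    F (A.point i x v)

/-- Continuity along a source fibre. -/
def FibreContinuous (x : X₀) (F : X₁ → ℝ) : Prop :=
  ∀ i, ContinuousOn (fun v => F (A.point i x v)) (A.dom i x)

variable {F F' : X₁ → ℝ}

theorem continuousOn_point (i : ι) (x : X₀) : ContinuousOn (A.point i x) (A.dom i x) := by
  intro v hv
  exact (A.contMDiffAt_point (J := 𝓘(ℝ, Fin k → ℝ)) (x := fun _ => x) (v := id)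
    contMDiffAt_const contMDiffAt_id hv).continuousAt.continuousWithinAt

theorem _root_.Continuous.fibreContinuous (hF : Continuous F) : A.FibreContinuous x F := fun i =>
  hF.comp_continuousOn (A.continuousOn_point i x)

variable {A}

theorem FibreContinuous.mul (hF : A.FibreContinuous x F) (hF' : A.FibreContinuous x F') :
    A.FibreContinuous x fun g => F g * F' g := fun i => (hF i).mul (hF' i)

theorem FibreContinuous.comp_op (hF : A.FibreContinuous (X.src h) F) :
    A.FibreContinuous (X.tgt h) fun g => F (X.op g h) := by
  intro i v hv
  obtain ⟨j, hj⟩ := A.exists_part_pos (X.op (A.point i (X.tgt h) v) h)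
  have hv' : v ∈ A.transDom i j h := ⟨hv, A.mem_source_of_part_ne_zero hj.ne'⟩
  have h1 : ContinuousAt (fun u => F (A.point j (X.src h) (A.trans i j h u))) v := by
    have h2 : ContinuousAt (fun u => F (A.point j (X.src h) u)) (A.trans i j h v) :=
      (hF j).continuousAt ((A.isOpen_dom j _).mem_nhds (by
        have := (A.trans_mem hv').1
        rwa [X.tgt_inv] at this))
    exact ContinuousAt.comp (g := fun u => F (A.point j (X.src h) u)) h2
      (A.differentiableAt_trans hv').continuousAt
  refine (h1.congr ?_).continuousWithinAt
  filter_upwards [(A.isOpen_transDom i j h).mem_nhds hv'] with u hu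
  rw [A.point_trans hu]

variable (A)

theorem integral_congr (hF : ∀ g, X.src g = x → F g = F' g) :
    A.integral c x F = A.integral c x F' :=
  finsum_congr fun i => setIntegral_congr_fun (A.isOpen_dom i x).measurableSet fun v hv => by
    simp only [hF _ (A.src_point hv)]

/-- Near a given object only finitely many charts contribute to the integrals. -/
theorem exists_finset_of_isCutoff (hc : X.IsCutoff c) (x : X₀) : ∃ s : Finset ι, ∀ᶠ y in 𝓝 x,
    ∀ g, X.src g = y → c (X.tgt g) ≠ 0 → ∀ i ∉ s, A.part i g = 0 := by
  obtain ⟨U, hU, K, hK, hUK⟩ := hc.isProper x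
  have hfin := A.part.locallyFinite.finite_nonempty_inter_compact hK
  refine ⟨hfin.toFinset, ?_⟩
  filter_upwards [hU] with y hy g hg hcg i hi
  by_contra hne
  exact hi (hfin.mem_toFinset.2 ⟨g, hne, hUK g (by rwa [hg]) hcg⟩)

theorem integral_eq_sum {s : Finset ι}
    (hs : ∀ g, X.src g = x → c (X.tgt g) ≠ 0 → ∀ i ∉ s, A.part i g = 0) :
    A.integral c x F = ∑ i ∈ s, ∫ v in A.dom i x,
      A.part i (A.point i x v) * A.density c i (A.point i x v) * F (A.point i x v) := by
  refine finsum_eq_sum_of_support_subset _ fun i hi => ?_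
  by_contra his
  refine hi ?_
  refine (setIntegral_congr_fun (A.isOpen_dom i x).measurableSet fun v hv => ?_).trans
    (integral_zero _ _)
  by_cases h0 : c (X.tgt (A.point i x v)) = 0
  · simp only [A.density_eq_zero h0, mul_zero, zero_mul]
  · simp only [hs _ (A.src_point hv) h0 i his, zero_mul]

section Proper

variable [T2Space X₀] (hc : X.IsCutoff c)

include hc

theorem integrableOn (hF : A.FibreContinuous x F) (i : ι) :
    IntegrableOn (fun v => A.part i (A.point i x v) * A.density c i (A.point i x v) *
      F (A.point i x v)) (A.dom i x) := by
  obtain ⟨U, hU, K, hK, hUK⟩ := hc.isProper x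
  let Z := K ∩ (tsupport (A.part i) ∩ X.src ⁻¹' {x})
  have hZ : IsCompact Z := hK.inter_right ((isClosed_tsupport _).inter
    (isClosed_singleton.preimage X.contMDiff_src.continuous))
  have hZi : Z ⊆ (A.chart i).source := fun g hg => A.subordinate i hg.2.1
  have hC : IsCompact (A.coord i '' Z) := hZ.image_of_continuousOn
    (continuous_snd.comp_continuousOn ((A.chart i).continuousOn.mono hZi))
  have hCd : A.coord i '' Z ⊆ A.dom i x := by
    rintro _ ⟨g, hg, rfl⟩
    have := A.coord_mem (hZi hg)
    rwa [show X.src g = x from hg.2.2] at this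
  have hcont : ContinuousOn (fun v => A.part i (A.point i x v) * A.density c i (A.point i x v) *
      F (A.point i x v)) (A.dom i x) := by
    refine ContinuousOn.mul (fun v hv => ?_) (hF i)
    have h1 := A.contMDiffAt_point (J := 𝓘(ℝ, Fin k → ℝ)) (x := fun _ => x) (v := id)
      contMDiffAt_const contMDiffAt_id hv
    exact ((A.contMDiffAt_part h1).mul (A.contMDiffAt_density hc.smooth h1
      (A.point_mem hv))).continuousAt.continuousWithinAt
  refine ((hcont.mono hCd).integrableOn_compact hC).of_forall_sdiff_eq_zero
    (A.isOpen_dom i x).measurableSet fun v hv => ?_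
  by_contra hne
  have h1 := A.src_point hv.1
  refine hv.2 ⟨A.point i x v, ⟨hUK _ (by rw [h1]; exact mem_of_mem_nhds hU) fun h0 => hne ?_,
    subset_tsupport _ fun h0 => hne ?_, h1⟩, A.coord_point hv.1⟩
  · rw [A.density_eq_zero h0, mul_zero, zero_mul]
  · rw [h0, zero_mul, zero_mul]

theorem integral_add (hF : A.FibreContinuous x F) (hF' : A.FibreContinuous x F') :
    A.integral c x (fun g => F g + F' g) = A.integral c x F + A.integral c x F' := by
  obtain ⟨s, hs⟩ := A.exists_finset_of_isCutoff hc x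
  have hs := hs.self_of_nhds
  rw [A.integral_eq_sum hs, A.integral_eq_sum hs, A.integral_eq_sum hs, ← Finset.sum_add_distrib]
  refine Finset.sum_congr rfl fun i _ => ?_
  rw [← MeasureTheory.integral_add (A.integrableOn hc hF i) (A.integrableOn hc hF' i)]
  simp only [mul_add]

omit hc [T2Space X₀] in
theorem integral_const_mul (a : ℝ) (F : X₁ → ℝ) :
    A.integral c x (fun g => a * F g) = a * A.integral c x F := by
  rw [integral, integral, mul_finsum]
  refine finsum_congr fun i => ?_
  rw [← MeasureTheory.integral_const_mul]
  simp only [mul_left_comm]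

theorem integral_pos (hF : A.FibreContinuous x F) (hpos : ∀ g, X.src g = x → 0 < F g) :
    0 < A.integral c x F := by
  obtain ⟨g, hgx, hcg⟩ := hc.exists_pos x
  obtain ⟨i, hi⟩ := A.exists_part_pos g
  obtain ⟨s, hs⟩ := A.exists_finset_of_isCutoff hc x
  have hs := hs.self_of_nhds
  have his : i ∈ s := by
    by_contra h0
    exact hi.ne' (hs g hgx hcg.ne' i h0)
  have hnn : ∀ j, ∀ v ∈ A.dom j x, 0 ≤ A.part j (A.point j x v) *
      A.density c j (A.point j x v) * F (A.point j x v) := fun j v hv =>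
    mul_nonneg (mul_nonneg (A.part.nonneg j _) (A.density_nonneg hc.nonneg))
      (hpos _ (A.src_point hv)).le
  rw [A.integral_eq_sum hs]
  refine Finset.sum_pos' (fun j _ => setIntegral_nonneg (A.isOpen_dom j x).measurableSet (hnn j))
    ⟨i, his, ?_⟩
  rw [setIntegral_pos_iff_support_of_nonneg_ae ((ae_restrict_iff'
    (A.isOpen_dom i x).measurableSet).2 (Eventually.of_forall (hnn i))) (A.integrableOn hc hF i)]
  have hgi := A.mem_source_of_part_ne_zero hi.ne'
  have hvd : A.coord i g ∈ A.dom i x := hgx ▸ A.coord_mem hgi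
  have hpg : A.point i x (A.coord i g) = g := by rw [← hgx, A.point_coord hgi]
  have hcont := (A.continuousOn_point i x).continuousAt ((A.isOpen_dom i x).mem_nhds hvd)
  have h1 : ∀ᶠ v in 𝓝 (A.coord i g), 0 < A.part i (A.point i x v) :=
    ((A.part i).contMDiff.continuous.continuousAt.comp hcont).eventually_const_lt (by simpa [hpg] using hi)
  have h2 : ∀ᶠ v in 𝓝 (A.coord i g), 0 < c (X.tgt (A.point i x v)) :=
    ((hc.smooth.continuous.comp X.contMDiff_tgt.continuous).continuousAt.comp
      hcont).eventually_const_lt (by simpa [hpg] using hcg)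
  refine Measure.measure_pos_of_mem_nhds _ (x := A.coord i g) ?_
  filter_upwards [h1, h2, (A.isOpen_dom i x).mem_nhds hvd] with v h1 h2 h3
  exact ⟨(mul_pos (mul_pos h1 (A.density_pos h2 (A.point_mem h3)))
    (hpos _ (A.src_point h3))).ne', h3⟩

/-- The integral, decomposed by a second family of weights with sum one. -/
theorem integral_eq_sum_sum {s : Finset ι}
    (hs : ∀ g, X.src g = x → c (X.tgt g) ≠ 0 → ∀ i ∉ s, A.part i g = 0) {u : ι → X₁ → ℝ}
    (hu : ∀ g, X.src g = x → c (X.tgt g) ≠ 0 → ∑ j ∈ s, u j g = 1)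
    (huc : ∀ j, A.FibreContinuous x (u j)) (hF : A.FibreContinuous x F) :
    A.integral c x F = ∑ i ∈ s, ∑ j ∈ s, ∫ v in A.dom i x,
      A.part i (A.point i x v) * A.density c i (A.point i x v) *
        (u j (A.point i x v) * F (A.point i x v)) := by
  rw [A.integral_eq_sum hs]
  refine Finset.sum_congr rfl fun i _ => ?_
  rw [← integral_finsetSum _ fun j _ => A.integrableOn hc ((huc j).mul hF) i]
  refine setIntegral_congr_fun (A.isOpen_dom i x).measurableSet fun v hv => ?_
  by_cases h0 : c (X.tgt (A.point i x v)) = 0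
  · simp only [A.density_eq_zero h0, mul_zero, zero_mul, Finset.sum_const_zero]
  · simp only [← Finset.mul_sum, ← Finset.sum_mul, hu _ (A.src_point hv) h0, one_mul]

omit hc [T2Space X₀] in
/-- The change of variables for the right translation by `h` in a pair of charts. -/
theorem setIntegral_part_mul_part :
    ∫ v in A.dom i (X.tgt h), A.part i (A.point i (X.tgt h) v) *
        A.density c i (A.point i (X.tgt h) v) *
        (A.part j (X.op (A.point i (X.tgt h) v) h) * F (X.op (A.point i (X.tgt h) v) h)) =
      ∫ v in A.dom j (X.src h), A.part j (A.point j (X.src h) v) *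
        A.density c j (A.point j (X.src h) v) *
        (A.part i (X.op (A.point j (X.src h) v) (X.inv h)) * F (A.point j (X.src h) v)) := by
  have hsub : A.transDom j i (X.inv h) ⊆ A.dom j (X.src h) := fun v hv => by
    have := hv.1
    rwa [X.tgt_inv] at this
  rw [setIntegral_eq_of_subset_of_forall_sdiff_eq_zero (A.isOpen_dom i (X.tgt h)).measurableSet
      (A.transDom_subset (j := j)),
    setIntegral_eq_of_subset_of_forall_sdiff_eq_zero (A.isOpen_dom j (X.src h)).measurableSet
      hsub, ← A.image_transDom,
    integral_image_eq_integral_abs_det_fderiv_smul volume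
      (A.isOpen_transDom i j h).measurableSet
      (fun v hv => (A.differentiableAt_trans hv).hasFDerivAt.hasFDerivWithinAt) A.injOn_trans]
  · refine setIntegral_congr_fun (A.isOpen_transDom i j h).measurableSet fun v hv => ?_
    have h1 := A.src_point hv.1
    have h2 := A.density_eq_mul_jac (c := c) (A.point_mem hv.1) h1 hv.2
    rw [A.coord_point hv.1] at h2
    simp only [A.point_trans hv, X.op_inv_cancel_right h1, h2, jac, smul_eq_mul]
    ring
  · intro v hv
    have : A.part i (X.op (A.point j (X.src h) v) (X.inv h)) = 0 := by
      by_contra h0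
      refine hv.2 ⟨by rw [X.tgt_inv]; exact hv.1, ?_⟩
      rw [X.tgt_inv]
      exact A.mem_source_of_part_ne_zero h0
    rw [this, zero_mul, mul_zero]
  · intro v hv
    have : A.part j (X.op (A.point i (X.tgt h) v) h) = 0 := by
      by_contra h0
      exact hv.2 ⟨hv.1, A.mem_source_of_part_ne_zero h0⟩
    rw [this, zero_mul, mul_zero]

/-- The invariance of the integral under right translations. -/
theorem integral_comp_op (hF : A.FibreContinuous (X.src h) F) :
    A.integral c (X.tgt h) (fun g => F (X.op g h)) = A.integral c (X.src h) F := by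
  classical
  obtain ⟨s₁, hs₁⟩ := A.exists_finset_of_isCutoff hc (X.tgt h)
  obtain ⟨s₂, hs₂⟩ := A.exists_finset_of_isCutoff hc (X.src h)
  have hs₁ : ∀ g, X.src g = X.tgt h → c (X.tgt g) ≠ 0 → ∀ i ∉ s₁ ∪ s₂, A.part i g = 0 :=
    fun g hg hcg i hi => hs₁.self_of_nhds g hg hcg i fun h1 => hi (Finset.mem_union_left _ h1)
  have hs₂ : ∀ g, X.src g = X.src h → c (X.tgt g) ≠ 0 → ∀ i ∉ s₁ ∪ s₂, A.part i g = 0 :=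
    fun g hg hcg i hi => hs₂.self_of_nhds g hg hcg i fun h1 => hi (Finset.mem_union_right _ h1)
  have hsum : ∀ g, (∀ i ∉ s₁ ∪ s₂, A.part i g = 0) → ∑ i ∈ s₁ ∪ s₂, A.part i g = 1 := by
    intro g hg
    rw [← A.sum_part_eq_one g]
    exact (finsum_eq_sum_of_support_subset _ fun i hi => by
      by_contra hi'
      exact hi (hg i hi')).symm
  have hpc : ∀ (y : X₀) (j : ι), A.FibreContinuous y (A.part j) := fun y j =>
    (A.part j).contMDiff.continuous.fibreContinuous A
  -- the charts `i` before and `j` after the translation play symmetric roles in the double sums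
  rw [A.integral_eq_sum_sum hc hs₁ (u := fun j g => A.part j (X.op g h))
      (fun g hg hcg => hsum _ (hs₂ _ (X.src_op hg) (by rwa [X.tgt_op hg])))
      (fun j => (hpc _ j).comp_op) hF.comp_op,
    A.integral_eq_sum_sum hc hs₂ (u := fun j g => A.part j (X.op g (X.inv h)))
      (fun g hg hcg => by
        have hg' : X.src g = X.tgt (X.inv h) := by rw [X.tgt_inv, hg]
        exact hsum _ (hs₁ _ (by rw [X.src_op hg', X.src_inv]) (by rwa [X.tgt_op hg'])))
      (fun j => by
        have := (hpc (X.src (X.inv h)) j).comp_op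
        rwa [X.tgt_inv] at this) hF, Finset.sum_comm]
  exact Finset.sum_congr rfl fun j _ => Finset.sum_congr rfl fun i _ =>
    A.setIntegral_part_mul_part

/-- The integral over the source fibres is smooth in parameters. -/
theorem contMDiffAt_integral [FiniteDimensional ℝ E₀] {EN N : Type*} [NormedAddCommGroup EN]
    [NormedSpace ℝ EN] [FiniteDimensional ℝ EN] [TopologicalSpace N] [ChartedSpace EN N]
    [IsManifold 𝓘(ℝ, EN) ∞ N] {f : N → X₀} {F : N → X₁ → ℝ} {n₀ : N}
    (hf : ContMDiff 𝓘(ℝ, EN) 𝓘(ℝ, E₀) ∞ f)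
    (hF : ∀ᶠ n in 𝓝 n₀, ∀ i, ∀ v ∈ A.dom i (f n),
      ContMDiffAt ((𝓘(ℝ, Fin k → ℝ)).prod 𝓘(ℝ, EN)) 𝓘(ℝ, ℝ) ∞
        (fun p : (Fin k → ℝ) × N => F p.2 (A.point i (f p.2) p.1)) (v, n)) :
    ContMDiffAt 𝓘(ℝ, EN) 𝓘(ℝ, ℝ) ∞ (fun n => A.integral c (f n) (F n)) n₀ := by
  have : LocallyCompactSpace X₀ := ChartedSpace.locallyCompactSpace E₀ X₀
  obtain ⟨s, hs⟩ := A.exists_finset_of_isCutoff hc (f n₀)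
  refine contMDiffAt_finsum_of_eventually s ((hf.continuous.continuousAt.eventually hs).mono
    fun n hn i hi => ?_) fun i => ?_
  · refine (setIntegral_congr_fun (A.isOpen_dom i _).measurableSet fun v hv => ?_).trans
      (integral_zero _ _)
    by_cases h0 : c (X.tgt (A.point i (f n) v)) = 0
    · simp only [A.density_eq_zero h0, mul_zero, zero_mul]
    · simp only [hn _ (A.src_point hv) h0 i hi, zero_mul]
  obtain ⟨U, hU, K, hK, hUK⟩ := hc.isProper (f n₀)
  obtain ⟨U', hU', hU'U, hU'c⟩ := local_compact_nhds hU
  -- on the fibres near the given one the integrands vanish outside of the compact set `Z`, which is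
  -- contained in the domain of the chart
  let Z := K ∩ (tsupport (A.part i) ∩ X.src ⁻¹' U')
  have hZ : IsCompact Z := hK.inter_right ((isClosed_tsupport _).inter
    (hU'c.isClosed.preimage X.contMDiff_src.continuous))
  have hZi : Z ⊆ (A.chart i).source := fun g hg => A.subordinate i hg.2.1
  have hZ' : IsCompact (A.chart i '' Z) :=
    hZ.image_of_continuousOn ((A.chart i).continuousOn.mono hZi)
  have hC : IsCompact (A.coord i '' Z) := hZ.image_of_continuousOn
    (continuous_snd.comp_continuousOn ((A.chart i).continuousOn.mono hZi))
  let φ : N → (Fin k → ℝ) → ℝ := fun n v => A.part i (A.point i (f n) v) *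
    A.density c i (A.point i (f n) v) * F n (A.point i (f n) v)
  have hφ : ∀ n v, f n ∈ U' → v ∈ A.dom i (f n) → φ n v ≠ 0 → A.point i (f n) v ∈ Z := by
    intro n v hn hv hne
    have h1 := A.src_point hv
    refine ⟨hUK _ (by rw [h1]; exact hU'U hn) fun h0 => hne ?_, subset_tsupport _ fun h0 => hne ?_,
      by simpa only [mem_preimage, h1] using hn⟩
    · simp only [φ, A.density_eq_zero h0, mul_zero, zero_mul]
    · simp only [φ, h0, zero_mul]
  -- extended by zero, the integrand is smooth at all points over a neighbourhood of `n₀`, and the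
  -- domain of integration no longer depends on the parameter
  let G : (Fin k → ℝ) → N → ℝ := fun v n => (A.dom i (f n)).indicator (φ n) v
  have hG : ∀ n, f n ∈ U' → ∫ v in A.dom i (f n), φ n v = ∫ v in A.coord i '' Z, G v n := by
    intro n hn
    rw [← integral_indicator (A.isOpen_dom i (f n)).measurableSet,
      setIntegral_eq_integral_of_forall_compl_eq_zero fun v hv => ?_]
    by_contra hne
    have hvd : v ∈ A.dom i (f n) := mem_of_indicator_ne_zero hne
    exact hv ⟨_, hφ n v hn hvd (by simpa [G, indicator_of_mem hvd] using hne), A.coord_point hvd⟩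
  have hUn : ∀ᶠ n in 𝓝 n₀, f n ∈ U' := hf.continuous.continuousAt.eventually hU'
  refine ContMDiffAt.congr_of_eventuallyEq ?_ (hUn.mono fun n hn => hG n hn)
  refine contMDiffAt_setIntegral (J := 𝓘(ℝ, Fin k → ℝ)) hC hC.isClosed.measurableSet
    (W := {n | (∀ᶠ m in 𝓝 n, f m ∈ U') ∧ ∀ i, ∀ v ∈ A.dom i (f n),
      ContMDiffAt ((𝓘(ℝ, Fin k → ℝ)).prod 𝓘(ℝ, EN)) 𝓘(ℝ, ℝ) ∞
        (fun p : (Fin k → ℝ) × N => F p.2 (A.point i (f p.2) p.1)) (v, n)})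
    (hUn.eventually_nhds.and hF) fun v _ n hn => ?_
  have hf' : ContMDiffAt ((𝓘(ℝ, Fin k → ℝ)).prod 𝓘(ℝ, EN)) 𝓘(ℝ, E₀) ∞
      (fun p : (Fin k → ℝ) × N => f p.2) (v, n) := hf.contMDiffAt.comp _ contMDiffAt_snd
  by_cases hv : v ∈ A.dom i (f n)
  · have h1 := A.contMDiffAt_point hf' contMDiffAt_fst hv
    refine (((A.contMDiffAt_part (i := i) h1).mul (A.contMDiffAt_density hc.smooth h1
      (A.point_mem hv))).mul (hn.2 i v hv)).congr_of_eventuallyEq ?_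
    filter_upwards [A.eventually_mem_dom hf'.continuousAt
      (continuous_fst.continuousAt (x := (v, n))) hv] with p hp
    exact indicator_of_mem hp _
  · refine contMDiffAt_const (c := (0 : ℝ)) |>.congr_of_eventuallyEq ?_
    have h1 : (f n, v) ∉ A.chart i '' Z := by
      rintro ⟨g, hg, hgv⟩
      exact hv (show (f n, v) ∈ _ from hgv ▸ (A.chart i).map_source (hZi hg))
    filter_upwards [(hf'.continuousAt.prodMk
      (continuous_fst.continuousAt (x := (v, n)))).eventually
      (hZ'.isClosed.isOpen_compl.mem_nhds h1),
      (continuous_snd.continuousAt (x := (v, n))).eventually hn.1] with p h2 h3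
    by_contra hne
    have hvd : p.1 ∈ A.dom i (f p.2) := mem_of_indicator_ne_zero hne
    refine h2 ⟨_, hφ p.2 p.1 h3 hvd (by simpa [G, Function.uncurry, indicator_of_mem hvd] using hne),
      (A.chart i).right_inv hvd⟩

end Proper

end FibreAtlas

end LieGroupoid

/-! ### Push-forward of dual metrics along maps from products -/


namespace RiemMetric

section ProdDual

variable {E X E' X' E'' X'' V κ : Type*}
  [NormedAddCommGroup E] [NormedSpace ℝ E] [FiniteDimensional ℝ E]
  [TopologicalSpace X] [ChartedSpace E X] [IsManifold 𝓘(ℝ, E) ∞ X]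
  [NormedAddCommGroup E'] [NormedSpace ℝ E'] [FiniteDimensional ℝ E']
  [TopologicalSpace X'] [ChartedSpace E' X'] [IsManifold 𝓘(ℝ, E') ∞ X']
  [NormedAddCommGroup E''] [NormedSpace ℝ E''] [FiniteDimensional ℝ E'']
  [TopologicalSpace X''] [ChartedSpace E'' X''] [IsManifold 𝓘(ℝ, E'') ∞ X'']
  [NormedAddCommGroup V] [NormedSpace ℝ V] [FiniteDimensional ℝ V] [Fintype κ] [DecidableEq κ]

/-- The positive semidefinite form `(α, β) ↦ (ρ ⊕ τ ⊕ ⋯ ⊕ τ)*(α ∘ dΦ, β ∘ dΦ)` on the covectors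
at `Φ y w`, for a map `Φ` from the product of `X` and `Vᵏ`, as the sum of the contributions of the
factors. -/
noncomputable def prodDual (ρ : RiemMetric E X) (τ : RiemMetric V V) (Φ : X → (κ → V) → X')
    (y : X) (w : κ → V) (α β : E' →L[ℝ] ℝ) : ℝ :=
  ρ.pushDual (fun y' => Φ y' w) y α β +
    ∑ a, τ.pushDual (fun u => Φ y (Function.update w a u)) (w a) α β

variable (ρ : RiemMetric E X) (τ : RiemMetric V V) {Φ Φ' : X → (κ → V) → X'} {y : X} {w : κ → V}

section

variable (α α' β : E' →L[ℝ] ℝ)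

theorem prodDual_symm : ρ.prodDual τ Φ y w α β = ρ.prodDual τ Φ y w β α := by
  rw [prodDual, prodDual, ρ.pushDual_symm α β]
  congr 1
  exact Finset.sum_congr rfl fun a _ => τ.pushDual_symm α β

theorem prodDual_add_left : ρ.prodDual τ Φ y w (α + α') β =
    ρ.prodDual τ Φ y w α β + ρ.prodDual τ Φ y w α' β := by
  simp only [prodDual, pushDual_add_left, Finset.sum_add_distrib]
  ring

theorem prodDual_smul_left (c : ℝ) :
    ρ.prodDual τ Φ y w (c • α) β = c * ρ.prodDual τ Φ y w α β := by
  simp only [prodDual, pushDual_smul_left, ← Finset.mul_sum, mul_add]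

theorem prodDual_nonneg : 0 ≤ ρ.prodDual τ Φ y w α α :=
  add_nonneg (ρ.pushDual_nonneg α) (Finset.sum_nonneg fun _ _ => τ.pushDual_nonneg α)

theorem prodDual_congr (h : Function.uncurry Φ =ᶠ[𝓝 (y, w)] Function.uncurry Φ') :
    ρ.prodDual τ Φ y w α β = ρ.prodDual τ Φ' y w α β := by
  rw [prodDual, prodDual]
  congr 1
  · refine ρ.pushDual_congr α β ?_
    exact (show ContinuousAt (fun y' => (y', w)) y by fun_prop).eventually h
  · refine Finset.sum_congr rfl fun a _ => τ.pushDual_congr α β ?_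
    have h1 : ContinuousAt (fun u => (y, Function.update w a u)) (w a) := by fun_prop
    have h2 : (y, Function.update w a (w a)) = (y, w) := by rw [Function.update_eq_self]
    rw [← h2] at h
    exact h1.eventually h

/-- The invariance of the form under permutations of the equal factors. -/
theorem prodDual_comp_perm (σ : Equiv.Perm κ) :
    ρ.prodDual τ Φ y (w ∘ σ) α β = ρ.prodDual τ (fun y w => Φ y (w ∘ σ)) y w α β := by
  rw [prodDual, prodDual]
  congr 1
  refine (Equiv.sum_comp σ.symm _).symm.trans (Finset.sum_congr rfl fun a _ => ?_)
  simp only [Function.update_comp_equiv, Function.comp_apply, Equiv.apply_symm_apply]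

end

theorem _root_.MDifferentiableAt.partial_left
    (h : MDifferentiableAt (𝓘(ℝ, E).prod 𝓘(ℝ, κ → V)) 𝓘(ℝ, E') (Function.uncurry Φ) (y, w)) :
    MDifferentiableAt 𝓘(ℝ, E) 𝓘(ℝ, E') (fun y' => Φ y' w) y :=
  MDifferentiableAt.comp (g := Function.uncurry Φ) (f := fun y' => (y', w)) y h
    (mdifferentiableAt_id.prodMk mdifferentiableAt_const)

theorem _root_.MDifferentiableAt.partial_right
    (h : MDifferentiableAt (𝓘(ℝ, E).prod 𝓘(ℝ, κ → V)) 𝓘(ℝ, E') (Function.uncurry Φ) (y, w)) :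
    MDifferentiableAt 𝓘(ℝ, κ → V) 𝓘(ℝ, E') (Φ y) w :=
  MDifferentiableAt.comp (g := Function.uncurry Φ) (f := fun w' => (y, w')) w h
    (mdifferentiableAt_const.prodMk mdifferentiableAt_id)

theorem hasMFDerivAt_update (a : κ)
    (h : MDifferentiableAt (𝓘(ℝ, E).prod 𝓘(ℝ, κ → V)) 𝓘(ℝ, E') (Function.uncurry Φ) (y, w)) :
    HasMFDerivAt 𝓘(ℝ, V) 𝓘(ℝ, E') (fun u => Φ y (Function.update w a u)) (w a)
      ((modelD (Φ y) w : (κ → V) →L[ℝ] E') ∘L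
        (ContinuousLinearMap.pi (Pi.single a (ContinuousLinearMap.id ℝ V)) :
          V →L[ℝ] (κ → V))) := by
  have h1 : ∀ w', w' = w → HasMFDerivAt 𝓘(ℝ, κ → V) 𝓘(ℝ, E') (Φ y) w'
      (modelD (Φ y) w : (κ → V) →L[ℝ] E') := by
    rintro _ rfl
    exact h.partial_right.hasMFDerivAt
  exact HasMFDerivAt.comp (w a) (h1 _ (Function.update_eq_self a w))
    (hasFDerivAt_update w (w a)).hasMFDerivAt

/-- A covector on which the form vanishes is zero on the image of the differential of `Φ`. -/
theorem apply_mfderiv_eq_zero_of_prodDual {α : E' →L[ℝ] ℝ}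
    (h : MDifferentiableAt (𝓘(ℝ, E).prod 𝓘(ℝ, κ → V)) 𝓘(ℝ, E') (Function.uncurry Φ) (y, w))
    (h0 : ρ.prodDual τ Φ y w α α = 0) (v : E × (κ → V)) :
    α ((mfderiv (𝓘(ℝ, E).prod 𝓘(ℝ, κ → V)) 𝓘(ℝ, E') (Function.uncurry Φ) (y, w) :
      E × (κ → V) →L[ℝ] E') v) = 0 := by
  have h1 : 0 ≤ ρ.pushDual (fun y' => Φ y' w) y α α := ρ.pushDual_nonneg α
  have h2 : ∀ a ∈ Finset.univ,
      0 ≤ τ.pushDual (fun u => Φ y (Function.update w a u)) (w a) α α :=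
    fun _ _ => τ.pushDual_nonneg α
  rw [prodDual, add_eq_zero_iff_of_nonneg h1 (Finset.sum_nonneg h2),
    Finset.sum_eq_zero_iff_of_nonneg h2] at h0
  have h3 : ∀ u : κ → V, α ((modelD (Φ y) w : (κ → V) →L[ℝ] E') u) = 0 := by
    intro u
    rw [← Finset.univ_sum_single u, map_sum, map_sum]
    refine Finset.sum_eq_zero fun a _ => ?_
    have h4 := τ.apply_modelD_eq_zero_of_pushDual (h0.2 a (Finset.mem_univ a)) (u a)
    have h5 : (modelD (fun u => Φ y (Function.update w a u)) (w a) : V →L[ℝ] E') = _ :=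
      (hasMFDerivAt_update a h).mfderiv
    rw [h5] at h4
    convert h4 using 2
    refine congrArg (modelD (Φ y) w : (κ → V) →L[ℝ] E') (funext fun b => ?_)
    change (Pi.single a (u a) : κ → V) b =
      (Pi.single a (ContinuousLinearMap.id ℝ V) : κ → V →L[ℝ] V) b (u a)
    rcases eq_or_ne b a with rfl | hb
    · rw [Pi.single_eq_same, Pi.single_eq_same, ContinuousLinearMap.id_apply]
    · rw [Pi.single_eq_of_ne hb, Pi.single_eq_of_ne hb, zero_apply]
  have h6 : (mfderiv (𝓘(ℝ, E).prod 𝓘(ℝ, κ → V)) 𝓘(ℝ, E') (Function.uncurry Φ) (y, w) :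
      E × (κ → V) →L[ℝ] E') v = (modelD (fun y' => Φ y' w) y : E →L[ℝ] E') v.1 +
        (modelD (Φ y) w : (κ → V) →L[ℝ] E') v.2 := mfderiv_prod_eq_add_apply h
  rw [h6, map_add, h3, add_zero]
  exact ρ.apply_modelD_eq_zero_of_pushDual h0.1 v.1

theorem prodDual_comp {G : X' → X''} (hG : MDifferentiable 𝓘(ℝ, E') 𝓘(ℝ, E'') G)
    (h : MDifferentiableAt (𝓘(ℝ, E).prod 𝓘(ℝ, κ → V)) 𝓘(ℝ, E') (Function.uncurry Φ) (y, w))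
    (α β : E'' →L[ℝ] ℝ) :
    ρ.prodDual τ (fun y w => G (Φ y w)) y w α β =
      ρ.prodDual τ Φ y w (α ∘L (modelD G (Φ y w) : E' →L[ℝ] E''))
        (β ∘L (modelD G (Φ y w) : E' →L[ℝ] E'')) := by
  rw [prodDual, prodDual]
  congr 1
  · exact ρ.pushDual_comp (hG _) h.partial_left α β
  · refine Finset.sum_congr rfl fun a _ => ?_
    have h1 := τ.pushDual_comp (F := fun u => Φ y (Function.update w a u)) (hG _)
      (hasMFDerivAt_update a h).mdifferentiableAt α β
    simpa only [Function.update_eq_self] using h1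

theorem contMDiffAt_prodDual {EN HN N : Type*} [NormedAddCommGroup EN] [NormedSpace ℝ EN]
    [TopologicalSpace HN] {J : ModelWithCorners ℝ EN HN} [TopologicalSpace N] [ChartedSpace HN N]
    [IsManifold J ∞ N] {y : N → X} {w : N → κ → V} {h : N → X'} {n₀ : N} {y₀ : X'}
    (hy : ContMDiffAt J 𝓘(ℝ, E) ∞ y n₀) (hw : ContMDiffAt J 𝓘(ℝ, κ → V) ∞ w n₀)
    (hΦ : ContMDiffAt (𝓘(ℝ, E).prod 𝓘(ℝ, κ → V)) 𝓘(ℝ, E') ∞ (Function.uncurry Φ)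
      (y n₀, w n₀))
    (hh : ∀ᶠ n in 𝓝 n₀, Φ (y n) (w n) = h n) (hy₀ : h n₀ ∈ (chartAt E' y₀).source)
    (ξ ζ : E' →L[ℝ] ℝ) :
    ContMDiffAt J 𝓘(ℝ, ℝ) ∞ (fun n => ρ.prodDual τ Φ (y n) (w n)
      (ξ ∘L modelChartD y₀ (h n)) (ζ ∘L modelChartD y₀ (h n))) n₀ := by
  have hwa : ∀ a, ContMDiffAt J 𝓘(ℝ, V) ∞ (fun n => w n a) n₀ := contMDiffAt_pi_space.1 hw
  refine ContMDiffAt.add ?_ (contMDiffAt_finsetSum fun a _ => ?_)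
  · refine ρ.contMDiffAt_pushDual (F := fun n y' => Φ y' (w n)) hy ?_ hh hy₀ ξ ζ
    exact ContMDiffAt.comp (g := Function.uncurry Φ) (f := fun p : N × X => (p.2, w p.1)) _ hΦ
      (contMDiffAt_snd.prodMk (hw.comp (n₀, y n₀) contMDiffAt_fst))
  · refine τ.contMDiffAt_pushDual (F := fun n u => Φ (y n) (Function.update (w n) a u)) (hwa a)
      ?_ (hh.mono fun n hn => by rwa [Function.update_eq_self]) hy₀ ξ ζ
    have h1 : ContMDiffAt (J.prod 𝓘(ℝ, V)) 𝓘(ℝ, κ → V) ∞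
        (fun p : N × V => Function.update (w p.1) a p.2) (n₀, w n₀ a) := by
      refine contMDiffAt_pi_space.2 fun b => ?_
      rcases eq_or_ne b a with rfl | hb
      · simpa using contMDiffAt_snd
      · simpa [Function.update_of_ne hb, Function.comp_def] using
          (hwa b).comp (n₀, w n₀ a) contMDiffAt_fst
    have h2 : (y n₀, Function.update (w n₀) a (w n₀ a)) = (y n₀, w n₀) := by
      rw [Function.update_eq_self]
    rw [← h2] at hΦ
    exact ContMDiffAt.comp (g := Function.uncurry Φ)
      (f := fun p : N × V => (y p.1, Function.update (w p.1) a p.2)) (n₀, w n₀ a) hΦ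
      ((hy.comp (n₀, w n₀ a) contMDiffAt_fst).prodMk h1)

end ProdDual

end RiemMetric

/-! ### Forms on the covectors of triangles with given legs -/


namespace LieGroupoid

namespace FibreAtlas

variable {E₀ E₁ E₂ X₀ X₁ X₂ : Type*}
  [NormedAddCommGroup E₀] [NormedSpace ℝ E₀] [TopologicalSpace X₀] [ChartedSpace E₀ X₀]
  [NormedAddCommGroup E₁] [NormedSpace ℝ E₁] [TopologicalSpace X₁] [ChartedSpace E₁ X₁]
  [NormedAddCommGroup E₂] [NormedSpace ℝ E₂] [TopologicalSpace X₂] [ChartedSpace E₂ X₂]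
  [FiniteDimensional ℝ E₁] [IsManifold 𝓘(ℝ, E₀) ∞ X₀] [IsManifold 𝓘(ℝ, E₁) ∞ X₁]
  [IsManifold 𝓘(ℝ, E₂) ∞ X₂]
  {X : LieGroupoid E₀ E₁ E₂ X₀ X₁ X₂} {k : ℕ} {ι : Type*}
  (A : FibreAtlas X k ι) {i : Fin 3 → ι} {x : X₀} {w : Fin 3 → Fin k → ℝ} {p q : Fin 3 → X₁}

/-- The commutative triangle with legs starting at `y` and having the coordinates `w 0`, `w 1`,
`w 2` in the charts `i 0`, `i 1`, `i 2`. -/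
noncomputable def triangle (i : Fin 3 → ι) (y : X₀) (w : Fin 3 → Fin k → ℝ) : X₂ :=
  X.tri fun a => A.point (i a) y (w a)

theorem triangle_coord (hp : ∀ a, X.src (p a) = x) (hi : ∀ a, p a ∈ (A.chart (i a)).source) :
    A.triangle i x (fun a => A.coord (i a) (p a)) = X.tri p := by
  rw [triangle]
  congr 1
  funext a
  rw [← hp a, A.point_coord (hi a)]

theorem coord_mem_dom (hp : ∀ a, X.src (p a) = x) (hi : ∀ a, p a ∈ (A.chart (i a)).source)
    (a : Fin 3) : A.coord (i a) (p a) ∈ A.dom (i a) x := by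
  rw [← hp a]
  exact A.coord_mem (hi a)

theorem contMDiffAt_triangle {EN HN N : Type*} [NormedAddCommGroup EN] [NormedSpace ℝ EN]
    [TopologicalSpace HN] {J : ModelWithCorners ℝ EN HN} [TopologicalSpace N] [ChartedSpace HN N]
    {y : N → X₀} {w : N → Fin 3 → Fin k → ℝ} {n : N}
    (hy : ContMDiffAt J 𝓘(ℝ, E₀) ∞ y n)
    (hw : ∀ a, ContMDiffAt J 𝓘(ℝ, Fin k → ℝ) ∞ (fun m => w m a) n)
    (h : ∀ a, w n a ∈ A.dom (i a) (y n)) :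
    ContMDiffAt J 𝓘(ℝ, E₂) ∞ (fun m => A.triangle i (y m) (w m)) n :=
  X.contMDiffAt_tri (x := y) (fun a => A.contMDiffAt_point hy (hw a) (h a))
    (eventually_all.2 fun a =>
      (A.eventually_mem_dom hy.continuousAt (hw a).continuousAt (h a)).mono
        fun _ hm => A.src_point hm)

theorem contMDiffAt_uncurry_triangle (h : ∀ a, w a ∈ A.dom (i a) x) :
    ContMDiffAt (𝓘(ℝ, E₀).prod 𝓘(ℝ, Fin 3 → Fin k → ℝ)) 𝓘(ℝ, E₂) ∞
      (Function.uncurry (A.triangle i)) (x, w) :=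
  A.contMDiffAt_triangle (y := Prod.fst) (w := Prod.snd) contMDiffAt_fst
    (contMDiffAt_pi_space.1 contMDiffAt_snd) h

theorem eventually_forall_mem_dom (h : ∀ a, w a ∈ A.dom (i a) x) :
    ∀ᶠ q : X₀ × (Fin 3 → Fin k → ℝ) in 𝓝 (x, w), ∀ a, q.2 a ∈ A.dom (i a) q.1 :=
  eventually_all.2 fun a => A.eventually_mem_dom continuous_fst.continuousAt
    (by fun_prop : Continuous fun q : X₀ × (Fin 3 → Fin k → ℝ) => q.2 a).continuousAt (h a)

theorem permute_triangle (σ : Equiv.Perm (Fin 3)) (h : ∀ a, w a ∈ A.dom (i a) x) :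
    A.triangle (i ∘ σ) x (w ∘ σ) = X.permute σ (A.triangle i x w) :=
  (X.permute_tri (fun a => A.src_point (h a)) σ).symm

theorem mul_triangle (h : ∀ a, w a ∈ A.dom (i a) x) : X.mul (A.triangle i x w) =
    X.op (A.point (i 2) x (w 2)) (X.inv (A.point (i 0) x (w 0))) :=
  X.mul_tri fun a => A.src_point (h a)

variable [FiniteDimensional ℝ E₀] [FiniteDimensional ℝ E₂] (ρ : RiemMetric E₀ X₀)
  (τ : RiemMetric (Fin k → ℝ) (Fin k → ℝ))

/-- A positive definite form on the covectors at the triangle with the legs `p 0`, `p 1`, `p 2`,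
which depends on the legs and not only on the triangle: the legs are moved in all possible ways,
in the coordinates of the fibre charts, and the results for the different charts are averaged by
means of the partition of unity. -/
noncomputable def legForm (p : Fin 3 → X₁) (α β : E₂ →L[ℝ] ℝ) : ℝ :=
  ∑ᶠ i : Fin 3 → ι, (∏ a, A.part (i a) (p a)) *
    ρ.prodDual τ (A.triangle i) (X.src (p 0)) (fun a => A.coord (i a) (p a)) α β

theorem mem_source_of_prod_part_ne_zero (h : ∏ a, A.part (i a) (p a) ≠ 0) (a : Fin 3) :
    p a ∈ (A.chart (i a)).source :=
  A.mem_source_of_part_ne_zero (Finset.prod_ne_zero_iff.1 h a (Finset.mem_univ a))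

theorem finite_support_prod_part (p : Fin 3 → X₁) :
    (Function.support fun i : Fin 3 → ι => ∏ a, A.part (i a) (p a)).Finite := by
  refine (Finite.pi fun a => A.part.locallyFinite.point_finite (p a)).subset fun i hi a _ => ?_
  exact Finset.prod_ne_zero_iff.1 hi a (Finset.mem_univ a)

theorem finite_support_mul (p : Fin 3 → X₁) (u : (Fin 3 → ι) → ℝ) :
    (Function.support fun i : Fin 3 → ι => (∏ a, A.part (i a) (p a)) * u i).Finite :=
  (A.finite_support_prod_part p).subset fun i hi h0 => hi (by
    simp only [show ∏ a, A.part (i a) (p a) = 0 from h0, zero_mul])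

section

variable (α α' β : E₂ →L[ℝ] ℝ)

theorem legForm_symm : A.legForm ρ τ p α β = A.legForm ρ τ p β α :=
  finsum_congr fun i => by rw [ρ.prodDual_symm τ α β]

theorem legForm_add_left : A.legForm ρ τ p (α + α') β =
    A.legForm ρ τ p α β + A.legForm ρ τ p α' β := by
  rw [legForm, legForm, legForm,
    ← finsum_add_distrib (A.finite_support_mul p _) (A.finite_support_mul p _)]
  exact finsum_congr fun i => by rw [ρ.prodDual_add_left, mul_add]

theorem legForm_smul_left (c : ℝ) :
    A.legForm ρ τ p (c • α) β = c * A.legForm ρ τ p α β := by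
  rw [legForm, legForm, mul_finsum]
  exact finsum_congr fun i => by rw [ρ.prodDual_smul_left, mul_left_comm]

end

/-- Triangles near a given one are obtained from it by moving its legs. -/
theorem exists_section_triangle (hp : ∀ a, X.src (p a) = x)
    (hi : ∀ a, p a ∈ (A.chart (i a)).source) :
    ∃ s : X₂ → X₀ × (Fin 3 → Fin k → ℝ),
      ContMDiffAt 𝓘(ℝ, E₂) (𝓘(ℝ, E₀).prod 𝓘(ℝ, Fin 3 → Fin k → ℝ)) ∞ s (X.tri p) ∧
      s (X.tri p) = (x, fun a => A.coord (i a) (p a)) ∧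
      ∀ᶠ z in 𝓝 (X.tri p), Function.uncurry (A.triangle i) (s z) = z := by
  have hz : X.src (X.snd (X.tri p)) = X.tgt (p 0) := by
    rw [X.snd_tri hp, X.src_op (by rw [X.tgt_inv, hp, hp]), X.src_inv]
  obtain ⟨σ, hσ, hσp, hσ'⟩ := X.hasLocalSections_tgt (p 0)
  rw [← hz] at hσ hσp hσ'
  have hb : ContMDiff 𝓘(ℝ, E₂) 𝓘(ℝ, E₀) ∞ fun z => X.src (X.snd z) :=
    X.contMDiff_src.comp X.contMDiff_snd
  -- the common origin of the legs is moved along a local section of the target map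
  let g : X₂ → X₁ := fun z => σ (X.src (X.snd z))
  have hg : ContMDiffAt 𝓘(ℝ, E₂) 𝓘(ℝ, E₁) ∞ g (X.tri p) :=
    ContMDiffAt.comp (g := σ) (f := fun z => X.src (X.snd z)) _ hσ hb.contMDiffAt
  have hgz : ∀ᶠ z in 𝓝 (X.tri p), X.tgt (g z) = X.src (X.snd z) :=
    hb.continuous.continuousAt.eventually hσ'
  let r : X₂ → Fin 3 → X₁ := fun z a => X.op (X.leg z a) (g z)
  have hr : ∀ a, ContMDiffAt 𝓘(ℝ, E₂) 𝓘(ℝ, E₁) ∞ (fun z => r z a) (X.tri p) := fun a =>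
    X.contMDiffAt_op (X.contMDiff_leg a).contMDiffAt hg
      (hgz.mono fun z hz => (X.src_leg z a).trans hz.symm)
  have hrp : ∀ a, r (X.tri p) a = p a := fun a => by
    simp only [r, g]
    rw [hσp, X.leg_tri hp, X.inv_op_cancel_right ((hp a).trans (hp 0).symm)]
  have hra : ∀ a, r (X.tri p) a ∈ (A.chart (i a)).source := fun a => by rw [hrp]; exact hi a
  refine ⟨fun z => (X.src (g z), fun a => A.coord (i a) (r z a)), ?_, ?_, ?_⟩
  · exact (X.contMDiff_src.contMDiffAt.comp _ hg).prodMk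
      (contMDiffAt_pi_space.2 fun a => A.contMDiffAt_coord (hr a) (hra a))
  · simp only [hrp]
    simp only [g]
    rw [hσp, hp 0]
  · have h1 : ∀ᶠ z in 𝓝 (X.tri p), ∀ a, r z a ∈ (A.chart (i a)).source :=
      eventually_all.2 fun a =>
        (hr a).continuousAt.preimage_mem_nhds ((A.chart (i a)).open_source.mem_nhds (hra a))
    filter_upwards [h1, hgz] with z h1 h2
    have h3 : ∀ a, X.src (r z a) = X.src (g z) := fun a =>
      X.src_op ((X.src_leg z a).trans h2.symm)
    exact (A.triangle_coord h3 h1).trans ((X.tri_op (X.src_leg z) h2).trans (X.tri_leg z))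

theorem legForm_pos (hp : ∀ a, X.src (p a) = x) {α : E₂ →L[ℝ] ℝ} (hα : α ≠ 0) :
    0 < A.legForm ρ τ p α α := by
  choose i hi using fun a => A.exists_part_pos (p a)
  have hi' : 0 < ∏ a, A.part (i a) (p a) := Finset.prod_pos fun a _ => hi a
  have hs := A.mem_source_of_prod_part_ne_zero hi'.ne'
  have hnn : ∀ j : Fin 3 → ι, 0 ≤ (∏ a, A.part (j a) (p a)) *
      ρ.prodDual τ (A.triangle j) (X.src (p 0)) (fun a => A.coord (j a) (p a)) α α := fun j =>
    mul_nonneg (Finset.prod_nonneg fun a _ => A.part.nonneg _ _) (ρ.prodDual_nonneg τ α)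
  refine (mul_pos hi' ((ρ.prodDual_nonneg τ α).lt_of_ne' fun h0 => hα ?_)).trans_le
    (single_le_finsum i (A.finite_support_mul p _) hnn)
  rw [hp 0] at h0
  obtain ⟨s, hsm, hsp, hs'⟩ := A.exists_section_triangle hp hs
  have hd := (A.contMDiffAt_uncurry_triangle (A.coord_mem_dom hp hs)).mdifferentiableAt (by simp)
  have h1 := ρ.apply_mfderiv_eq_zero_of_prodDual τ hd h0
  have h2 : ∀ q, q = (x, fun a => A.coord (i a) (p a)) → HasMFDerivAt
      (𝓘(ℝ, E₀).prod 𝓘(ℝ, Fin 3 → Fin k → ℝ)) 𝓘(ℝ, E₂) (Function.uncurry (A.triangle i)) q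
      (mfderiv (𝓘(ℝ, E₀).prod 𝓘(ℝ, Fin 3 → Fin k → ℝ)) 𝓘(ℝ, E₂)
        (Function.uncurry (A.triangle i)) (x, fun a => A.coord (i a) (p a)) :
        E₀ × (Fin 3 → Fin k → ℝ) →L[ℝ] E₂) := by
    rintro _ rfl
    exact hd.hasMFDerivAt
  have h3 := HasMFDerivAt.comp (X.tri p) (h2 _ hsp)
    (hsm.mdifferentiableAt (by simp)).hasMFDerivAt
  have h4 := h3.congr_of_eventuallyEq (f₁ := id) (hs'.mono fun z hz => hz.symm)
  have h5 := hasMFDerivAt_unique h4 (hasMFDerivAt_id _)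
  ext v
  have h6 := h1 ((mfderiv 𝓘(ℝ, E₂) (𝓘(ℝ, E₀).prod 𝓘(ℝ, Fin 3 → Fin k → ℝ)) s (X.tri p) :
    E₂ →L[ℝ] E₀ × (Fin 3 → Fin k → ℝ)) v)
  refine Eq.trans ?_ h6
  exact congrArg α (DFunLike.congr_fun h5 v).symm

/-- The forms are compatible with the permutations of the vertices. -/
theorem legForm_comp_perm (hp : ∀ a, X.src (p a) = x) (σ : Equiv.Perm (Fin 3))
    (α β : E₂ →L[ℝ] ℝ) :
    A.legForm ρ τ (p ∘ σ) α β = A.legForm ρ τ p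
      (α ∘L (modelD (X.permute σ) (X.tri p) : E₂ →L[ℝ] E₂))
      (β ∘L (modelD (X.permute σ) (X.tri p) : E₂ →L[ℝ] E₂)) := by
  rw [legForm, legForm]
  refine (finsum_comp_equiv (σ.symm.arrowCongr (Equiv.refl ι))).symm.trans
    (finsum_congr fun i => ?_)
  have h1 : σ.symm.arrowCongr (Equiv.refl ι) i = i ∘ σ := rfl
  have h2 : ∏ a, A.part ((i ∘ σ) a) ((p ∘ σ) a) = ∏ a, A.part (i a) (p a) :=
    Equiv.prod_comp σ fun a => A.part (i a) (p a)
  rw [h1, h2]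
  rcases eq_or_ne (∏ a, A.part (i a) (p a)) 0 with h0 | h0
  · rw [h0, zero_mul, zero_mul]
  have hs := A.mem_source_of_prod_part_ne_zero h0
  have hd := A.coord_mem_dom hp hs
  congr 1
  rw [Function.comp_apply, hp, hp, ← A.triangle_coord hp hs]
  refine (ρ.prodDual_comp_perm τ (w := fun a => A.coord (i a) (p a)) α β σ).trans ?_
  rw [ρ.prodDual_congr τ (Φ := fun y w => A.triangle (i ∘ σ) y (w ∘ σ))
    (Φ' := fun y w => X.permute σ (A.triangle i y w)) α β
    ((A.eventually_forall_mem_dom hd).mono fun q hq => A.permute_triangle σ hq)]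
  exact ρ.prodDual_comp τ ((X.contMDiff_permute σ).mdifferentiable (by simp))
    ((A.contMDiffAt_uncurry_triangle hd).mdifferentiableAt (by simp)) α β

/-- The contribution of a pair of charts to the form which is induced by the composition. -/
noncomputable def outerForm (i j : ι) (x : X₀) (g h : X₁) (α β : E₁ →L[ℝ] ℝ) : ℝ :=
  ρ.pushDual (fun y => X.op (A.point j y (A.coord j h)) (X.inv (A.point i y (A.coord i g))))
      x α β +
    τ.pushDual (fun u => X.op (A.point j x (A.coord j h)) (X.inv (A.point i x u)))
      (A.coord i g) α β +
    τ.pushDual (fun u => X.op (A.point j x u) (X.inv (A.point i x (A.coord i g))))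
      (A.coord j h) α β

theorem legForm_comp_mul (hp : ∀ a, X.src (p a) = x) (α β : E₁ →L[ℝ] ℝ) :
    A.legForm ρ τ p (α ∘L (modelD X.mul (X.tri p) : E₂ →L[ℝ] E₁))
      (β ∘L (modelD X.mul (X.tri p) : E₂ →L[ℝ] E₁)) =
    ∑ᶠ i : Fin 3 → ι, (∏ a, A.part (i a) (p a)) *
      A.outerForm ρ τ (i 0) (i 2) x (p 0) (p 2) α β := by
  rw [legForm]
  refine finsum_congr fun i => ?_
  rcases eq_or_ne (∏ a, A.part (i a) (p a)) 0 with h0 | h0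
  · rw [h0, zero_mul, zero_mul]
  have hs := A.mem_source_of_prod_part_ne_zero h0
  have hd := A.coord_mem_dom hp hs
  congr 1
  rw [hp, ← A.triangle_coord hp hs,
    ← ρ.prodDual_comp τ (X.contMDiff_mul.mdifferentiable (by simp))
      ((A.contMDiffAt_uncurry_triangle hd).mdifferentiableAt (by simp)) α β,
    ρ.prodDual_congr τ (Φ := fun y w => X.mul (A.triangle i y w))
      (Φ' := fun y w => X.op (A.point (i 2) y (w 2)) (X.inv (A.point (i 0) y (w 0)))) α β
      ((A.eventually_forall_mem_dom hd).mono fun q hq => A.mul_triangle hq),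
    RiemMetric.prodDual, Fin.sum_univ_three]
  simp [outerForm, add_assoc, RiemMetric.pushDual_const]

omit [FiniteDimensional ℝ E₀] [FiniteDimensional ℝ E₂] in
theorem finsum_prod_part_congr (h0 : p 0 = q 0) (h2 : p 2 = q 2) (T : ι → ι → ℝ) :
    ∑ᶠ i : Fin 3 → ι, (∏ a, A.part (i a) (p a)) * T (i 0) (i 2) =
      ∑ᶠ i : Fin 3 → ι, (∏ a, A.part (i a) (q a)) * T (i 0) (i 2) := by
  classical
  have hfin : (⋃ a, Function.support (fun i => A.part i (p a)) ∪
      Function.support fun i => A.part i (q a)).Finite := finite_iUnion fun a =>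
    (A.part.locallyFinite.point_finite (p a)).union (A.part.locallyFinite.point_finite (q a))
  set s := hfin.toFinset with hs
  have hsp : ∀ a, ∀ i ∉ s, A.part i (p a) = 0 := fun a i hi => by
    by_contra h
    exact hi (hfin.mem_toFinset.2 (mem_iUnion.2 ⟨a, Or.inl h⟩))
  have hsq : ∀ a, ∀ i ∉ s, A.part i (q a) = 0 := fun a i hi => by
    by_contra h
    exact hi (hfin.mem_toFinset.2 (mem_iUnion.2 ⟨a, Or.inr h⟩))
  have h1 : ∀ r : Fin 3 → X₁, (∀ a, ∀ i ∉ s, A.part i (r a) = 0) →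
      ∑ᶠ i : Fin 3 → ι, (∏ a, A.part (i a) (r a)) * T (i 0) (i 2) =
        ∑ i ∈ Fintype.piFinset fun _ : Fin 3 => s,
          (∏ a, A.part (i a) (r a)) * T (i 0) (i 2) := by
    intro r hr
    refine finsum_eq_sum_of_support_subset _ fun i hi => ?_
    refine Finset.mem_coe.2 (Fintype.mem_piFinset.2 fun a => ?_)
    by_contra hia
    refine hi ?_
    have h4 : ∏ a, A.part (i a) (r a) = 0 := Finset.prod_eq_zero (Finset.mem_univ a) (hr a _ hia)
    simp only [h4, zero_mul]
  have h3 : ∀ g, (∀ i ∉ s, A.part i g = 0) → ∑ i ∈ s, A.part i g = 1 := fun g hg => by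
    rw [← A.sum_part_eq_one g]
    exact (finsum_eq_sum_of_support_subset _ fun i hi => by
      by_contra hi'
      exact hi (hg i hi')).symm
  rw [h1 p hsp, h1 q hsq]
  -- both sides are extended by the weights of the other inner leg, which are then exchanged
  rw [← mul_one (∑ i ∈ _, _), ← h3 (q 1) (hsq 1), Finset.sum_mul_sum, ← Finset.sum_product']
  symm
  rw [← mul_one (∑ i ∈ _, _), ← h3 (p 1) (hsp 1), Finset.sum_mul_sum, ← Finset.sum_product']
  refine Finset.sum_nbij' (fun t => (Function.update t.1 1 t.2, t.1 1))
    (fun t => (Function.update t.1 1 t.2, t.1 1)) ?_ ?_ ?_ ?_ ?_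
  iterate 2
    rintro ⟨i, j⟩ hij
    simp only [Finset.mem_product, Fintype.mem_piFinset] at hij ⊢
    refine ⟨fun a => ?_, hij.1 1⟩
    rcases eq_or_ne a 1 with rfl | ha
    · simpa using hij.2
    · simpa [Function.update_of_ne ha] using hij.1 a
  iterate 2
    rintro ⟨i, j⟩ -
    simp
  rintro ⟨i, j⟩ -
  simp [Fin.prod_univ_three, h0, h2]
  ring

/-- The form induced by the composition depends only on the outer legs: the inner leg is
integrated out. -/
theorem legForm_comp_mul_congr (hp : ∀ a, X.src (p a) = x) (hq : ∀ a, X.src (q a) = x)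
    (h0 : p 0 = q 0) (h2 : p 2 = q 2) (α β : E₁ →L[ℝ] ℝ) :
    A.legForm ρ τ p (α ∘L (modelD X.mul (X.tri p) : E₂ →L[ℝ] E₁))
        (β ∘L (modelD X.mul (X.tri p) : E₂ →L[ℝ] E₁)) =
      A.legForm ρ τ q (α ∘L (modelD X.mul (X.tri q) : E₂ →L[ℝ] E₁))
        (β ∘L (modelD X.mul (X.tri q) : E₂ →L[ℝ] E₁)) := by
  rw [A.legForm_comp_mul ρ τ hp, A.legForm_comp_mul ρ τ hq,
    A.finsum_prod_part_congr h0 h2 fun i j => A.outerForm ρ τ i j x (p 0) (p 2) α β, h0, h2]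

theorem contMDiffAt_legForm {EN HN N : Type*} [NormedAddCommGroup EN] [NormedSpace ℝ EN]
    [TopologicalSpace HN] {J : ModelWithCorners ℝ EN HN} [TopologicalSpace N] [ChartedSpace HN N]
    [IsManifold J ∞ N] {p : N → Fin 3 → X₁} {x : N → X₀} {n : N} {z₀ : X₂}
    (hp : ∀ a, ContMDiffAt J 𝓘(ℝ, E₁) ∞ (fun m => p m a) n)
    (hpx : ∀ᶠ m in 𝓝 n, ∀ a, X.src (p m a) = x m)
    (hz₀ : X.tri (p n) ∈ (chartAt E₂ z₀).source) (ξ ζ : E₂ →L[ℝ] ℝ) :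
    ContMDiffAt J 𝓘(ℝ, ℝ) ∞ (fun m => A.legForm ρ τ (p m)
      (ξ ∘L modelChartD z₀ (X.tri (p m))) (ζ ∘L modelChartD z₀ (X.tri (p m)))) n := by
  choose s hs using fun a => A.part.locallyFinite.exists_finset (p n a)
  refine contMDiffAt_finsum_of_eventually (Fintype.piFinset s) ?_ fun i => ?_
  · filter_upwards [eventually_all.2 fun a => (hp a).continuousAt.eventually (hs a)] with m hm i hi
    obtain ⟨a, ha⟩ : ∃ a, i a ∉ s a := by simpa [Fintype.mem_piFinset] using hi
    rw [Finset.prod_eq_zero (Finset.mem_univ a) (hm a _ ha), zero_mul]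
  by_cases hi : ∀ a, p n a ∈ tsupport (A.part (i a))
  · have hs : ∀ a, p n a ∈ (A.chart (i a)).source := fun a => A.subordinate _ (hi a)
    have hsrc : ContMDiffAt J 𝓘(ℝ, E₀) ∞ (fun m => X.src (p m 0)) n :=
      X.contMDiff_src.contMDiffAt.comp n (hp 0)
    have hpx' : ∀ᶠ m in 𝓝 n, ∀ a, X.src (p m a) = X.src (p m 0) :=
      hpx.mono fun m hm a => (hm a).trans (hm 0).symm
    refine ContMDiffAt.mul ?_ ?_
    · exact contMDiffAt_finsetProd fun a _ => A.contMDiffAt_part (hp a)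
    · refine ρ.contMDiffAt_prodDual τ (Φ := A.triangle i) hsrc
        (contMDiffAt_pi_space.2 fun a => A.contMDiffAt_coord (hp a) (hs a))
        (A.contMDiffAt_uncurry_triangle (A.coord_mem_dom hpx'.self_of_nhds hs)) ?_ hz₀ ξ ζ
      filter_upwards [hpx', eventually_all.2 fun a => (hp a).continuousAt.preimage_mem_nhds
        ((A.chart (i a)).open_source.mem_nhds (hs a))] with m h1 h2
      exact A.triangle_coord h1 h2
  · push Not at hi
    obtain ⟨a, ha⟩ := hi
    refine contMDiffAt_const (c := (0 : ℝ)) |>.congr_of_eventuallyEq ?_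
    filter_upwards [(hp a).continuousAt.eventually
      ((isClosed_tsupport _).isOpen_compl.mem_nhds ha)] with m hm
    have h1 : A.part (i a) (p m a) = 0 := image_eq_zero_of_notMem_tsupport hm
    rw [Finset.prod_eq_zero (Finset.mem_univ a) h1, zero_mul]

end FibreAtlas

end LieGroupoid

/-! ### Groupoid metrics on proper groupoids -/


namespace LieGroupoid

section ProperGroupoids

variable {E₀ E₁ E₂ X₀ X₁ X₂ : Type*}
  [NormedAddCommGroup E₀] [NormedSpace ℝ E₀] [TopologicalSpace X₀] [ChartedSpace E₀ X₀]
  [NormedAddCommGroup E₁] [NormedSpace ℝ E₁] [TopologicalSpace X₁] [ChartedSpace E₁ X₁]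
  [NormedAddCommGroup E₂] [NormedSpace ℝ E₂] [TopologicalSpace X₂] [ChartedSpace E₂ X₂]
  [FiniteDimensional ℝ E₀] [IsManifold 𝓘(ℝ, E₀) ∞ X₀]
  [FiniteDimensional ℝ E₁] [IsManifold 𝓘(ℝ, E₁) ∞ X₁]
  [FiniteDimensional ℝ E₂] [IsManifold 𝓘(ℝ, E₂) ∞ X₂]
  {X : LieGroupoid E₀ E₁ E₂ X₀ X₁ X₂}

section Shift

variable (X)

/-- The origin of the legs of a triangle. -/
def origin (z : X₂) : X₀ := X.src (X.snd z)

/-- The legs of a triangle, shifted along an arrow `g` which starts at their origin. -/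
noncomputable def shift (z : X₂) (g : X₁) (a : Fin 3) : X₁ := X.op (X.leg z a) (X.inv g)

theorem contMDiff_origin : ContMDiff 𝓘(ℝ, E₂) 𝓘(ℝ, E₀) ∞ X.origin :=
  X.contMDiff_src.comp X.contMDiff_snd

variable {z : X₂} {g : X₁}

theorem src_leg_eq_tgt_inv (hg : X.src g = X.origin z) (a : Fin 3) :
    X.src (X.leg z a) = X.tgt (X.inv g) := by
  rw [X.tgt_inv, hg, X.src_leg, origin]

theorem src_shift (hg : X.src g = X.origin z) (a : Fin 3) : X.src (X.shift z g a) = X.tgt g := by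
  rw [shift, X.src_op (X.src_leg_eq_tgt_inv hg a), X.src_inv]

theorem tri_shift (hg : X.src g = X.origin z) : X.tri (X.shift z g) = z :=
  (X.tri_op (X.src_leg z) ((X.tgt_inv g).trans hg)).trans (X.tri_leg z)

theorem origin_permute (σ : Equiv.Perm (Fin 3)) (z : X₂) :
    X.origin (X.permute σ z) = X.tgt (X.leg z (σ 0)) := by
  rw [origin, ← X.src_leg _ 0, X.leg_permute, X.src_op, X.src_inv]
  rw [X.tgt_inv]

/-- A permutation of the vertices of a triangle permutes its legs up to a right translation. -/
theorem shift_permute (σ : Equiv.Perm (Fin 3)) (hg : X.src g = X.tgt (X.leg z (σ 0))) :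
    X.shift (X.permute σ z) g = X.shift z (X.op g (X.leg z (σ 0))) ∘ σ := by
  funext a
  rw [Function.comp_apply, shift, shift, X.leg_permute, X.inv_op hg, X.op_assoc]
  · rw [X.tgt_inv, X.src_leg, X.src_leg]
  · rw [X.src_inv, X.tgt_inv, hg]

end Shift

namespace FibreAtlas

variable {k : ℕ} {ι : Type*} (A : FibreAtlas X k ι) (ρ : RiemMetric E₀ X₀)
  (τ : RiemMetric (Fin k → ℝ) (Fin k → ℝ)) {c : X₀ → ℝ}

theorem contMDiffAt_legForm_shift {i : ι} {v : Fin k → ℝ} {z z₀ : X₂}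
    (hv : v ∈ A.dom i (X.origin z)) (hz : z ∈ (chartAt E₂ z₀).source) (ξ ζ : E₂ →L[ℝ] ℝ) :
    ContMDiffAt ((𝓘(ℝ, Fin k → ℝ)).prod 𝓘(ℝ, E₂)) 𝓘(ℝ, ℝ) ∞
      (fun p : (Fin k → ℝ) × X₂ => A.legForm ρ τ (X.shift p.2 (A.point i (X.origin p.2) p.1))
        (ξ ∘L modelChartD z₀ p.2) (ζ ∘L modelChartD z₀ p.2)) (v, z) := by
  have ho : ContMDiffAt ((𝓘(ℝ, Fin k → ℝ)).prod 𝓘(ℝ, E₂)) 𝓘(ℝ, E₀) ∞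
      (fun p : (Fin k → ℝ) × X₂ => X.origin p.2) (v, z) :=
    X.contMDiff_origin.contMDiffAt.comp _ contMDiffAt_snd
  have hg := A.contMDiffAt_point ho contMDiffAt_fst hv
  have hsrc : ∀ᶠ p : (Fin k → ℝ) × X₂ in 𝓝 (v, z),
      X.src (A.point i (X.origin p.2) p.1) = X.origin p.2 :=
    (A.eventually_mem_dom ho.continuousAt continuousAt_fst hv).mono
      fun p hp => A.src_point hp
  refine (A.contMDiffAt_legForm ρ τ
    (p := fun p : (Fin k → ℝ) × X₂ => X.shift p.2 (A.point i (X.origin p.2) p.1))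
    (x := fun p => X.tgt (A.point i (X.origin p.2) p.1)) (z₀ := z₀) (fun a => ?_)
    (hsrc.mono fun p hp => X.src_shift hp) ?_ ξ ζ).congr_of_eventuallyEq
    (hsrc.mono fun p hp => ?_)
  · exact X.contMDiffAt_op ((X.contMDiff_leg a).contMDiffAt.comp _ contMDiffAt_snd)
      (X.contMDiffAt_inv hg) (hsrc.mono fun p hp => X.src_leg_eq_tgt_inv hp a)
  · rwa [X.tri_shift hsrc.self_of_nhds]
  · simp only
    rw [X.tri_shift hp]

theorem fibreContinuous_legForm_shift (z : X₂) (α β : E₂ →L[ℝ] ℝ) :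
    A.FibreContinuous (X.origin z) fun g => A.legForm ρ τ (X.shift z g) α β := by
  intro i v hv
  have h1 := A.contMDiffAt_legForm_shift ρ τ hv (mem_chart_source E₂ z)
    (α ∘L (chartD (E := E₂) z z).inverse) (β ∘L (chartD (E := E₂) z z).inverse)
  have h2 := h1.continuousAt.comp (f := fun u => (u, z)) (x := v) (by fun_prop)
  have h3 : ∀ ξ : E₂ →L[ℝ] ℝ,
      (ξ ∘L (chartD (E := E₂) z z).inverse) ∘L modelChartD z z = ξ := fun ξ =>
    comp_chartD_comp_inverse (mem_chart_source E₂ z) ξ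
  simp only [Function.comp_def, h3] at h2
  exact h2.continuousWithinAt

/-- The cometric on the triangles of a proper groupoid: the form of the shifted legs is averaged
over all shifts. -/
noncomputable def cometric (c : X₀ → ℝ) (z : X₂) (α β : E₂ →L[ℝ] ℝ) : ℝ :=
  A.integral c (X.origin z) fun g => A.legForm ρ τ (X.shift z g) α β

variable [T2Space X₀] (hc : X.IsCutoff c)

include hc

theorem isCometric_cometric : IsCometric (E := E₂) (X := X₂) (A.cometric ρ τ c) where
  symm z α β := A.integral_congr fun g _ => A.legForm_symm ρ τ _ _
  add_left z α α' β := by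
    refine (A.integral_congr fun g _ => A.legForm_add_left ρ τ _ _ _).trans ?_
    exact A.integral_add hc (A.fibreContinuous_legForm_shift ρ τ z _ _)
      (A.fibreContinuous_legForm_shift ρ τ z _ _)
  smul_left z a α β := by
    refine (A.integral_congr fun g _ => A.legForm_smul_left ρ τ _ _ _).trans ?_
    exact A.integral_const_mul a _
  pos z α hα := A.integral_pos hc (A.fibreContinuous_legForm_shift ρ τ z _ _)
    fun g hg => A.legForm_pos ρ τ (X.src_shift hg) hα
  smooth z₀ ξ ζ := by
    refine A.contMDiffAt_integral hc (f := X.origin) (F := fun z g => A.legForm ρ τ (X.shift z g)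
      (ξ ∘L modelChartD z₀ z) (ζ ∘L modelChartD z₀ z)) X.contMDiff_origin ?_
    filter_upwards [(chartAt E₂ z₀).open_source.mem_nhds (mem_chart_source E₂ z₀)] with z hz i v hv
    exact A.contMDiffAt_legForm_shift ρ τ hv hz ξ ζ

theorem cometric_permute (σ : Equiv.Perm (Fin 3)) (z : X₂) (α β : E₂ →L[ℝ] ℝ) :
    A.cometric ρ τ c (X.permute σ z) α β = A.cometric ρ τ c z
      (α ∘L (modelD (X.permute σ) z : E₂ →L[ℝ] E₂))
      (β ∘L (modelD (X.permute σ) z : E₂ →L[ℝ] E₂)) := by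
  have hs : X.src (X.leg z (σ 0)) = X.origin z := X.src_leg z _
  rw [cometric, cometric, X.origin_permute, ← hs]
  refine Eq.trans (A.integral_congr fun g hg => ?_) (A.integral_comp_op hc
    (h := X.leg z (σ 0)) (hs ▸ A.fibreContinuous_legForm_shift ρ τ z _ _))
  have hg' : X.src (X.op g (X.leg z (σ 0))) = X.origin z := (X.src_op hg).trans hs
  rw [X.shift_permute σ hg, A.legForm_comp_perm ρ τ (X.src_shift hg') σ, X.tri_shift hg']

omit hc [T2Space X₀] in
theorem cometric_mul {z z' : X₂} (h : X.mul z = X.mul z') (α β : E₁ →L[ℝ] ℝ) :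
    A.cometric ρ τ c z (α ∘L (modelD X.mul z : E₂ →L[ℝ] E₁))
        (β ∘L (modelD X.mul z : E₂ →L[ℝ] E₁)) =
      A.cometric ρ τ c z' (α ∘L (modelD X.mul z' : E₂ →L[ℝ] E₁))
        (β ∘L (modelD X.mul z' : E₂ →L[ℝ] E₁)) := by
  have ho : X.origin z = X.origin z' := by
    rw [origin, origin, ← X.src_mul, ← X.src_mul, h]
  rw [cometric, cometric, ← ho]
  refine A.integral_congr fun g hg => ?_
  have h1 := A.legForm_comp_mul_congr ρ τ (X.src_shift hg) (X.src_shift (hg.trans ho))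
    (by rw [shift, shift]; congr 1; exact congrArg X.unit ho)
    (by rw [shift, shift]; congr 1) α β
  rwa [X.tri_shift hg, X.tri_shift (hg.trans ho)] at h1

end FibreAtlas

/-- Proper groupoids carry groupoid metrics. -/
theorem IsProper.exists_isGroupoidMetric [T2Space X₀] [SecondCountableTopology X₀] [T2Space X₁]
    [SecondCountableTopology X₁] (hX : X.IsProper) :
    ∃ η : RiemMetric E₂ X₂, X.IsGroupoidMetric η := by
  obtain ⟨c, hc⟩ := hX.exists_isCutoff
  obtain ⟨k, ⟨A⟩⟩ := X.exists_fibreAtlas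
  obtain ⟨ρ⟩ := exists_riemMetric E₀ X₀
  obtain ⟨τ⟩ := exists_riemMetric_self (Fin k → ℝ)
  obtain ⟨η, hη⟩ := (A.isCometric_cometric ρ τ hc).exists_metric
  refine ⟨η, fun σ => ?_, fun z z' h α β => ?_⟩
  · refine RiemMetric.IsRiemannianSubmersion.isPreservedBy (fun z α β => ?_)
      fun z => (X.isInvertible_mfderiv_permute σ z).injective
    rw [hη, hη]
    exact (A.cometric_permute ρ τ hc σ z α β).symm
  · rw [hη, hη]
    -- the covectors at `mul z` and `mul z'` are compared in the model space
    have hcast : ∀ (γ : ∀ b : X₁, TangentSpace 𝓘(ℝ, E₁) b →L[ℝ] ℝ) (b b' : X₁), b = b' →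
        (γ b : E₁ →L[ℝ] ℝ) = γ b' := by
      rintro γ b _ rfl
      rfl
    refine (A.cometric_mul ρ τ h (α (X.mul z)) (β (X.mul z))).trans ?_
    rw [hcast α _ _ h, hcast β _ _ h]
    rfl

end ProperGroupoids

end LieGroupoid

end

theorem theorem3
    {F₀ F₁ F₂ G₀ G₁ G₂ : Type*}
    [NormedAddCommGroup F₀] [NormedSpace ℝ F₀] [FiniteDimensional ℝ F₀]
    [NormedAddCommGroup F₁] [NormedSpace ℝ F₁] [FiniteDimensional ℝ F₁]
    [NormedAddCommGroup F₂] [NormedSpace ℝ F₂] [FiniteDimensional ℝ F₂]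
    [TopologicalSpace G₀] [T2Space G₀] [ChartedSpace F₀ G₀] [Group G₀]
    [TopologicalSpace G₁] [T2Space G₁] [ChartedSpace F₁ G₁] [Group G₁]
    [TopologicalSpace G₂] [ChartedSpace F₂ G₂] [IsManifold 𝓘(ℝ, F₂) ∞ G₂] [Group G₂]
    [MeasurableSpace G₀] [BorelSpace G₀] [MeasurableSpace G₁] [BorelSpace G₁]
    [MeasurableSpace G₂] [BorelSpace G₂]
    (G : LieGroupoid F₀ F₁ F₂ G₀ G₁ G₂) (hG : G.IsLieTwoGroup) [CompactSpace G₁]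
    {E₀ E₁ E₂ X₀ X₁ X₂ : Type*}
    [NormedAddCommGroup E₀] [NormedSpace ℝ E₀] [FiniteDimensional ℝ E₀]
    [NormedAddCommGroup E₁] [NormedSpace ℝ E₁] [FiniteDimensional ℝ E₁]
    [NormedAddCommGroup E₂] [NormedSpace ℝ E₂] [FiniteDimensional ℝ E₂]
    [TopologicalSpace X₀] [ChartedSpace E₀ X₀] [IsManifold 𝓘(ℝ, E₀) ∞ X₀]
    [TopologicalSpace X₁] [ChartedSpace E₁ X₁] [IsManifold 𝓘(ℝ, E₁) ∞ X₁]
    [TopologicalSpace X₂] [ChartedSpace E₂ X₂] [IsManifold 𝓘(ℝ, E₂) ∞ X₂]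
    (X : LieGroupoid E₀ E₁ E₂ X₀ X₁ X₂)
    [MulAction G₀ X₀] [MulAction G₁ X₁] (hθ : LieGroupoid.IsTwoAction G X) :
    -- cotangent averaging of a groupoid metric over normalized Haar measure
    (∀ (η : RiemMetric E₂ X₂), X.IsGroupoidMetric η →
      ∀ (μ₂ : Measure G₂) (μ₁ : Measure G₁) (μ₀ : Measure G₀)
        [μ₂.IsHaarMeasure] [IsProbabilityMeasure μ₂]
        [μ₁.IsHaarMeasure] [IsProbabilityMeasure μ₁]
        [μ₀.IsHaarMeasure] [IsProbabilityMeasure μ₀],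
      ∃ ηbar : RiemMetric E₂ X₂,
        ηbar.IsCotangentAverage η hθ.act₂ μ₂ ∧
        X.IsGroupoidMetric ηbar ∧
        hθ.IsIsometric ηbar ∧
        -- the induced metrics on arrows and objects are averaged in the same way
        ∃ (η₁ ηbar₁ : RiemMetric E₁ X₁) (η₀ ηbar₀ : RiemMetric E₀ X₀),
          X.IsInduced η η₁ η₀ ∧ X.IsInduced ηbar ηbar₁ ηbar₀ ∧
          ηbar₁.IsCotangentAverage η₁ (fun (g : G₁) (p : X₁) => g • p) μ₁ ∧
          ηbar₀.IsCotangentAverage η₀ (fun (g : G₀) (x : X₀) => g • x) μ₀) ∧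
    -- existence of an invariant groupoid metric on a proper groupoid
    (T2Space X₀ → T2Space X₁ → SecondCountableTopology X₀ → SecondCountableTopology X₁ →
      X.IsProper →
      ∃ ηbar : RiemMetric E₂ X₂, X.IsGroupoidMetric ηbar ∧ hθ.IsIsometric ηbar) := by
  refine ⟨fun η hη μ₂ μ₁ μ₀ _ _ _ _ _ _ => hη.exists_average hG hθ μ₂ μ₁ μ₀, ?_⟩
  intro _ _ _ _ hX
  obtain ⟨η, hη⟩ := hX.exists_isGroupoidMetric
  exact hη.exists_isIsometric hG hθ
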